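/- Let $\mathbf k$ be a field. **Filtered dg-categories.** A filtration function on a cochain complex $(C,d)$ over $\mathbf k$ is given by functions $\ell\colon C^n\to\mathbb R\cup\{-\infty\}$ with $\ell(f)=-\infty\iff f=0$, $\ell(af+g)\le\max(\ell(f),\ell(g))$ for $a\in\mathbf k\setminus\{0\}$, and $\ell(df)\le\ell(f)$; put $C^{\le r}=\{f:\ell(f)\le r\}$. A filtered dg-category $\mathcal A$ is a dg-category over $\mathbf k$ whose morphism complexes $\hom(X,Y)$ carry filtration functions with $\ell(g\circ f)\le\ell(g)+\ell(f)$ and $\ell(1_X)\le 0$ (equivalently, $\ell(1_X)=0$ unless $1_X=0$). The Leibniz rule is $d(gf)=(dg)f+(-1)^{|g|}g\,(df)$. A filtered dg-functor is a dg-functor with $\ell(F(f))\le\ell(f)$; it is an equivalence if it induces bijections on morphisms preserving $\ell$, and if every object of the target is isomorphic to an object in the image via closed mutually inverse morphisms of degree $0$ with $\ell\le 0$. $H^0(\mathcal A)$ has the objects of $\mathcal A$ and morphism spaces $\hom^r(X,Y)=H^0(\hom^{\le r}(X,Y))$, $r\in\mathbb R$, with the maps $i_{r,s}\colon\hom^r(X,Y)\to\hom^s(X,Y)$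 ($r\le s$) induced by inclusion. **Twisted complexes.** The shift completion $\Sigma\mathcal A$ has objects $\Sigma^rX[d]$ ($X\in\mathcal A$, $r\in\mathbb R$, $d\in\mathbb Z$), morphisms of degree $n$ from $\Sigma^rX[d]$ to $\Sigma^sY[e]$ being $\hom^{n+e-d}_{\mathcal A}(X,Y)$ with filtration function $\ell_{\mathcal A}+s-r$, differential $(-1)^e d_{\mathcal A}$ and the composition of $\mathcal A$. An object of $Tw(\mathcal A)$ is a filtered one-sided twisted complex: a finite (possibly empty) sum $\bigoplus_{i=1}^m\Sigma^{r_i}X_i[d_i]$ with a strictly upper triangular matrix $q=(q_{ij})$ of morphisms of degree $1$ of $\Sigma\mathcal A$ with $dq+q^2=0$ and $\ell(q_{ij})\le0$. Morphisms $f=(f_{ij})$ are matrices of morphisms of $\Sigma\mathcal A$, composed by matrix multiplication, with $d_{Tw}f=(df_{ij})+q'f-(-1)^{|f|}fq$ and $\ell(f)=\max_{i,j}\ell(f_{ij})$. $Tw(\mathcal A)$ is a filtered dg-category. Put $\Sigma^sX=(\bigoplus\Sigma^{r_i+s}X_i[d_i],q)$ and $X[n]=(\bigoplus\Sigma^{r_i}X_i[d_i+n],(-1)^nq)$;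 for a closed $f\colon X\to Y$ of degree $0$ with $\ell(f)\le0$, $\mathrm{Cone}(f)=\bigl(Y\oplus X[1],\begin{pmatrix}q_Y&f\\0&-q_X\end{pmatrix}\bigr)$, with the inclusion $i\colon Y\to\mathrm{Cone}(f)$ and the projection $\pi\colon\mathrm{Cone}(f)\to X[1]$. $\mathcal A$ is called pre-triangulated if the inclusion $\mathcal A\hookrightarrow Tw(\mathcal A)$, sending $X$ to the one-term complex $\Sigma^0X[0]$ with $q=0$, is an equivalence of filtered dg-categories. **Triangulated persistence categories.** A persistence category $\mathcal C$ has morphism spaces $\hom^r(A,B)$, $r\in\mathbb R$, which are $\mathbf k$-vector spaces with structure maps $i_{r,s}$ ($r\le s$), and unital associative bilinear compositions $\hom^s(B,C)\times\hom^r(A,B)\to\hom^{r+s}(A,C)$ compatible with the $i_{r,s}$, with $1_A\in\hom^0(A,A)$. Its $0$-level $\mathcal C_0$ has the same objects and the morphism spaces $\hom^0$. An object $K$ is $r$-acyclic ($r\ge 0$) if $i_{0,r}(1_K)=0$. A persistence functor is given by linear maps on each $\hom^r$ compatible with the $i_{r,s}$, identities and compositions. A shift functor is a (strong) monoidal functor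 $\Sigma$ from $(\mathbb R,+)$, with exactly one morphism $\eta_{r,s}\colon r\to s$ for all $r,s\in\mathbb R$, to the persistence endofunctors of $\mathcal C$, the natural transformation $\eta_{r,s}\colon\Sigma^r\to\Sigma^s$ having shift $s-r$. For $r\ge0$ let $\eta^A_r\colon\Sigma^rA\to A$ be the morphism of $\mathcal C_0$ obtained from $(\eta_{r,0})_A\in\hom^{-r}(\Sigma^rA,\Sigma^0A)$ by $i_{-r,0}$ and $\Sigma^0A\cong A$. $(\mathcal C,\Sigma)$ is a triangulated persistence category (TPC) if 1. $\mathcal C_0$ is a triangulated category (with the octahedral axiom, and with an additive auto-equivalence $T$ as translation functor), and direct sums $A\oplus B$ in $\mathcal C_0$ induce $\hom^r(A\oplus B,D)\cong\hom^r(A,D)\oplus\hom^r(B,D)$ and $\hom^r(D,A\oplus B)\cong\hom^r(D,A)\oplus\hom^r(D,B)$ for all $r\in\mathbb R$; 2. each $\Sigma^r$ restricts to a triangulated functor on $\mathcal C_0$, and the isomorphisms $\Sigma^rT\cong T\Sigma^r$ are compatible with the monoidal structure of $\Sigma$ and with the morphisms $\Sigma^rA\to\Sigma^sA$ ($s\le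 r$) of $\mathcal C_0$ given by $\eta_{r,s}$; 3. for all $r\ge0$ and $A$ there is an exact triangle $\Sigma^rA\xrightarrow{\eta^A_r}A\to K\to T\Sigma^rA$ with $K$ $r$-acyclic. It is strict if moreover $\Sigma$ is strictly monoidal, $T$ is an automorphism of $\mathcal C_0$, and $\Sigma^rT=T\Sigma^r$. **Theorem.** (a) For every filtered dg-category $\mathcal A$, $H^0(Tw(\mathcal A))$ is a strict triangulated persistence category, with the shift functor given by $X\mapsto\Sigma^rX$ and by identity matrices as the $\eta_{r,s}$, with translation functors $T^n$ given by $X\mapsto X[n]$, and with exact triangles those isomorphic in $H^0(Tw(\mathcal A))_0$ to $X\xrightarrow{f}Y\xrightarrow{i}\mathrm{Cone}(f)\xrightarrow{\pi}X[1]$ for a closed $f$ of degree $0$ with $\ell(f)\le0$. (b) For every filtered pre-triangulated dg-category $\mathcal A$, $H^0(\mathcal A)$ is a triangulated persistence category, i.e. there are a shift functor on $H^0(\mathcal A)$ and a triangulated structure on $H^0(\mathcal A)_0$ with the properties above. (c) The filtered dg-category $\mathcal{FK}_{\mathbf k}$ of filtered cochain complexes $(X,\partial,\ell)$ over $\mathbf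 k$, whose morphisms of degree $n$ are the graded linear maps $f$ of degree $n$ for which $\{r\in\mathbb R:\ell(f(x))\le\ell(x)+r\ \forall x\}$ is non-empty, with $\ell(f)$ the infimum of this set ($-\infty$ for $f=0$) and $df=\partial f-(-1)^nf\partial$, is pre-triangulated; and $H^0(\mathcal{FK}_{\mathbf k})$ is a strict triangulated persistence category with $\Sigma^r(X,\partial,\ell)=(X,\partial,\ell+r)$, the $\eta_{r,s}$ induced by identities, and $T(X,\partial,\ell)=(X[1],-\partial,\ell)$. -/

import Mathlib

open CategoryTheory CategoryTheory.Limits CategoryTheory.Pretriangulated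

universe w v u v' u'

namespace FiltDG

/-! ### Persistence categories -/

/-- A persistence category over the field `k`: for all objects `A`, `B` a persistence `k`-module
`r ↦ hom A B r` (a functor from `(ℝ, ≤)` to `k`-vector spaces, with structure maps `map`), together
with unital associative bilinear compositions `hom B C s × hom A B r → hom A C (s + r)` compatible
with the structure maps.  The index `t` and the proof of `s + r = t` only serve to avoid casts;
`comp h g f` is `g ∘ f`. -/
class PersistenceCategory (k : Type w) [Field k] (C : Type u) where
  hom : C → C → ℝ → Type v
  [addCommGroup : ∀ A B r, AddCommGroup (hom A B r)]
  [module : ∀ A B r, Module k (hom A B r)]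
  map : ∀ {A B : C} {r s : ℝ}, r ≤ s → (hom A B r →ₗ[k] hom A B s)
  map_refl : ∀ {A B : C} {r : ℝ} (f : hom A B r), map (le_refl r) f = f
  map_map : ∀ {A B : C} {r s t : ℝ} (h₁ : r ≤ s) (h₂ : s ≤ t) (f : hom A B r),
    map h₂ (map h₁ f) = map (h₁.trans h₂) f
  comp : ∀ {A B D : C} {s r t : ℝ}, s + r = t → (hom B D s →ₗ[k] hom A B r →ₗ[k] hom A D t)
  map_comp : ∀ {A B D : C} {s r t s' r' t' : ℝ} (h : s + r = t) (h' : s' + r' = t')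
    (hs : s ≤ s') (hr : r ≤ r') (ht : t ≤ t') (g : hom B D s) (f : hom A B r),
    map ht (comp h g f) = comp h' (map hs g) (map hr f)
  id : ∀ A : C, hom A A 0
  id_comp : ∀ {A B : C} {r : ℝ} (f : hom A B r), comp (zero_add r) (id B) f = f
  comp_id : ∀ {A B : C} {r : ℝ} (f : hom A B r), comp (add_zero r) f (id A) = f
  assoc : ∀ {A B D E : C} {a b c ab bc abc : ℝ} (h₁ : a + b = ab) (h₂ : ab + c = abc)
    (h₃ : b + c = bc) (h₄ : a + bc = abc) (x : hom D E a) (y : hom B D b) (z : hom A B c),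
    comp h₂ (comp h₁ x y) z = comp h₄ x (comp h₃ y z)

attribute [reducible, instance] PersistenceCategory.addCommGroup PersistenceCategory.module

namespace PersistenceCategory

variable (k : Type w) [Field k] {C : Type u} [PersistenceCategory.{w, v} k C]

/-- The identity of `A`, regarded as a morphism `A → B` of shift `0` when `A = B`. -/
def eqTo {A B : C} (h : A = B) : hom k A B 0 := h ▸ id A

lemma comp_add_aux {A B D : C} (g : hom k B D 0) (f f' : hom k A B 0) :
    comp (add_zero (0 : ℝ)) g (f + f') =
      comp (add_zero (0 : ℝ)) g f + comp (add_zero (0 : ℝ)) g f' := by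
  simp

lemma add_comp_aux {A B D : C} (g g' : hom k B D 0) (f : hom k A B 0) :
    comp (add_zero (0 : ℝ)) (g + g') f =
      comp (add_zero (0 : ℝ)) g f + comp (add_zero (0 : ℝ)) g' f := by
  simp

/-- An object `K` is `r`-acyclic (`r ≥ 0`) if the image of its identity under `i_{0,r}`
vanishes. -/
def IsAcyclic (r : ℝ) (hr : 0 ≤ r) (K : C) : Prop :=
  map hr (id K : hom k K K 0) = 0

end PersistenceCategory

section

open PersistenceCategory

section

variable (k : Type w) [Field k]

/-- The `0`-level of a persistence category: same objects, morphisms of shift `0`. -/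
structure Level0 (k : Type w) (C : Type u) where
  obj : C

instance Level0.category (C : Type u) [PersistenceCategory.{w, v} k C] :
    Category.{v} (Level0 k C) where
  Hom A B := hom k A.obj B.obj 0
  id A := PersistenceCategory.id A.obj
  comp f g := comp (add_zero (0 : ℝ)) g f
  id_comp f := comp_id f
  comp_id f := by
    convert id_comp f
  assoc f g h := (assoc _ _ _ _ h g f).symm

instance Level0.preadditive (C : Type u) [PersistenceCategory.{w, v} k C] :
    Preadditive (Level0 k C) where
  homGroup A B := PersistenceCategory.addCommGroup A.obj B.obj 0
  add_comp _ _ _ f f' g := comp_add_aux k g f f'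
  comp_add _ _ _ f g g' := add_comp_aux k g g' f

end

/-- A persistence functor: a functor given by linear maps on the spaces of morphisms of each
shift, compatible with the persistence structure maps. -/
structure PersFunctor (k : Type w) [Field k] (C : Type u) (D : Type u')
    [PersistenceCategory.{w, v} k C] [PersistenceCategory.{w, v'} k D] where
  obj : C → D
  map : ∀ {A B : C} {r : ℝ}, hom k A B r →ₗ[k] hom k (obj A) (obj B) r
  map_pers : ∀ {A B : C} {r s : ℝ} (h : r ≤ s) (f : hom k A B r),
    map (PersistenceCategory.map h f) = PersistenceCategory.map h (map f)
  map_id : ∀ A : C, map (PersistenceCategory.id A) = PersistenceCategory.id (k := k) (obj A)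
  map_comp : ∀ {A B E : C} {s r t : ℝ} (h : s + r = t) (g : hom k B E s) (f : hom k A B r),
    map (comp h g f) = comp h (map g) (map f)

namespace PersFunctor

variable (k : Type w) [Field k] {C : Type u} [PersistenceCategory.{w, v} k C]

/-- The identity persistence functor. -/
@[reducible]
def refl (C : Type u) [PersistenceCategory.{w, v} k C] : PersFunctor k C C where
  obj A := A
  map := LinearMap.id
  map_pers _ _ := rfl
  map_id _ := rfl
  map_comp _ _ _ := rfl

variable {k}

/-- The composition of persistence functors: first `F`, then `G`. -/
@[reducible]
def trans (F G : PersFunctor k C C) : PersFunctor k C C where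
  obj A := G.obj (F.obj A)
  map := G.map ∘ₗ F.map
  map_pers h f := by simp [F.map_pers, G.map_pers]
  map_id A := by simp [F.map_id, G.map_id]
  map_comp h g f := by simp [F.map_comp, G.map_comp]

/-- The restriction of a persistence functor to the `0`-levels. -/
def level0 (F : PersFunctor k C C) : Level0 k C ⥤ Level0 k C where
  obj A := ⟨F.obj A.obj⟩
  map f := F.map f
  map_id A := F.map_id A.obj
  map_comp f g := F.map_comp _ g f

instance (F : PersFunctor k C C) : F.level0.Additive where
  map_add {_ _ f g} := map_add F.map f g

end PersFunctor

/-- A persistence natural transformation of shift `r`. -/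
structure PersNatTrans {k : Type w} [Field k] {C : Type u} [PersistenceCategory.{w, v} k C]
    (F G : PersFunctor k C C) (r : ℝ) where
  app : ∀ A : C, hom k (F.obj A) (G.obj A) r
  naturality : ∀ {A B : C} {s t : ℝ} (h : r + s = t) (h' : s + r = t) (f : hom k A B s),
    comp h (app B) (F.map f) = comp h' (G.map f) (app A)

/-- An isomorphism of persistence functors: persistence natural transformations of shift `0`
inverse to each other. -/
structure PersNatIso {k : Type w} [Field k] {C : Type u} [PersistenceCategory.{w, v} k C]
    (F G : PersFunctor k C C) where
  hom : PersNatTrans F G 0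
  inv : PersNatTrans G F 0
  hom_inv : ∀ A : C, comp (add_zero 0) (inv.app A) (hom.app A) = PersistenceCategory.id (F.obj A)
  inv_hom : ∀ A : C, comp (add_zero 0) (hom.app A) (inv.app A) = PersistenceCategory.id (G.obj A)

/-- A shift functor on a persistence category `C`: a monoidal functor `Σ` from `(ℝ, +)`, in which
there is exactly one morphism `r ⟶ s` for all `r`, `s`, to the persistence endofunctors of `C`,
such that the image `η r s : Σ^r → Σ^s` of `r ⟶ s` has shift `s - r`.  The coherence
isomorphisms `unit : 1 ≅ Σ^0` and `mul r s : Σ^s ∘ Σ^r ≅ Σ^(r+s)` are part of the data; the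
functor is strictly monoidal if they are identities, see `ShiftFunctor.IsStrict`.
In `unit_mul`, `mul_unit` and `mul_mul` the map `PersistenceCategory.map` only replaces the index
`0` by an equal one. -/
structure ShiftFunctor (k : Type w) [Field k] (C : Type u) [PersistenceCategory.{w, v} k C] where
  functor : ℝ → PersFunctor k C C
  η : ∀ r s : ℝ, PersNatTrans (functor r) (functor s) (s - r)
  η_self : ∀ (r : ℝ) (A : C),
    PersistenceCategory.map (sub_self r).le ((η r r).app A) =
      PersistenceCategory.id ((functor r).obj A)
  η_comp : ∀ (r s t : ℝ) (A : C),
    comp (sub_add_sub_cancel t s r) ((η s t).app A) ((η r s).app A) = (η r t).app A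
  unit : PersNatIso (PersFunctor.refl k C) (functor 0)
  mul : ∀ r s : ℝ, PersNatIso ((functor r).trans (functor s)) (functor (r + s))
  mul_natural : ∀ (r r' s s' : ℝ) (A : C),
    comp (show 0 + (r' + s' - (r + s)) = r' + s' - (r + s) by ring)
        ((mul r' s').hom.app A)
        (comp (show (s' - s) + (r' - r) = r' + s' - (r + s) by ring)
          ((η s s').app ((functor r').obj A)) ((functor s).map ((η r r').app A))) =
      comp (add_zero _) ((η (r + s) (r' + s')).app A) ((mul r s).hom.app A)
  unit_mul : ∀ (s : ℝ) (A : C),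
    comp (add_zero 0) ((mul 0 s).hom.app A) ((functor s).map (unit.hom.app A)) =
      PersistenceCategory.map (show 0 + s - s ≤ 0 by simp) ((η s (0 + s)).app A)
  mul_unit : ∀ (r : ℝ) (A : C),
    comp (add_zero 0) ((mul r 0).hom.app A) (unit.hom.app ((functor r).obj A)) =
      PersistenceCategory.map (show r + 0 - r ≤ 0 by simp) ((η r (r + 0)).app A)
  mul_mul : ∀ (r s t : ℝ) (A : C),
    comp (add_zero 0) ((mul r (s + t)).hom.app A) ((mul s t).hom.app ((functor r).obj A)) =
      comp (add_zero 0)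
        (PersistenceCategory.map (show r + (s + t) - (r + s + t) ≤ 0 by linarith)
          ((η (r + s + t) (r + (s + t))).app A))
        (comp (add_zero 0) ((mul (r + s) t).hom.app A) ((functor t).map ((mul r s).hom.app A)))

namespace ShiftFunctor

variable {k : Type w} [Field k] {C : Type u} [PersistenceCategory.{w, v} k C]

/-- The shift functor is a strict monoidal functor: `Σ^0 = 1` and `Σ^s ∘ Σ^r = Σ^(r+s)`, and the
coherence isomorphisms are identities. -/
def IsStrict (S : ShiftFunctor k C) : Prop :=
  (∀ A : C, ∃ h : A = (S.functor 0).obj A, S.unit.hom.app A = eqTo k h) ∧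
  ∀ (r s : ℝ) (A : C),
    ∃ h : (S.functor s).obj ((S.functor r).obj A) = (S.functor (r + s)).obj A,
      (S.mul r s).hom.app A = eqTo k h

/-- The component `A ⟶ Σ^0 A` of `unit`, as a morphism of the `0`-level. -/
def unit₀ (S : ShiftFunctor k C) (A : Level0 k C) : A ⟶ (S.functor 0).level0.obj A :=
  S.unit.hom.app A.obj

/-- The component `Σ^s (Σ^r A) ⟶ Σ^(r+s) A` of `mul r s`, as a morphism of the `0`-level. -/
def mul₀ (S : ShiftFunctor k C) (r s : ℝ) (A : Level0 k C) :
    (S.functor s).level0.obj ((S.functor r).level0.obj A) ⟶ (S.functor (r + s)).level0.obj A :=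
  (S.mul r s).hom.app A.obj

/-- For `s ≤ r`, the morphism `Σ^r A ⟶ Σ^s A` of shift `0` which is the image of
`(η_{r,s})_A` under `i_{s-r,0}`. -/
def η₀ (S : ShiftFunctor k C) {r s : ℝ} (h : s ≤ r) (A : Level0 k C) :
    (S.functor r).level0.obj A ⟶ (S.functor s).level0.obj A :=
  PersistenceCategory.map (sub_nonpos.2 h) ((S.η r s).app A.obj)

/-- The morphism `η^A_r : Σ^r A ⟶ A` of the `0`-level, for `r ≥ 0`; here `Σ^0 A` is identified
with `A`. -/
def ηA (S : ShiftFunctor k C) (r : ℝ) (hr : 0 ≤ r) (A : Level0 k C) :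
    (S.functor r).level0.obj A ⟶ A :=
  S.η₀ hr A ≫ (show (S.functor 0).level0.obj A ⟶ A from S.unit.inv.app A.obj)

end ShiftFunctor

/-- The structure of a triangulated persistence category on the persistence category `C` with
shift functor `S`. The triangulated category axioms (including the octahedral axiom) for the
`0`-level are those of Mathlib, the translation functor being `X ↦ X⟦1⟧`. -/
structure TPC (k : Type w) [Field k] (C : Type u) [PersistenceCategory.{w, v} k C]
    (S : ShiftFunctor k C) where
  -- the `0`-level is a triangulated category
  [hasZeroObject : HasZeroObject (Level0 k C)]
  [hasShift : HasShift (Level0 k C) ℤ]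
  [shiftAdditive : ∀ n : ℤ, (shiftFunctor (Level0 k C) n).Additive]
  [pretriangulated : Pretriangulated (Level0 k C)]
  [isTriangulated : IsTriangulated (Level0 k C)]
  -- direct sums in the `0`-level induce direct sum decompositions of the morphisms of any shift
  -- (by `PersistenceCategory.map_comp` the persistence structure maps respect them)
  bijective_biprod_left : ∀ (A B D : Level0 k C) (b : BinaryBicone A B) (_ : b.IsBilimit) (r : ℝ),
    Function.Bijective fun f : hom k b.pt.obj D.obj r =>
      ((comp (add_zero r) f b.inl : hom k A.obj D.obj r),
        (comp (add_zero r) f b.inr : hom k B.obj D.obj r))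
  bijective_biprod_right : ∀ (A B D : Level0 k C) (b : BinaryBicone A B) (_ : b.IsBilimit) (r : ℝ),
    Function.Bijective fun f : hom k D.obj b.pt.obj r =>
      ((comp (zero_add r) b.fst f : hom k D.obj A.obj r),
        (comp (zero_add r) b.snd f : hom k D.obj B.obj r))
  -- each `Σ^r` is a triangulated functor on the `0`-level (additivity, and the compatibility of
  -- the `η` with direct sums, are part of linearity and naturality)
  [commShift : ∀ r : ℝ, (S.functor r).level0.CommShift ℤ]
  [functor_isTriangulated : ∀ r : ℝ, (S.functor r).level0.IsTriangulated]
  -- the commutation of `Σ` with the translation is compatible with the monoidal structure of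
  -- `Σ` and with the `η`
  unit_translate : ∀ A : Level0 k C,
    S.unit₀ (A⟦(1 : ℤ)⟧) ≫ ((S.functor 0).level0.commShiftIso (1 : ℤ)).hom.app A =
      (S.unit₀ A)⟦(1 : ℤ)⟧'
  mul_translate : ∀ (r s : ℝ) (A : Level0 k C),
    S.mul₀ r s (A⟦(1 : ℤ)⟧) ≫ ((S.functor (r + s)).level0.commShiftIso (1 : ℤ)).hom.app A =
      (S.functor s).level0.map (((S.functor r).level0.commShiftIso (1 : ℤ)).hom.app A) ≫
        ((S.functor s).level0.commShiftIso (1 : ℤ)).hom.app ((S.functor r).level0.obj A) ≫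
          (S.mul₀ r s A)⟦(1 : ℤ)⟧'
  η_translate : ∀ (r s : ℝ) (h : s ≤ r) (A : Level0 k C),
    S.η₀ h (A⟦(1 : ℤ)⟧) ≫ ((S.functor s).level0.commShiftIso (1 : ℤ)).hom.app A =
      ((S.functor r).level0.commShiftIso (1 : ℤ)).hom.app A ≫ (S.η₀ h A)⟦(1 : ℤ)⟧'
  -- `η^A_r` embeds into an exact triangle with `r`-acyclic third object
  exists_acyclic : ∀ (r : ℝ) (hr : 0 ≤ r) (A : Level0 k C),
    ∃ (K : Level0 k C) (g : A ⟶ K) (h : K ⟶ ((S.functor r).level0.obj A)⟦(1 : ℤ)⟧),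
      Triangle.mk (S.ηA r hr A) g h ∈
        distTriang (Level0 k C) ∧
      IsAcyclic k r hr K.obj

/-- A triangulated persistence category is strict if its shift functor is a strict monoidal
functor, its translation functor `T` is an automorphism (not just an auto-equivalence) of the
`0`-level, and `Σ^r T = T Σ^r` on the nose. -/
def TPC.IsStrict {k : Type w} [Field k] {C : Type u} [PersistenceCategory.{w, v} k C]
    {S : ShiftFunctor k C} (t : TPC k C S) : Prop :=
  letI := t.hasShift
  letI := t.commShift
  S.IsStrict ∧
  Function.Bijective (fun A : Level0 k C => A⟦(1 : ℤ)⟧) ∧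
  ∀ (r : ℝ) (A : Level0 k C),
    ∃ h : (S.functor r).level0.obj (A⟦(1 : ℤ)⟧) = ((S.functor r).level0.obj A)⟦(1 : ℤ)⟧,
      ((S.functor r).level0.commShiftIso (1 : ℤ)).hom.app A = eqToHom h

/-! ### Shift functors from shifted objects -/

/-- The category with the same objects as a persistence category `C` whose morphisms are the pairs
of a real number `r` and a morphism of shift `r`. -/
structure Total (k : Type w) (C : Type u) where
  obj : C

namespace Total

variable (k : Type w) [Field k] {C : Type u} [PersistenceCategory.{w, v} k C]

lemma mk_comp_aux {A B D : C} {s r t : ℝ} (h : s + r = t) (g : hom k B D s) (f : hom k A B r) :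
    (⟨t, comp h g f⟩ : Σ r : ℝ, hom k A D r) = ⟨s + r, comp rfl g f⟩ := by
  subst h; rfl

lemma mk_eq_aux {A B : C} {r s : ℝ} (h : r = s) (h' : r ≤ s) (f : hom k A B r) :
    (⟨s, PersistenceCategory.map h' f⟩ : Σ r : ℝ, hom k A B r) = ⟨r, f⟩ := by
  subst h; rw [PersistenceCategory.map_refl]

instance category (C : Type u) [PersistenceCategory.{w, v} k C] : Category (Total k C) where
  Hom A B := Σ r : ℝ, hom k A.obj B.obj r
  id A := ⟨0, PersistenceCategory.id A.obj⟩
  comp f g := ⟨g.1 + f.1, comp rfl g.2 f.2⟩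
  id_comp f := by
    dsimp only
    rw [← mk_comp_aux k (add_zero f.1) f.2 _, comp_id]
  comp_id f := by
    dsimp only
    rw [← mk_comp_aux k (zero_add f.1) _ f.2, PersistenceCategory.id_comp]
  assoc f g h := by
    dsimp only
    rw [← mk_comp_aux k (add_assoc h.1 g.1 f.1) _ f.2,
      PersistenceCategory.assoc rfl (add_assoc h.1 g.1 f.1) rfl rfl]

/-- A morphism of shift `r` as a morphism of `Total k C`. -/
def mk' {A B : C} {r : ℝ} (f : hom k A B r) : (⟨A⟩ : Total k C) ⟶ ⟨B⟩ :=
  ⟨r, f⟩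

variable {k}

lemma mk_injective {A B : C} {r : ℝ} {f g : hom k A B r} (h : mk' k f = mk' k g) : f = g :=
  eq_of_heq (Sigma.mk.inj h).2

lemma mk_comp {A B D : C} {s r t : ℝ} (h : s + r = t) (g : hom k B D s) (f : hom k A B r) :
    mk' k (comp h g f) = mk' k f ≫ mk' k g :=
  mk_comp_aux k h g f

lemma mk_map {A B : C} {r s : ℝ} (h : r = s) (h' : r ≤ s) (f : hom k A B r) :
    mk' k (PersistenceCategory.map h' f) = mk' k f :=
  mk_eq_aux k h h' f

lemma mk_id (A : C) :
    mk' k (PersistenceCategory.id A : hom k A A 0) = 𝟙 (⟨A⟩ : Total k C) := rfl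

end Total

/-- For each `r` and `A` an object `obj r A` together with an invertible morphism
`e r A : A → obj r A` of shift `r`. -/
structure ShiftData (k : Type w) [Field k] (C : Type u) [PersistenceCategory.{w, v} k C] where
  obj : ℝ → C → C
  e : ∀ (r : ℝ) (A : C), hom k A (obj r A) r
  e' : ∀ (r : ℝ) (A : C), hom k (obj r A) A (-r)
  e'_e : ∀ (r : ℝ) (A : C), comp (neg_add_cancel r) (e' r A) (e r A) = PersistenceCategory.id A
  e_e' : ∀ (r : ℝ) (A : C),
    comp (add_neg_cancel r) (e r A) (e' r A) = PersistenceCategory.id (obj r A)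

namespace ShiftData

variable {k : Type w} [Field k] {C : Type u} [PersistenceCategory.{w, v} k C]
  (D : ShiftData k C)

lemma mk_e_e' (r : ℝ) (A : C) : Total.mk' k (D.e r A) ≫ Total.mk' k (D.e' r A) = 𝟙 _ := by
  rw [← Total.mk_comp (neg_add_cancel r), D.e'_e, Total.mk_id]

lemma mk_e'_e (r : ℝ) (A : C) : Total.mk' k (D.e' r A) ≫ Total.mk' k (D.e r A) = 𝟙 _ := by
  rw [← Total.mk_comp (add_neg_cancel r), D.e_e', Total.mk_id]

lemma mk_e_e'_assoc (r : ℝ) (A : C) {B : Total k C} (f : (⟨A⟩ : Total k C) ⟶ B) :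
    Total.mk' k (D.e r A) ≫ Total.mk' k (D.e' r A) ≫ f = f := by
  rw [← Category.assoc, mk_e_e', Category.id_comp]

lemma mk_e'_e_assoc (r : ℝ) (A : C) {B : Total k C}
    (f : (⟨D.obj r A⟩ : Total k C) ⟶ B) :
    Total.mk' k (D.e' r A) ≫ Total.mk' k (D.e r A) ≫ f = f := by
  rw [← Category.assoc, mk_e'_e, Category.id_comp]

/-- The map `f ↦ e ∘ f ∘ e⁻¹`. -/
def mapL (r : ℝ) (A B : C) (s : ℝ) : hom k A B s →ₗ[k] hom k (D.obj r A) (D.obj r B) s :=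
  (comp (show (r + s) + -r = s by ring)).flip (D.e' r A) ∘ₗ comp rfl (D.e r B)

lemma mk_mapL (r : ℝ) {A B : C} {s : ℝ} (f : hom k A B s) :
    Total.mk' k (D.mapL r A B s f) =
      Total.mk' k (D.e' r A) ≫ Total.mk' k f ≫ Total.mk' k (D.e r B) := by
  simp only [mapL, LinearMap.comp_apply, LinearMap.flip_apply, Total.mk_comp]

/-- The functor `Σ^r`, given on morphisms by `f ↦ e ∘ f ∘ e⁻¹`. -/
@[reducible]
def functor (r : ℝ) : PersFunctor k C C where
  obj A := D.obj r A
  map {A B s} := D.mapL r A B s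
  map_pers {A B s t} h f := by
    have h1 : r + s ≤ r + t := by linarith
    simp only [mapL, LinearMap.comp_apply, LinearMap.flip_apply]
    rw [map_comp _ (show (r + t) + -r = t by ring) h1 le_rfl,
      map_comp _ rfl le_rfl h, PersistenceCategory.map_refl, PersistenceCategory.map_refl]
  map_id A := by
    apply Total.mk_injective
    simp only [mk_mapL, Total.mk_id, Category.id_comp, mk_e'_e]
  map_comp h g f := by
    apply Total.mk_injective
    simp only [mk_mapL, Total.mk_comp, Category.assoc, mk_e_e'_assoc]

/-- The shift functor given by the objects `obj r A`: the functors `Σ^r` are conjugation by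
`e r`, the natural transformations `η_{r,s}` are `e s ∘ (e r)⁻¹`. -/
def shiftFunctor : ShiftFunctor k C where
  functor := D.functor
  η r s :=
    { app A := comp (show s + -r = s - r by ring) (D.e s A) (D.e' r A)
      naturality h h' f := by
        apply Total.mk_injective
        dsimp only [functor, PersFunctor.refl, PersFunctor.trans]
        simp only [Total.mk_comp, mk_mapL, Category.assoc, mk_e_e'_assoc] }
  η_self r A := by
    apply Total.mk_injective
    dsimp only [functor, PersFunctor.refl, PersFunctor.trans]
    rw [Total.mk_map (sub_self r)]
    simp only [Total.mk_comp, mk_e'_e]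
    rfl
  η_comp r s t A := by
    apply Total.mk_injective
    dsimp only [functor, PersFunctor.refl, PersFunctor.trans]
    simp only [Total.mk_comp, Category.assoc, mk_e_e'_assoc]
  unit :=
    { hom :=
        { app A := D.e 0 A
          naturality h h' f := by
            apply Total.mk_injective
            dsimp only [functor, PersFunctor.refl, PersFunctor.trans]
            simp only [Total.mk_comp, mk_mapL, mk_e_e'_assoc]
            rfl }
      inv :=
        { app A := PersistenceCategory.map (neg_zero (G := ℝ)).le (D.e' 0 A)
          naturality h h' f := by
            apply Total.mk_injective
            dsimp only [functor, PersFunctor.refl, PersFunctor.trans]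
            simp only [Total.mk_comp, mk_mapL, Total.mk_map (neg_zero (G := ℝ)),
              Category.assoc, mk_e_e', Category.comp_id]
            rfl }
      hom_inv A := by
        apply Total.mk_injective
        dsimp only [functor, PersFunctor.refl, PersFunctor.trans]
        simp only [Total.mk_comp, Total.mk_map (neg_zero (G := ℝ)), mk_e_e']
        rfl
      inv_hom A := by
        apply Total.mk_injective
        dsimp only [functor, PersFunctor.refl, PersFunctor.trans]
        simp only [Total.mk_comp, Total.mk_map (neg_zero (G := ℝ)), mk_e'_e]
        rfl }
  mul r s :=
    { hom :=
        { app A := comp (show (r + s) + -(r + s) = 0 by ring) (D.e (r + s) A)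
            (comp (show -r + -s = -(r + s) by ring) (D.e' r A) (D.e' s (D.obj r A)))
          naturality h h' f := by
            apply Total.mk_injective
            dsimp only [functor, PersFunctor.refl, PersFunctor.trans]
            simp only [LinearMap.comp_apply, Total.mk_comp, mk_mapL,
              Category.assoc, mk_e_e'_assoc] }
      inv :=
        { app A := comp (show (s + r) + -(r + s) = 0 by ring)
            (comp rfl (D.e s (D.obj r A)) (D.e r A)) (D.e' (r + s) A)
          naturality h h' f := by
            apply Total.mk_injective
            dsimp only [functor, PersFunctor.refl, PersFunctor.trans]
            simp only [LinearMap.comp_apply, Total.mk_comp, mk_mapL,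
              Category.assoc, mk_e_e'_assoc] }
      hom_inv A := by
        apply Total.mk_injective
        dsimp only [functor, PersFunctor.refl, PersFunctor.trans]
        simp only [Total.mk_comp, Category.assoc, mk_e_e'_assoc, mk_e'_e_assoc, mk_e'_e]
        rfl
      inv_hom A := by
        apply Total.mk_injective
        dsimp only [functor, PersFunctor.refl, PersFunctor.trans]
        simp only [Total.mk_comp, Category.assoc, mk_e_e'_assoc, mk_e'_e]
        rfl }
  mul_natural r r' s s' A := by
    apply Total.mk_injective
    dsimp only [functor, PersFunctor.refl, PersFunctor.trans]
    simp only [Total.mk_comp, mk_mapL, Category.assoc, mk_e_e'_assoc]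
  unit_mul s A := by
    apply Total.mk_injective
    dsimp only [functor, PersFunctor.refl, PersFunctor.trans]
    rw [Total.mk_map (show 0 + s - s = 0 by simp)]
    simp only [Total.mk_comp, mk_mapL, Category.assoc, mk_e_e'_assoc]
  mul_unit r A := by
    apply Total.mk_injective
    dsimp only [functor, PersFunctor.refl, PersFunctor.trans]
    rw [Total.mk_map (show r + 0 - r = 0 by simp)]
    simp only [Total.mk_comp, Category.assoc, mk_e_e'_assoc]
  mul_mul r s t A := by
    apply Total.mk_injective
    dsimp only [functor, PersFunctor.refl, PersFunctor.trans]
    simp only [Total.mk_comp, mk_mapL, Category.assoc, mk_e_e'_assoc]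
    rw [Total.mk_map (show r + (s + t) - (r + s + t) = 0 by ring)]
    simp only [Total.mk_comp, mk_e_e'_assoc]

end ShiftData

end

/-! ### Filtered dg-categories -/

/-- A filtered dg-category over the field `k`. For objects `X`, `Y`, the `hom X Y n`, `n : ℤ`, with
the differential `d` form a cochain complex of `k`-vector spaces (`d n m` is zero unless
`n + 1 = m`), and `len` is a filtration function on it (`⊥` plays the role of `-∞`), so that the
filtration of `hom X Y n` is given by the `f` with `len f ≤ r`.  The composition `comp h g f` is
`g ∘ f`; it is bilinear and a filtered chain map
`hom Y Z ⊗ hom X Y → hom X Z`. The identities are closed, with `len (id X) ≤ 0`; by `len_comp_le`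
this says that `len (id X) = 0` unless `id X = 0`. -/
class FilteredDGCategory (k : Type w) [Field k] (A : Type u) where
  hom : A → A → ℤ → Type v
  [addCommGroup : ∀ X Y n, AddCommGroup (hom X Y n)]
  [module : ∀ X Y n, Module k (hom X Y n)]
  d : ∀ {X Y : A} (n m : ℤ), hom X Y n →ₗ[k] hom X Y m
  d_shape : ∀ {X Y : A} (n m : ℤ), n + 1 ≠ m → ∀ f : hom X Y n, d n m f = 0
  d_d : ∀ {X Y : A} (n m p : ℤ) (f : hom X Y n), d m p (d n m f) = 0
  comp : ∀ {X Y Z : A} {m n p : ℤ}, m + n = p → (hom Y Z m →ₗ[k] hom X Y n →ₗ[k] hom X Z p)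
  d_comp : ∀ {X Y Z : A} {m n p m' n' p' : ℤ} (h : m + n = p) (_ : m + 1 = m') (_ : n + 1 = n')
    (_ : p + 1 = p') (h₁ : m' + n = p') (h₂ : m + n' = p') (g : hom Y Z m) (f : hom X Y n),
    d p p' (comp h g f) = comp h₁ (d m m' g) f + m.negOnePow • comp h₂ g (d n n' f)
  id : ∀ X : A, hom X X 0
  d_id : ∀ (X : A) (m : ℤ), d 0 m (id X) = 0
  id_comp : ∀ {X Y : A} {n : ℤ} (f : hom X Y n), comp (zero_add n) (id Y) f = f
  comp_id : ∀ {X Y : A} {n : ℤ} (f : hom X Y n), comp (add_zero n) f (id X) = f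
  assoc : ∀ {X Y Z W : A} {a b c ab bc abc : ℤ} (h₁ : a + b = ab) (h₂ : ab + c = abc)
    (h₃ : b + c = bc) (h₄ : a + bc = abc) (x : hom Z W a) (y : hom Y Z b) (z : hom X Y c),
    comp h₂ (comp h₁ x y) z = comp h₄ x (comp h₃ y z)
  len : ∀ {X Y : A} {n : ℤ}, hom X Y n → WithBot ℝ
  len_smul_add_le : ∀ {X Y : A} {n : ℤ} (a : k) (f g : hom X Y n), a ≠ 0 →
    len (a • f + g) ≤ max (len f) (len g)
  len_eq_bot_iff : ∀ {X Y : A} {n : ℤ} (f : hom X Y n), len f = ⊥ ↔ f = 0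
  len_d_le : ∀ {X Y : A} (n m : ℤ) (f : hom X Y n), len (d n m f) ≤ len f
  len_comp_le : ∀ {X Y Z : A} {m n p : ℤ} (h : m + n = p) (g : hom Y Z m) (f : hom X Y n),
    len (comp h g f) ≤ len g + len f
  len_id_le : ∀ X : A, len (id X) ≤ 0

attribute [reducible, instance] FilteredDGCategory.addCommGroup FilteredDGCategory.module

namespace FilteredDGCategory

variable {k : Type w} [Field k] {A : Type u} [FilteredDGCategory.{w, v} k A] {X Y Z : A}

@[simp]
lemma len_zero {n : ℤ} : len (0 : hom k X Y n) = ⊥ := (len_eq_bot_iff _).2 rfl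

lemma len_add_le {n : ℤ} (f g : hom k X Y n) : len (f + g) ≤ max (len f) (len g) := by
  simpa using len_smul_add_le (1 : k) f g one_ne_zero

lemma len_smul_le {n : ℤ} (a : k) (f : hom k X Y n) : len (a • f) ≤ len f := by
  rcases eq_or_ne a 0 with rfl | ha
  · simp
  · simpa using len_smul_add_le a f 0 ha

lemma len_neg {n : ℤ} (f : hom k X Y n) : len (-f) = len f := by
  apply le_antisymm
  · simpa using len_smul_le (-1 : k) f
  · simpa using len_smul_le (-1 : k) (-f)

lemma len_units_smul {n : ℤ} (a : ℤˣ) (f : hom k X Y n) : len (a • f) = len f := by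
  rcases Int.units_eq_one_or a with rfl | rfl
  · simp
  · simpa using len_neg f

lemma len_sum_le {ι : Type*} (s : Finset ι) {n : ℤ} (f : ι → hom k X Y n) {c : WithBot ℝ}
    (h : ∀ i ∈ s, len (f i) ≤ c) : len (∑ i ∈ s, f i) ≤ c := by
  classical
  induction s using Finset.induction_on with
  | empty => simp
  | insert i s hi ih =>
    rw [Finset.sum_insert hi]
    exact (len_add_le _ _).trans
      (max_le (h i (by simp)) (ih fun j hj => h j (by simp [hj])))

/-- The morphisms `f` of degree `n` with `len f ≤ r`. -/
def filt (k : Type w) [Field k] {A : Type u} [FilteredDGCategory.{w, v} k A] (X Y : A) (n : ℤ)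
    (r : ℝ) : Submodule k (hom k X Y n) where
  carrier := {f | len f ≤ r}
  zero_mem' := by simp
  add_mem' hf hg := (len_add_le _ _).trans (max_le hf hg)
  smul_mem' a f hf := (len_smul_le a f).trans hf

lemma mem_filt {n : ℤ} {r : ℝ} {f : hom k X Y n} : f ∈ filt k X Y n r ↔ len f ≤ r := Iff.rfl

/-- The closed morphisms `f` of degree `0` with `len f ≤ r`. -/
def cycles (k : Type w) [Field k] {A : Type u} [FilteredDGCategory.{w, v} k A] (X Y : A) (r : ℝ) :
    Submodule k (hom k X Y 0) :=
  LinearMap.ker (d (k := k) (X := X) (Y := Y) 0 1) ⊓ filt k X Y 0 r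

/-- The differentials of the morphisms `f` of degree `-1` with `len f ≤ r`. -/
def boundaries (k : Type w) [Field k] {A : Type u} [FilteredDGCategory.{w, v} k A] (X Y : A)
    (r : ℝ) : Submodule k (hom k X Y 0) :=
  (filt k X Y (-1) r).map (d (k := k) (X := X) (Y := Y) (-1) 0)

lemma boundaries_le_cycles (r : ℝ) : boundaries k X Y r ≤ cycles k X Y r := by
  rintro _ ⟨h, hh, rfl⟩
  exact ⟨d_d _ _ _ _, (len_d_le _ _ _).trans hh⟩

/-- The cohomology `H^0(hom^{≤ r}(X, Y))`. -/
abbrev H0Hom (k : Type w) [Field k] {A : Type u} [FilteredDGCategory.{w, v} k A] (X Y : A)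
    (r : ℝ) : Type v :=
  cycles k X Y r ⧸ (boundaries k X Y r).submoduleOf (cycles k X Y r)

/-- The cohomology class of a closed morphism of degree `0` of filtration level `≤ r`. -/
def H0Hom.mk {r : ℝ} (f : hom k X Y 0) (hf : f ∈ cycles k X Y r) : H0Hom k X Y r :=
  Submodule.Quotient.mk ⟨f, hf⟩

lemma H0Hom.mk_eq {r : ℝ} {f g : hom k X Y 0} (hf : f ∈ cycles k X Y r)
    (hg : g ∈ cycles k X Y r) (h : f - g ∈ boundaries k X Y r) : H0Hom.mk f hf = H0Hom.mk g hg :=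
  (Submodule.Quotient.eq _).2 h

lemma comp_mem_cycles {s r t : ℝ} (h : s + r = t) {g : hom k Y Z 0} {f : hom k X Y 0}
    (hg : g ∈ cycles k Y Z s) (hf : f ∈ cycles k X Y r) :
    comp (add_zero 0) g f ∈ cycles k X Z t := by
  refine ⟨?_, ?_⟩
  · have hg' : d (k := k) 0 1 g = 0 := hg.1
    have hf' : d (k := k) 0 1 f = 0 := hf.1
    show d (k := k) 0 1 _ = 0
    rw [d_comp (add_zero 0) (zero_add 1) (zero_add 1) (zero_add 1)
      (add_zero 1) (zero_add 1), hg', hf']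
    simp
  · refine (len_comp_le _ _ _).trans ((add_le_add hg.2 hf.2).trans ?_)
    rw [← h]; exact (WithBot.coe_add s r).ge

lemma comp_mem_boundaries_left {s r t : ℝ} (h : s + r = t) {g : hom k Y Z 0} {f : hom k X Y 0}
    (hg : g ∈ boundaries k Y Z s) (hf : f ∈ cycles k X Y r) :
    comp (add_zero 0) g f ∈ boundaries k X Z t := by
  obtain ⟨u, hu, rfl⟩ := hg
  have hf' : d (k := k) 0 1 f = 0 := hf.1
  refine ⟨comp (add_zero (-1)) u f, ?_, ?_⟩
  · refine (len_comp_le _ _ _).trans ((add_le_add hu hf.2).trans ?_)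
    rw [← h]; exact (WithBot.coe_add s r).ge
  · rw [d_comp (add_zero (-1)) (neg_add_cancel 1) (zero_add 1) (neg_add_cancel 1)
      (add_zero 0) (neg_add_cancel 1), hf']
    simp

lemma comp_mem_boundaries_right {s r t : ℝ} (h : s + r = t) {g : hom k Y Z 0} {f : hom k X Y 0}
    (hg : g ∈ cycles k Y Z s) (hf : f ∈ boundaries k X Y r) :
    comp (add_zero 0) g f ∈ boundaries k X Z t := by
  obtain ⟨u, hu, rfl⟩ := hf
  have hg' : d (k := k) 0 1 g = 0 := hg.1
  refine ⟨comp (zero_add (-1)) g u, ?_, ?_⟩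
  · refine (len_comp_le _ _ _).trans ((add_le_add hg.2 hu).trans ?_)
    rw [← h]; exact (WithBot.coe_add s r).ge
  · rw [d_comp (zero_add (-1)) (zero_add 1) (neg_add_cancel 1) (neg_add_cancel 1)
      (add_neg_cancel 1) (add_zero 0), hg']
    simp

/-- The composition in cohomology. -/
def H0Hom.comp {s r t : ℝ} (h : s + r = t) (X Y Z : A) :
    H0Hom k Y Z s →ₗ[k] H0Hom k X Y r →ₗ[k] H0Hom k X Z t :=
  LinearMap.mk₂ k
    (fun g f => Quotient.liftOn₂' g f
      (fun g f => H0Hom.mk (FilteredDGCategory.comp (add_zero 0) g.1 f.1)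
        (comp_mem_cycles h g.2 f.2))
      (by
        rintro ⟨g, hg⟩ ⟨f, hf⟩ ⟨g', hg'⟩ ⟨f', hf'⟩ h₁ h₂
        have h₁' : g - g' ∈ boundaries k Y Z s :=
          (Submodule.quotientRel_def
            ((boundaries k Y Z s).submoduleOf (cycles k Y Z s))).1 h₁
        have h₂' : f - f' ∈ boundaries k X Y r :=
          (Submodule.quotientRel_def
            ((boundaries k X Y r).submoduleOf (cycles k X Y r))).1 h₂
        apply H0Hom.mk_eq
        have : FilteredDGCategory.comp (k := k) (add_zero 0) g f -
            FilteredDGCategory.comp (add_zero 0) g' f' =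
            FilteredDGCategory.comp (add_zero 0) (g - g') f +
              FilteredDGCategory.comp (add_zero 0) g' (f - f') := by
          simp
        rw [this]
        exact add_mem (comp_mem_boundaries_left h h₁' hf) (comp_mem_boundaries_right h hg' h₂')))
    (by
      rintro ⟨g, hg⟩ ⟨g', hg'⟩ ⟨f, hf⟩
      exact congrArg _ (Subtype.ext (by simp)))
    (by
      rintro a ⟨g, hg⟩ ⟨f, hf⟩
      exact congrArg _ (Subtype.ext (by simp)))
    (by
      rintro ⟨g, hg⟩ ⟨f, hf⟩ ⟨f', hf'⟩
      exact congrArg _ (Subtype.ext (by simp)))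
    (by
      rintro a ⟨g, hg⟩ ⟨f, hf⟩
      exact congrArg _ (Subtype.ext (by simp)))

lemma H0Hom.comp_mk {s r t : ℝ} (h : s + r = t) (g : hom k Y Z 0) (f : hom k X Y 0)
    (hg : g ∈ cycles k Y Z s) (hf : f ∈ cycles k X Y r) :
    H0Hom.comp h X Y Z (H0Hom.mk g hg) (H0Hom.mk f hf) =
      H0Hom.mk (FilteredDGCategory.comp (add_zero 0) g f) (comp_mem_cycles h hg hf) := rfl

lemma cycles_mono {r s : ℝ} (h : r ≤ s) : cycles k X Y r ≤ cycles k X Y s :=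
  fun _ hf => ⟨hf.1, hf.2.trans (WithBot.coe_le_coe.2 h)⟩

/-- The structure maps `H^0(hom^{≤ r}(X, Y)) → H^0(hom^{≤ s}(X, Y))` induced by the inclusions. -/
def H0Hom.map {r s : ℝ} (h : r ≤ s) (X Y : A) : H0Hom k X Y r →ₗ[k] H0Hom k X Y s :=
  Submodule.mapQ _ _ (Submodule.inclusion (cycles_mono h)) (by
    rintro ⟨f, hf⟩ hf'
    obtain ⟨u, hu, rfl⟩ : f ∈ boundaries k X Y r := hf'
    exact ⟨u, hu.trans (WithBot.coe_le_coe.2 h), rfl⟩)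

lemma H0Hom.map_mk {r s : ℝ} (h : r ≤ s) (f : hom k X Y 0) (hf : f ∈ cycles k X Y r) :
    H0Hom.map h X Y (H0Hom.mk f hf) = H0Hom.mk f (cycles_mono h hf) := rfl

lemma id_mem_cycles (X : A) : id X ∈ cycles k X X 0 :=
  ⟨d_id X 1, len_id_le X⟩

end FilteredDGCategory

/-- The degree-`0` cohomology category of a filtered dg-category `A`: it has the same objects, and
its morphisms of shift `r` are the elements of `H^0(hom^{≤ r}(X, Y))`. -/
structure H0 (k : Type w) (A : Type u) where
  obj : A

namespace H0

open FilteredDGCategory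

instance (k : Type w) [Field k] (A : Type u) [FilteredDGCategory.{w, v} k A] :
    PersistenceCategory.{w, v} k (H0 k A) where
  hom X Y r := H0Hom k X.obj Y.obj r
  map h := H0Hom.map h _ _
  map_refl := by rintro _ _ _ ⟨f, hf⟩; rfl
  map_map := by rintro _ _ _ _ _ _ _ ⟨f, hf⟩; rfl
  comp h := H0Hom.comp h _ _ _
  map_comp := by rintro _ _ _ _ _ _ _ _ _ _ _ _ _ _ ⟨g, hg⟩ ⟨f, hf⟩; rfl
  id X := H0Hom.mk (FilteredDGCategory.id X.obj) (id_mem_cycles X.obj)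
  id_comp := by
    rintro _ _ _ ⟨f, hf⟩
    exact congrArg _ (Subtype.ext (FilteredDGCategory.id_comp f))
  comp_id := by
    rintro _ _ _ ⟨f, hf⟩
    exact congrArg _ (Subtype.ext (FilteredDGCategory.comp_id f))
  assoc := by
    rintro _ _ _ _ _ _ _ _ _ _ _ _ _ _ ⟨x, hx⟩ ⟨y, hy⟩ ⟨z, hz⟩
    exact congrArg _ (Subtype.ext (FilteredDGCategory.assoc _ _ _ _ x y z))

end H0

namespace FilteredDGCategory

section

variable (k : Type w) [Field k] {A : Type u} [FilteredDGCategory.{w, v} k A] {X Y Z : A}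

/-- The identification `hom X Y n = hom X Y m` when `n = m`. -/
def degCast {n m : ℤ} (h : n = m) : hom k X Y n →ₗ[k] hom k X Y m where
  toFun f := h ▸ f
  map_add' f g := by subst h; rfl
  map_smul' a f := by subst h; rfl

@[simp]
lemma degCast_self {n : ℤ} (h : n = n) (f : hom k X Y n) : degCast k h f = f := rfl

@[simp]
lemma degCast_degCast {n m p : ℤ} (h : n = m) (h' : m = p) (f : hom k X Y n) :
    degCast k h' (degCast k h f) = degCast k (h.trans h') f := by
  subst h h'; rfl

lemma len_degCast {n m : ℤ} (h : n = m) (f : hom k X Y n) : len (degCast k h f) = len f := by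
  subst h; rfl

lemma comp_degCast_left {m n m' p p' : ℤ} (h : m = m') (hp : p = p') (h' : m' + n = p')
    (g : hom k Y Z m) (f : hom k X Y n) :
    comp h' (degCast k h g) f = degCast k hp (comp (by omega) g f) := by
  subst h hp; rfl

lemma comp_degCast_right {m n n' p p' : ℤ} (h : n = n') (hp : p = p') (h' : m + n' = p')
    (g : hom k Y Z m) (f : hom k X Y n) :
    comp h' g (degCast k h f) = degCast k hp (comp (by omega) g f) := by
  subst h hp; rfl

lemma comp_degCast {m m' n n' p p' : ℤ} (hm : m = m') (hn : n = n') (hp : p = p')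
    (h : m + n = p) (h' : m' + n' = p') (g : hom k Y Z m) (f : hom k X Y n) :
    comp h' (degCast k hm g) (degCast k hn f) = degCast k hp (comp h g f) := by
  subst hm hn hp; rfl

lemma d_degCast {n n' m m' : ℤ} (h : n = n') (h' : m = m') (f : hom k X Y n) :
    d n' m' (degCast k h f) = degCast k h' (d n m f) := by
  subst h h'; rfl

end

end FilteredDGCategory

/-! ### The shift completion -/

/-- An object `Σ^r X[d]` of the shift completion of `A`, with `r = shift` and `d = deg`. -/
@[ext]
structure ShiftCompletion (A : Type u) where
  obj : A
  shift : ℝ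
  deg : ℤ

namespace ShiftCompletion

open FilteredDGCategory

/-- The shift completion of a filtered dg-category: the morphisms of degree `n` from `Σ^r X[d]` to
`Σ^s Y[e]` are the morphisms of degree `n + e - d` from `X` to `Y`, the filtration function is
`ℓ_{XY} + s - r`, and composition is that of `A`. The differential is `(-1)^e` times the
differential of `A`, since `Y[e]` carries the differential of `Y` multiplied by `(-1)^e`. -/
instance (k : Type w) [Field k] (A : Type u) [FilteredDGCategory.{w, v} k A] :
    FilteredDGCategory.{w, v} k (ShiftCompletion A) where
  hom X Y n := hom k X.obj Y.obj (n + Y.deg - X.deg)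
  d {X Y} n m :=
    Y.deg.negOnePow • (d (n + Y.deg - X.deg) (m + Y.deg - X.deg) :
      hom k X.obj Y.obj (n + Y.deg - X.deg) →ₗ[k] hom k X.obj Y.obj (m + Y.deg - X.deg))
  d_shape n m h f := by
    rw [LinearMap.smul_apply, d_shape _ _ (by omega), smul_zero]
  d_d n m p f := by
    simp only [LinearMap.smul_apply, Units.smul_def, map_zsmul, d_d, smul_zero]
  comp {X Y Z m n p} h :=
    comp (show (m + Z.deg - Y.deg) + (n + Y.deg - X.deg) = p + Z.deg - X.deg by omega)
  d_comp {X Y Z m n p m' n' p'} h hm hn hp h₁ h₂ g f := by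
    simp only [LinearMap.smul_apply, Units.smul_def, map_zsmul]
    rw [d_comp (show (m + Z.deg - Y.deg) + (n + Y.deg - X.deg) = p + Z.deg - X.deg by omega)
      (show m + Z.deg - Y.deg + 1 = m' + Z.deg - Y.deg by omega)
      (show n + Y.deg - X.deg + 1 = n' + Y.deg - X.deg by omega)
      (show p + Z.deg - X.deg + 1 = p' + Z.deg - X.deg by omega)
      (show (m' + Z.deg - Y.deg) + (n + Y.deg - X.deg) = p' + Z.deg - X.deg by omega)
      (show (m + Z.deg - Y.deg) + (n' + Y.deg - X.deg) = p' + Z.deg - X.deg by omega)]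
    simp only [smul_add, Units.smul_def, smul_smul]
    congr 2
    norm_cast
    rw [← Int.negOnePow_add, ← Int.negOnePow_add, Int.negOnePow_eq_iff]
    exact ⟨Z.deg - Y.deg, by ring⟩
  id X := degCast k (show 0 = 0 + X.deg - X.deg by omega) (id X.obj)
  d_id X m := by
    rw [LinearMap.smul_apply, d_degCast k _ (show m = m + X.deg - X.deg by omega), d_id]
    simp
  id_comp {X Y n} f := by
    rw [comp_degCast_left k _ (p := n + Y.deg - X.deg) rfl, degCast_self]
    exact id_comp f
  comp_id {X Y n} f := by
    rw [comp_degCast_right k _ (p := n + Y.deg - X.deg) rfl, degCast_self]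
    exact comp_id f
  assoc h₁ h₂ h₃ h₄ x y z := assoc _ _ _ _ x y z
  len {X Y n} f := len f + ((Y.shift - X.shift : ℝ) : WithBot ℝ)
  len_smul_add_le {X Y n} a f g ha := by
    refine (add_le_add_left (len_smul_add_le a f g ha) _).trans (le_of_eq ?_)
    exact max_add (len f) (len g) _
  len_eq_bot_iff {X Y n} f := by
    rw [WithBot.add_eq_bot, len_eq_bot_iff]
    simp
  len_d_le n m f := by
    gcongr
    rw [LinearMap.smul_apply, len_units_smul]
    exact len_d_le _ _ _
  len_comp_le {X Y Z m n p} h g f := by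
    refine (add_le_add_left (len_comp_le _ g f) _).trans (le_of_eq ?_)
    have : ((Z.shift - X.shift : ℝ) : WithBot ℝ) =
        ((Z.shift - Y.shift : ℝ) : WithBot ℝ) + ((Y.shift - X.shift : ℝ) : WithBot ℝ) := by
      rw [← WithBot.coe_add]; congr 1; ring
    rw [this]
    abel
  len_id_le X := by
    rw [len_degCast, sub_self, WithBot.coe_zero, add_zero]
    exact len_id_le _

/-- The object `Σ^s X`. -/
def shiftBy {A : Type u} (s : ℝ) (X : ShiftCompletion A) : ShiftCompletion A :=
  ⟨X.obj, X.shift + s, X.deg⟩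

/-- The object `X[n]`. -/
def translate {A : Type u} (n : ℤ) (X : ShiftCompletion A) : ShiftCompletion A :=
  ⟨X.obj, X.shift, X.deg + n⟩

end ShiftCompletion

/-! ### Matrices of morphisms -/

namespace Mat

open FilteredDGCategory

variable (k : Type w) [Field k] {B : Type u} [FilteredDGCategory.{w, v} k B]
  {I J L M : Type*}

/-- Matrices of morphisms of degree `n` from `⨁ X j` to `⨁ Y i`. -/
abbrev Hom (X : J → B) (Y : I → B) (n : ℤ) := ∀ (i : I) (j : J), hom k (X j) (Y i) n

section

variable {X : J → B} {Y : I → B} {Z : L → B} {W : M → B}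

/-- The entrywise differential. -/
def d (n m : ℤ) : Hom k X Y n →ₗ[k] Hom k X Y m where
  toFun f i j := FilteredDGCategory.d n m (f i j)
  map_add' f g := by ext; simp
  map_smul' a f := by ext; simp

/-- The matrix product `g f`. -/
def comp [Fintype I] {m n p : ℤ} (h : m + n = p) :
    Hom k Y Z m →ₗ[k] Hom k X Y n →ₗ[k] Hom k X Z p :=
  LinearMap.mk₂ k (fun g f i j => ∑ l, FilteredDGCategory.comp h (g i l) (f l j))
    (fun _ _ _ => by ext; simp [Finset.sum_add_distrib])
    (fun _ _ _ => by ext; simp [Finset.smul_sum])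
    (fun _ _ _ => by ext; simp [Finset.sum_add_distrib])
    (fun _ _ _ => by ext; simp [Finset.smul_sum])

/-- The identity matrix. -/
def id [DecidableEq J] (X : J → B) : Hom k X X 0 := fun i j =>
  if h : j = i then h ▸ FilteredDGCategory.id (X j) else 0

/-- The largest value of the filtration function on the entries. -/
def len [Fintype I] [Fintype J] {n : ℤ} (f : Hom k X Y n) : WithBot ℝ :=
  Finset.univ.sup fun i => Finset.univ.sup fun j => FilteredDGCategory.len (f i j)

variable {k}

lemma d_apply (n m : ℤ) (f : Hom k X Y n) (i : I) (j : J) :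
    d k n m f i j = FilteredDGCategory.d n m (f i j) := rfl

lemma comp_apply [Fintype I] {m n p : ℤ} (h : m + n = p) (g : Hom k Y Z m) (f : Hom k X Y n)
    (i : L) (j : J) :
    comp k h g f i j = ∑ l, FilteredDGCategory.comp h (g i l) (f l j) := rfl

lemma d_d (n m p : ℤ) (f : Hom k X Y n) : d k m p (d k n m f) = 0 := by
  ext i j; exact FilteredDGCategory.d_d _ _ _ _

lemma d_comp [Fintype I] {m n p m' n' p' : ℤ} (h : m + n = p) (hm : m + 1 = m') (hn : n + 1 = n')
    (hp : p + 1 = p') (h₁ : m' + n = p') (h₂ : m + n' = p') (g : Hom k Y Z m) (f : Hom k X Y n) :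
    d k p p' (comp k h g f) =
      comp k h₁ (d k m m' g) f + m.negOnePow • comp k h₂ g (d k n n' f) := by
  ext i j
  simp only [d_apply, comp_apply, map_sum, Pi.add_apply, Pi.smul_apply]
  rw [Finset.smul_sum, ← Finset.sum_add_distrib]
  exact Finset.sum_congr rfl fun l _ => FilteredDGCategory.d_comp h hm hn hp h₁ h₂ _ _

lemma assoc [Fintype I] [Fintype L] {a b c ab bc abc : ℤ} (h₁ : a + b = ab) (h₂ : ab + c = abc)
    (h₃ : b + c = bc) (h₄ : a + bc = abc) (x : Hom k Z W a) (y : Hom k Y Z b) (z : Hom k X Y c) :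
    comp k h₂ (comp k h₁ x y) z = comp k h₄ x (comp k h₃ y z) := by
  ext i j
  simp only [comp_apply, map_sum, LinearMap.sum_apply]
  rw [Finset.sum_comm]
  exact Finset.sum_congr rfl fun l _ => Finset.sum_congr rfl fun l' _ =>
    FilteredDGCategory.assoc h₁ h₂ h₃ h₄ _ _ _

lemma id_self [DecidableEq J] (j : J) : id k X j j = FilteredDGCategory.id (X j) := by
  simp [id]

lemma id_of_ne [DecidableEq J] {i j : J} (h : j ≠ i) : id k X i j = 0 := by
  simp [id, h]

lemma id_comp [Fintype I] [DecidableEq I] {n n' : ℤ} (h : 0 + n = n') (f : Hom k X Y n) :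
    comp k h (id k Y) f = (show n = n' by omega) ▸ f := by
  obtain rfl : n = n' := by omega
  ext i j
  rw [comp_apply, Finset.sum_eq_single i]
  · rw [id_self]; exact FilteredDGCategory.id_comp _
  · intro l _ hl
    rw [id_of_ne hl]; simp
  · simp

lemma comp_id [Fintype J] [DecidableEq J] {n n' : ℤ} (h : n + 0 = n') (f : Hom k X Y n) :
    comp k h f (id k X) = (show n = n' by omega) ▸ f := by
  obtain rfl : n = n' := by omega
  ext i j
  rw [comp_apply, Finset.sum_eq_single j]
  · rw [id_self]; exact FilteredDGCategory.comp_id _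
  · intro l _ hl
    rw [id_of_ne hl.symm]; simp
  · simp

lemma d_id [DecidableEq J] (m : ℤ) : d k 0 m (id k X) = 0 := by
  ext i j
  rcases eq_or_ne j i with rfl | h
  · rw [d_apply, id_self, FilteredDGCategory.d_id]; rfl
  · rw [d_apply, id_of_ne h, map_zero]; rfl

variable [Fintype I] [Fintype J]

lemma len_le_iff {n : ℤ} (f : Hom k X Y n) (c : WithBot ℝ) :
    len k f ≤ c ↔ ∀ i j, FilteredDGCategory.len (f i j) ≤ c := by
  simp [len, Finset.sup_le_iff]

lemma le_len {n : ℤ} (f : Hom k X Y n) (i : I) (j : J) :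
    FilteredDGCategory.len (f i j) ≤ len k f :=
  (len_le_iff f _).1 le_rfl i j

lemma len_add_le {n : ℤ} (f g : Hom k X Y n) {c : WithBot ℝ} (hf : len k f ≤ c)
    (hg : len k g ≤ c) : len k (f + g) ≤ c :=
  (len_le_iff _ _).2 fun i j => (FilteredDGCategory.len_add_le _ _).trans
    (max_le ((le_len f i j).trans hf) ((le_len g i j).trans hg))

lemma len_neg {n : ℤ} (f : Hom k X Y n) : len k (-f) = len k f := by
  simp [len, FilteredDGCategory.len_neg]

lemma len_units_smul {n : ℤ} (a : ℤˣ) (f : Hom k X Y n) : len k (a • f) = len k f := by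
  simp [len, FilteredDGCategory.len_units_smul]

lemma len_smul_add_le {n : ℤ} (a : k) (f g : Hom k X Y n) (ha : a ≠ 0) :
    len k (a • f + g) ≤ max (len k f) (len k g) :=
  (len_le_iff _ _).2 fun i j => (FilteredDGCategory.len_smul_add_le _ _ _ ha).trans
    (max_le_max (le_len f i j) (le_len g i j))

lemma len_eq_bot_iff {n : ℤ} (f : Hom k X Y n) : len k f = ⊥ ↔ f = 0 := by
  rw [← le_bot_iff, len_le_iff]
  simp only [le_bot_iff, FilteredDGCategory.len_eq_bot_iff]
  exact ⟨fun h => by ext i j; exact h i j, fun h i j => by rw [h]; rfl⟩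

lemma len_d_le (n m : ℤ) (f : Hom k X Y n) : len k (d k n m f) ≤ len k f :=
  (len_le_iff _ _).2 fun i j => (FilteredDGCategory.len_d_le _ _ _).trans (le_len f i j)

lemma len_comp_le [Fintype L] {m n p : ℤ} (h : m + n = p) (g : Hom k Y Z m) (f : Hom k X Y n) :
    len k (comp k h g f) ≤ len k g + len k f :=
  (len_le_iff _ _).2 fun i j => len_sum_le _ _ fun l _ =>
    (FilteredDGCategory.len_comp_le h _ _).trans (add_le_add (le_len g i l) (le_len f l j))

lemma len_id_le [DecidableEq J] : len k (id k X) ≤ 0 :=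
  (len_le_iff _ _).2 fun i j => by
    rcases eq_or_ne j i with rfl | h
    · rw [id_self]; exact FilteredDGCategory.len_id_le _
    · rw [id_of_ne h]; simp

end

end Mat

/-! ### Filtered twisted complexes -/

/-- A filtered one-sided twisted complex `(⨁ Σ^{r_i} X_i[d_i], q)` of `Σ A`: a finite sequence of
objects of the shift completion and a strictly upper triangular matrix `q` of morphisms of degree
`1` and filtration level `≤ 0` with `d q + q q = 0`. -/
structure Tw (k : Type w) [Field k] (A : Type u) [FilteredDGCategory.{w, v} k A] where
  size : ℕ
  obj : Fin size → ShiftCompletion A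
  q : ∀ i j : Fin size, FilteredDGCategory.hom k (obj j) (obj i) 1
  q_eq_zero : ∀ i j : Fin size, j ≤ i → q i j = 0
  d_q : ∀ i j : Fin size, FilteredDGCategory.d 1 2 (q i j) +
    ∑ l, FilteredDGCategory.comp (one_add_one_eq_two (R := ℤ)) (q i l) (q l j) = 0
  len_q_le : ∀ i j : Fin size, FilteredDGCategory.len (q i j) ≤ 0

namespace Tw

variable {k : Type w} [Field k] {A : Type u} [FilteredDGCategory.{w, v} k A] {X Y Z : Tw k A}

/-- Morphisms of degree `n` of twisted complexes: matrices of morphisms of degree `n`. -/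
abbrev Hom (X Y : Tw k A) (n : ℤ) := Mat.Hom k X.obj Y.obj n

/-- The differential `f ↦ (d f_{ij}) + q' f - (-1)^n f q`, where `n` is the degree of `f`. -/
def dHom (n m : ℤ) (h : n + 1 = m) : Hom X Y n →ₗ[k] Hom X Y m :=
  Mat.d k n m + Mat.comp k (show 1 + n = m by omega) Y.q -
    n.negOnePow • (Mat.comp k h).flip X.q

lemma dHom_apply (n m : ℤ) (h : n + 1 = m) (f : Hom X Y n) :
    dHom n m h f = Mat.d k n m f + Mat.comp k (show 1 + n = m by omega) Y.q f -
      n.negOnePow • Mat.comp k h f X.q := rfl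

lemma d_q_eq (X : Tw k A) :
    Mat.d k 1 2 X.q = - Mat.comp k (one_add_one_eq_two (R := ℤ)) X.q X.q := by
  rw [eq_neg_iff_add_eq_zero]
  ext i j
  exact X.d_q i j

lemma dHom_dHom (n m p : ℤ) (h : n + 1 = m) (h' : m + 1 = p) (f : Hom X Y n) :
    dHom m p h' (dHom n m h f) = 0 := by
  subst h h'
  simp only [dHom_apply, map_add, map_sub, Mat.d_d, Int.negOnePow_succ]
  have e1 := Mat.d_comp (k := k) (show 1 + n = n + 1 by omega) (show 1 + 1 = 2 by norm_num) rfl rfl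
    (show 2 + n = n + 1 + 1 by omega) (show 1 + (n + 1) = n + 1 + 1 by omega) Y.q f
  have e2 := Mat.d_comp (k := k) (show n + 1 = n + 1 by omega) rfl (show 1 + 1 = 2 by norm_num) rfl
    (show n + 1 + 1 = n + 1 + 1 by omega) (show n + 2 = n + 1 + 1 by omega) f X.q
  have e3 := Mat.assoc (k := k) (one_add_one_eq_two (R := ℤ)) (show 2 + n = n + 1 + 1 by omega)
    (show 1 + n = n + 1 by omega) (show 1 + (n + 1) = n + 1 + 1 by omega) Y.q Y.q f
  have e4 := Mat.assoc (k := k) (show n + 1 = n + 1 by omega)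
    (show n + 1 + 1 = n + 1 + 1 by omega) (one_add_one_eq_two (R := ℤ))
    (show n + 2 = n + 1 + 1 by omega) f X.q X.q
  have e5 := Mat.assoc (k := k) (show 1 + n = n + 1 by omega)
    (show n + 1 + 1 = n + 1 + 1 by omega) (show n + 1 = n + 1 by omega)
    (show 1 + (n + 1) = n + 1 + 1 by omega) Y.q f X.q
  rw [d_q_eq] at e1 e2
  rcases Int.units_eq_one_or n.negOnePow with hn | hn <;>
  · simp only [hn, Int.negOnePow_one, one_smul, Units.neg_smul, map_neg, LinearMap.neg_apply] at e1 e2 ⊢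
    rw [e1, e2, e3, e4, e5]
    abel

lemma dHom_comp {m n p m' n' p' : ℤ} (h : m + n = p) (hm : m + 1 = m') (hn : n + 1 = n')
    (hp : p + 1 = p') (h₁ : m' + n = p') (h₂ : m + n' = p') (g : Hom Y Z m) (f : Hom X Y n) :
    dHom p p' hp (Mat.comp k h g f) = Mat.comp k h₁ (dHom m m' hm g) f +
      m.negOnePow • Mat.comp k h₂ g (dHom n n' hn f) := by
  subst h hm hn hp
  simp only [dHom_apply, map_add, map_sub, LinearMap.add_apply, LinearMap.sub_apply,
    Int.negOnePow_add]
  rw [Mat.d_comp (k := k) rfl rfl rfl rfl h₁ h₂ g f]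
  have e1 := Mat.assoc (k := k) (show 1 + m = m + 1 by omega) h₁ rfl
    (show 1 + (m + n) = m + n + 1 by omega) Z.q g f
  have e2 := Mat.assoc (k := k) (rfl : m + n = m + n) (rfl : m + n + 1 = m + n + 1) rfl h₂ g f X.q
  have e3 := Mat.assoc (k := k) (rfl : m + 1 = m + 1) h₁ (show 1 + n = n + 1 by omega) h₂ g Y.q f
  rcases Int.units_eq_one_or n.negOnePow with hn | hn <;>
  rcases Int.units_eq_one_or m.negOnePow with hm | hm <;>
  · simp only [hn, hm, one_smul, Units.neg_smul, map_neg, LinearMap.neg_apply, mul_one,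
      mul_neg, neg_neg, smul_add, smul_sub]
    rw [e1, e2, e3]
    abel

lemma len_dHom_le (n m : ℤ) (h : n + 1 = m) (f : Hom X Y n) :
    Mat.len k (dHom n m h f) ≤ Mat.len k f := by
  have hX : Mat.len k X.q ≤ 0 := (Mat.len_le_iff _ _).2 X.len_q_le
  have hY : Mat.len k Y.q ≤ 0 := (Mat.len_le_iff _ _).2 Y.len_q_le
  rw [dHom_apply, sub_eq_add_neg]
  refine Mat.len_add_le _ _ (Mat.len_add_le _ _ (Mat.len_d_le _ _ _) ?_) ?_
  · exact (Mat.len_comp_le _ _ _).trans ((add_le_add_left hY _).trans (zero_add _).le)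
  · rw [Mat.len_neg, Mat.len_units_smul]
    exact (Mat.len_comp_le _ _ _).trans ((add_le_add_right hX _).trans (add_zero _).le)

variable (k A) in
/-- The filtered pre-triangulated completion of `A` as a filtered dg-category: composition is
matrix multiplication, and the filtration function is the maximum over the entries. -/
instance filteredDGCategory : FilteredDGCategory.{w, v} k (Tw k A) where
  hom X Y n := Hom X Y n
  d n m := if h : n + 1 = m then dHom n m h else 0
  d_shape n m h f := by simp [h]
  d_d n m p f := by
    by_cases h : n + 1 = m
    · by_cases h' : m + 1 = p
      · simpa [h, h'] using dHom_dHom n m p h h' f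
      · simp [h']
    · simp [h]
  comp h := Mat.comp k h
  d_comp h hm hn hp h₁ h₂ g f := by
    simpa only [hm, hn, hp, dif_pos] using dHom_comp h hm hn hp h₁ h₂ g f
  id X := Mat.id k X.obj
  d_id X m := by
    by_cases h : 0 + 1 = m
    · obtain rfl : m = 1 := by omega
      simp only [zero_add, dif_pos]
      rw [dHom_apply, Mat.d_id, Mat.id_comp, Mat.comp_id]
      simp
    · rw [dif_neg h]; rfl
  id_comp f := Mat.id_comp _ f
  comp_id f := Mat.comp_id _ f
  assoc h₁ h₂ h₃ h₄ x y z := Mat.assoc h₁ h₂ h₃ h₄ x y z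
  len f := Mat.len k f
  len_smul_add_le a f g ha := Mat.len_smul_add_le a f g ha
  len_eq_bot_iff f := Mat.len_eq_bot_iff f
  len_d_le n m f := by
    by_cases h : n + 1 = m
    · simpa [h] using len_dHom_le n m h f
    · rw [dif_neg h]
      exact ((Mat.len_eq_bot_iff _).2 rfl).le.trans bot_le
  len_comp_le h g f := Mat.len_comp_le h g f
  len_id_le X := Mat.len_id_le

end Tw

namespace ShiftCompletion

open FilteredDGCategory

variable (k : Type w) [Field k] {A : Type u} [FilteredDGCategory.{w, v} k A]
  {X Y Z : ShiftCompletion A}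

/-- A morphism of degree `n` from `X` to `Y` as a morphism of degree `n` from `X[a]` to `Y[a]`,
with the same underlying morphism of `A`. -/
def homTranslate (a : ℤ) (n : ℤ) :
    hom k X Y n →ₗ[k] hom k (translate a X) (translate a Y) n :=
  degCast k (A := A) (show n + Y.deg - X.deg = n + (Y.deg + a) - (X.deg + a) by omega)

/-- A morphism of degree `n` from `X` to `Y` as a morphism of degree `m = n + a` from `X[a]` to
`Y`, with the same underlying morphism of `A`. -/
def homTranslateLeft (a : ℤ) {n m : ℤ} (h : n + a = m) :
    hom k X Y n →ₗ[k] hom k (translate a X) Y m :=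
  degCast k (A := A) (show n + Y.deg - X.deg = m + Y.deg - (X.deg + a) by omega)

variable {k}

lemma len_def {n : ℤ} (f : hom k X Y n) :
    len f = len (A := A) (X := X.obj) (Y := Y.obj) (n := n + Y.deg - X.deg) f +
      ((Y.shift - X.shift : ℝ) : WithBot ℝ) := rfl

lemma len_homTranslate (a n : ℤ) (f : hom k X Y n) : len (homTranslate k a n f) = len f := by
  rw [len_def, len_def]
  congr 1
  exact len_degCast _ _ _

lemma len_homTranslateLeft (a : ℤ) {n m : ℤ} (h : n + a = m) (f : hom k X Y n) :
    len (homTranslateLeft k a h f) = len f := by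
  rw [len_def, len_def]
  congr 1
  exact len_degCast _ _ _

lemma d_homTranslate (a n m : ℤ) (f : hom k X Y n) :
    d n m (homTranslate k a n f) = a.negOnePow • homTranslate k a m (d n m f) := by
  have h := d_degCast k (A := A) (X := X.obj) (Y := Y.obj)
    (show n + Y.deg - X.deg = n + (Y.deg + a) - (X.deg + a) by omega)
    (show m + Y.deg - X.deg = m + (Y.deg + a) - (X.deg + a) by omega) f
  change (Y.deg + a).negOnePow • d (k := k) (A := A) (X := X.obj) (Y := Y.obj)
      (n + (Y.deg + a) - (X.deg + a)) (m + (Y.deg + a) - (X.deg + a))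
      (degCast k (A := A) (X := X.obj) (Y := Y.obj) _ f) =
    a.negOnePow • degCast k (A := A) (X := X.obj) (Y := Y.obj)
      (show m + Y.deg - X.deg = m + (Y.deg + a) - (X.deg + a) by omega) (Y.deg.negOnePow •
      d (k := k) (A := A) (X := X.obj) (Y := Y.obj) (n + Y.deg - X.deg) (m + Y.deg - X.deg) f)
  rw [h, Int.negOnePow_add, mul_comm, mul_smul]
  congr 1
  rw [Units.smul_def, Units.smul_def, map_zsmul]

lemma d_homTranslateLeft (a : ℤ) {n m n' m' : ℤ} (h : n + a = m) (h' : n' + a = m')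
    (f : hom k X Y n) :
    d m m' (homTranslateLeft k a h f) = homTranslateLeft k a h' (d n n' f) := by
  have h := d_degCast k (A := A) (X := X.obj) (Y := Y.obj)
    (show n + Y.deg - X.deg = m + Y.deg - (X.deg + a) by omega)
    (show n' + Y.deg - X.deg = m' + Y.deg - (X.deg + a) by omega) f
  change Y.deg.negOnePow • d (k := k) (A := A) (X := X.obj) (Y := Y.obj)
      (m + Y.deg - (X.deg + a)) (m' + Y.deg - (X.deg + a))
      (degCast k (A := A) (X := X.obj) (Y := Y.obj) _ f) =
    degCast k (A := A) (X := X.obj) (Y := Y.obj)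
      (show n' + Y.deg - X.deg = m' + Y.deg - (X.deg + a) by omega) (Y.deg.negOnePow •
      d (k := k) (A := A) (X := X.obj) (Y := Y.obj) (n + Y.deg - X.deg) (n' + Y.deg - X.deg) f)
  rw [h, Units.smul_def, Units.smul_def, map_zsmul]

lemma comp_homTranslate (a : ℤ) {m n p : ℤ} (h : m + n = p) (g : hom k Y Z m) (f : hom k X Y n) :
    comp h (homTranslate k a m g) (homTranslate k a n f) = homTranslate k a p (comp h g f) := by
  exact comp_degCast k (A := A) _ _ _ _ _ _ _

lemma comp_homTranslateLeft_homTranslate (a : ℤ) {m n p m' p' : ℤ} (h : m + n = p)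
    (h' : m + a = m') (h'' : p + a = p') (h''' : m' + n = p') (g : hom k Y Z m)
    (f : hom k X Y n) :
    comp h''' (homTranslateLeft k a h' g) (homTranslate k a n f) =
      homTranslateLeft k a h'' (comp h g f) := by
  exact comp_degCast k (A := A) _ _ _ _ _ _ _

lemma comp_homTranslateLeft (a : ℤ) {m n p n' p' : ℤ} (h : m + n = p)
    (h' : n + a = n') (h'' : p + a = p') (h''' : m + n' = p') (g : hom k Y Z m)
    (f : hom k X Y n) :
    comp h''' g (homTranslateLeft k a h' f) = homTranslateLeft k a h'' (comp h g f) := by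
  exact comp_degCast k (A := A) rfl _ _ _ _ _ _

lemma id_homTranslate (a : ℤ) (X : ShiftCompletion A) :
    homTranslate k a 0 (FilteredDGCategory.id X) = FilteredDGCategory.id (translate a X) :=
  degCast_degCast k (A := A) _ _ _

end ShiftCompletion

namespace Tw

open FilteredDGCategory ShiftCompletion

variable {k : Type w} [Field k] {A : Type u} [FilteredDGCategory.{w, v} k A] {X Y Z : Tw k A}

/-! #### Filtration shifts -/

/-- The filtration shift `Σ^s X`: all objects are shifted by `Σ^s`, the matrix `q` is the same. -/
def shiftBy (s : ℝ) (X : Tw k A) : Tw k A where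
  size := X.size
  obj i := ShiftCompletion.shiftBy s (X.obj i)
  q := X.q
  q_eq_zero := X.q_eq_zero
  d_q := X.d_q
  len_q_le i j := by
    have h : (X.obj i).shift + s - ((X.obj j).shift + s) = (X.obj i).shift - (X.obj j).shift := by
      ring
    refine le_trans (le_of_eq ?_) (X.len_q_le i j)
    simp only [len_def, ShiftCompletion.shiftBy, h]

/-- The identity matrix, as a morphism from `X` to `Σ^s X`. -/
def toShift (s : ℝ) (X : Tw k A) : hom k X (shiftBy s X) 0 := Mat.id k X.obj

/-- The identity matrix, as a morphism from `Σ^s X` to `X`. -/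
def fromShift (s : ℝ) (X : Tw k A) : hom k (shiftBy s X) X 0 := Mat.id k X.obj

lemma toShift_mem (s : ℝ) (X : Tw k A) : toShift s X ∈ cycles k X (shiftBy s X) s := by
  refine ⟨FilteredDGCategory.d_id (k := k) X 1, (Mat.len_le_iff _ _).2 fun i j => ?_⟩
  have h : ((X.obj i).shift + s - (X.obj j).shift : ℝ) =
    (X.obj i).shift - (X.obj j).shift + s := by ring
  have h' := (Mat.len_le_iff (k := k) _ _).1 (Mat.len_id_le (k := k) (X := X.obj)) i j
  rw [len_def] at h' ⊢
  simp only [ShiftCompletion.shiftBy, shiftBy, h, WithBot.coe_add, ← add_assoc]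
  exact (add_le_add_left h' _).trans (zero_add _).le

lemma fromShift_mem (s : ℝ) (X : Tw k A) : fromShift s X ∈ cycles k (shiftBy s X) X (-s) := by
  refine ⟨FilteredDGCategory.d_id (k := k) X 1, (Mat.len_le_iff _ _).2 fun i j => ?_⟩
  have h : ((X.obj i).shift - ((X.obj j).shift + s) : ℝ) =
    (X.obj i).shift - (X.obj j).shift + -s := by ring
  have h' := (Mat.len_le_iff (k := k) _ _).1 (Mat.len_id_le (k := k) (X := X.obj)) i j
  rw [len_def] at h' ⊢
  simp only [ShiftCompletion.shiftBy, shiftBy, h, WithBot.coe_add, ← add_assoc]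
  exact (add_le_add_left h' _).trans (zero_add _).le

variable (k A) in
/-- The shift functor of `H^0(Tw(A))`: on objects it is `X ↦ Σ^r X`, and the natural
transformations `η_{r,s}` are given by identity matrices. -/
def shiftFunctor : ShiftFunctor k (H0 k (Tw k A)) :=
  ShiftData.shiftFunctor
    { obj r X := ⟨shiftBy r X.obj⟩
      e r X := H0Hom.mk (toShift r X.obj) (toShift_mem r X.obj)
      e' r X := H0Hom.mk (fromShift r X.obj) (fromShift_mem r X.obj)
      e'_e r X := congrArg _ (Subtype.ext
        (FilteredDGCategory.id_comp (k := k) (FilteredDGCategory.id (k := k) X.obj)))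
      e_e' r X := congrArg _ (Subtype.ext
        (FilteredDGCategory.id_comp (k := k) (FilteredDGCategory.id (k := k) X.obj))) }

/-! #### The translation -/

/-- The translation `X[a]`: all objects are translated by `[a]`, and `q` is replaced by
`(-1)^a q`. -/
def translate (a : ℤ) (X : Tw k A) : Tw k A where
  size := X.size
  obj i := ShiftCompletion.translate a (X.obj i)
  q i j := a.negOnePow • homTranslate k a 1 (X.q i j)
  q_eq_zero i j h := by rw [X.q_eq_zero i j h, map_zero, smul_zero]
  d_q i j := by
    have h := X.d_q i j
    simp only [Units.smul_def, map_zsmul, LinearMap.smul_apply, comp_homTranslate,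
      d_homTranslate, smul_smul, ← map_sum] at h ⊢
    norm_cast
    simp only [Int.units_mul_self, Units.val_one, one_smul]
    rw [← map_sum, ← map_add, h, map_zero]
  len_q_le i j := by
    rw [len_units_smul, len_homTranslate]
    exact X.len_q_le i j

/-- The map `f ↦ f[a]` on matrices. -/
def homTranslate (a : ℤ) (X Y : Tw k A) (n : ℤ) :
    hom k X Y n →ₗ[k] hom k (translate a X) (translate a Y) n where
  toFun f i j := ShiftCompletion.homTranslate k a n (f i j)
  map_add' f g := by funext i j; exact map_add _ _ _
  map_smul' c f := by funext i j; exact map_smul _ _ _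

lemma homTranslate_apply (a : ℤ) (X Y : Tw k A) (n : ℤ) (f : hom k X Y n)
    (i : Fin Y.size) (j : Fin X.size) :
    homTranslate a X Y n f i j = ShiftCompletion.homTranslate k a n (f i j) := rfl

lemma d_eq (n m : ℤ) (h : n + 1 = m) (f : hom k X Y n) : d n m f = dHom n m h f := by
  change (if h : n + 1 = m then dHom n m h else 0) f = _
  rw [dif_pos h]

lemma d_apply (n m : ℤ) (h : n + 1 = m) (f : hom k X Y n) (i : Fin Y.size) (j : Fin X.size) :
    d n m f i j = d (k := k) n m (f i j) +
      ∑ l, comp (show 1 + n = m by omega) (Y.q i l) (f l j) -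
      n.negOnePow • ∑ l, comp h (f i l) (X.q l j) := by
  rw [d_eq n m h]
  rfl

lemma d_homTranslate (a n m : ℤ) (h : n + 1 = m) (f : hom k X Y n) :
    d n m (homTranslate a X Y n f) = a.negOnePow • homTranslate a X Y m (d n m f) := by
  have e (i : Fin Y.size) (j : Fin X.size) :
      d (k := k) n m (ShiftCompletion.homTranslate k a n (f i j)) +
      ∑ l, comp (show 1 + n = m by omega) (a.negOnePow • ShiftCompletion.homTranslate k a 1 (Y.q i l))
        (ShiftCompletion.homTranslate k a n (f l j)) -
      n.negOnePow • ∑ l, comp h (ShiftCompletion.homTranslate k a n (f i l))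
        (a.negOnePow • ShiftCompletion.homTranslate k a 1 (X.q l j)) =
      a.negOnePow • ShiftCompletion.homTranslate k a m (d (k := k) n m (f i j) +
        ∑ l, comp (show 1 + n = m by omega) (Y.q i l) (f l j) -
        n.negOnePow • ∑ l, comp h (f i l) (X.q l j)) := by
    rw [ShiftCompletion.d_homTranslate]
    rcases Int.units_eq_one_or a.negOnePow with ha | ha <;>
    rcases Int.units_eq_one_or n.negOnePow with hn | hn <;>
    simp only [ha, hn, one_smul, Units.neg_smul, map_neg, LinearMap.neg_apply,
      ShiftCompletion.comp_homTranslate, map_add, map_sub, map_sum, Finset.sum_neg_distrib,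
      neg_add_rev, neg_sub, sub_neg_eq_add, neg_neg] <;> abel
  funext i j
  refine (d_apply n m h _ i j).trans ((e i j).trans ?_)
  rw [← d_apply n m h f i j]
  rfl

lemma comp_apply {m n p : ℤ} (h : m + n = p) (g : hom k Y Z m) (f : hom k X Y n)
    (i : Fin Z.size) (j : Fin X.size) :
    comp h g f i j = ∑ l, comp h (g i l) (f l j) := rfl

lemma comp_homTranslate (a : ℤ) {m n p : ℤ} (h : m + n = p) (g : hom k Y Z m) (f : hom k X Y n) :
    comp h (homTranslate a Y Z m g) (homTranslate a X Y n f) =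
      homTranslate a X Z p (comp h g f) := by
  have e (i : Fin Z.size) (j : Fin X.size) :
      ∑ l, comp h (ShiftCompletion.homTranslate k a m (g i l))
        (ShiftCompletion.homTranslate k a n (f l j)) =
      ShiftCompletion.homTranslate k a p (∑ l, comp h (g i l) (f l j)) := by
    rw [map_sum]
    exact Finset.sum_congr rfl fun l _ =>
      ShiftCompletion.comp_homTranslate a h (g i l) (f l j)
  funext i j
  exact e i j

lemma homTranslate_id (a : ℤ) (X : Tw k A) :
    homTranslate a X X 0 (FilteredDGCategory.id X) = FilteredDGCategory.id (translate a X) := by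
  have e (i j : Fin X.size) : ShiftCompletion.homTranslate k a 0 (Mat.id k X.obj i j) =
      Mat.id k (fun i => ShiftCompletion.translate a (X.obj i)) i j := by
    rcases eq_or_ne j i with rfl | h
    · rw [Mat.id_self, Mat.id_self, id_homTranslate]
    · rw [Mat.id_of_ne h, Mat.id_of_ne h, map_zero]
  funext i j
  exact e i j

lemma len_homTranslate_le (a n : ℤ) (f : hom k X Y n) :
    len (homTranslate a X Y n f) ≤ len f :=
  (Mat.len_le_iff _ _).2 fun i j =>
    (ShiftCompletion.len_homTranslate a n (f i j)).le.trans (Mat.le_len f i j)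

lemma homTranslate_mem_cycles (a : ℤ) {r : ℝ} {f : hom k X Y 0} (hf : f ∈ cycles k X Y r) :
    homTranslate a X Y 0 f ∈ cycles k (translate a X) (translate a Y) r := by
  refine ⟨?_, (len_homTranslate_le a 0 f).trans hf.2⟩
  have hf' : d (k := k) 0 1 f = 0 := hf.1
  show d (k := k) 0 1 _ = 0
  rw [d_homTranslate a 0 1 (zero_add 1), hf']
  simp

/-- The map `f ↦ f[a]` in cohomology. -/
def h0Translate (a : ℤ) (X Y : Tw k A) (r : ℝ) :
    H0Hom k X Y r →ₗ[k] H0Hom k (translate a X) (translate a Y) r :=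
  Submodule.mapQ _ _
    ((homTranslate a X Y 0).restrict fun _ hf => homTranslate_mem_cycles a hf) (by
    rintro ⟨f, hf⟩ hf'
    obtain ⟨u, hu, rfl⟩ : f ∈ boundaries k X Y r := hf'
    refine ⟨a.negOnePow • homTranslate a X Y (-1) u, ?_, ?_⟩
    · exact (len_units_smul _ _).le.trans ((len_homTranslate_le a _ u).trans hu)
    · change d (k := k) (-1) 0 _ = homTranslate a X Y 0 (d (-1) 0 u)
      rw [Units.smul_def, map_zsmul, d_homTranslate a (-1) 0 (neg_add_cancel 1),
        Units.smul_def, smul_smul]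
      norm_cast
      simp)

variable (k A) in
/-- The translation functor `[a]` of `H^0(Tw(A))`. -/
def translation (a : ℤ) : PersFunctor k (H0 k (Tw k A)) (H0 k (Tw k A)) where
  obj X := ⟨translate a X.obj⟩
  map := h0Translate a _ _ _
  map_pers := by rintro _ _ _ _ h ⟨f, hf⟩; rfl
  map_id X := congrArg _ (Subtype.ext (homTranslate_id a X.obj))
  map_comp := by
    rintro _ _ _ _ _ _ h ⟨g, hg⟩ ⟨f, hf⟩
    exact congrArg _ (Subtype.ext (comp_homTranslate a (add_zero 0) g f).symm)

end Tw

namespace Tw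

open FilteredDGCategory ShiftCompletion

variable {k : Type w} [Field k] {A : Type u} [FilteredDGCategory.{w, v} k A] {X Y : Tw k A}

/-! #### Mapping cones -/

/-- The objects of the cone of a morphism `X → Y`: those of `Y`, followed by those of `X[1]`. -/
abbrev coneObj (X Y : Tw k A) : Fin Y.size ⊕ Fin X.size → ShiftCompletion A :=
  Sum.elim Y.obj (translate 1 X).obj

/-- The block matrix with rows `(q_Y, f)` and `(0, -q_X)`; here `-q_X` is the matrix of `X[1]`. -/
def coneQ (f : hom k X Y 0) :
    ∀ i j : Fin Y.size ⊕ Fin X.size, hom k (coneObj X Y j) (coneObj X Y i) 1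
  | Sum.inl i, Sum.inl j => Y.q i j
  | Sum.inl i, Sum.inr j => ShiftCompletion.homTranslateLeft k 1 (zero_add 1) (f i j)
  | Sum.inr _, Sum.inl _ => (0 : hom k (A := ShiftCompletion A) _ _ _)
  | Sum.inr i, Sum.inr j => (translate 1 X).q i j

lemma coneQ_eq_zero (f : hom k X Y 0) (i j : Fin Y.size ⊕ Fin X.size)
    (h : finSumFinEquiv j ≤ finSumFinEquiv i) : coneQ f i j = 0 := by
  rcases i with i | i <;> rcases j with j | j
  · exact Y.q_eq_zero i j (by
      simpa only [finSumFinEquiv_apply_left, Fin.le_def, Fin.val_castAdd] using h)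
  · simp only [finSumFinEquiv_apply_left, finSumFinEquiv_apply_right, Fin.le_def,
      Fin.val_natAdd, Fin.val_castAdd] at h
    omega
  · rfl
  · exact (translate 1 X).q_eq_zero i j (show j.1 ≤ i.1 by
      simpa only [finSumFinEquiv_apply_right, Fin.le_def, Fin.val_natAdd,
        Nat.add_le_add_iff_left] using h)

lemma len_coneQ_le (f : hom k X Y 0) (hf : len f ≤ 0) (i j : Fin Y.size ⊕ Fin X.size) :
    len (coneQ f i j) ≤ 0 := by
  rcases i with i | i <;> rcases j with j | j
  · exact Y.len_q_le i j
  · exact (ShiftCompletion.len_homTranslateLeft 1 (zero_add 1) (f i j)).le.trans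
      ((Mat.le_len f i j).trans hf)
  · exact (len_zero (k := k)).le.trans bot_le
  · exact (translate 1 X).len_q_le i j

lemma d_coneQ (f : hom k X Y 0) (hf : d (k := k) 0 1 f = 0) (i j : Fin Y.size ⊕ Fin X.size) :
    d 1 2 (coneQ f i j) +
      ∑ l, comp (one_add_one_eq_two (R := ℤ)) (coneQ f i l) (coneQ f l j) = 0 := by
  rw [Fintype.sum_sum_type]
  rcases i with i | i <;> rcases j with j | j
  · have h : ∑ l : Fin X.size, comp (one_add_one_eq_two (R := ℤ)) (coneQ f (Sum.inl i) (Sum.inr l))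
        (coneQ f (Sum.inr l) (Sum.inl j)) = 0 :=
      Finset.sum_eq_zero fun l _ => map_zero _
    rw [h, add_zero]
    exact Y.d_q i j
  · have e (i : Fin Y.size) (j : Fin X.size) :
        d (k := k) 1 2 (ShiftCompletion.homTranslateLeft k 1 (zero_add 1) (f i j)) +
          (∑ l, comp (one_add_one_eq_two (R := ℤ)) (Y.q i l)
            (ShiftCompletion.homTranslateLeft k 1 (zero_add 1) (f l j)) +
          ∑ l, comp (one_add_one_eq_two (R := ℤ))
            (ShiftCompletion.homTranslateLeft k 1 (zero_add 1) (f i l))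
            ((1 : ℤ).negOnePow • ShiftCompletion.homTranslate k 1 1 (X.q l j))) =
        ShiftCompletion.homTranslateLeft k 1 (one_add_one_eq_two (R := ℤ))
          (d (k := k) 0 1 (f i j) + ∑ l, comp (show 1 + 0 = 1 by omega) (Y.q i l) (f l j) -
            (0 : ℤ).negOnePow • ∑ l, comp (zero_add 1) (f i l) (X.q l j)) := by
      rw [ShiftCompletion.d_homTranslateLeft 1 (zero_add 1) (one_add_one_eq_two (R := ℤ))]
      have e1 (l : Fin Y.size) := ShiftCompletion.comp_homTranslateLeft 1 (show 1 + 0 = 1 by omega)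
        (zero_add 1) (one_add_one_eq_two (R := ℤ)) (one_add_one_eq_two (R := ℤ)) (Y.q i l) (f l j)
      have e2 (l : Fin X.size) := ShiftCompletion.comp_homTranslateLeft_homTranslate 1
        (zero_add 1) (zero_add 1) (one_add_one_eq_two (R := ℤ)) (one_add_one_eq_two (R := ℤ))
        (f i l) (X.q l j)
      simp only [Int.negOnePow_one, Int.negOnePow_zero, one_smul, Units.neg_smul, map_neg, e1, e2,
        map_add, map_sub, map_sum, Finset.sum_neg_distrib]
      abel
    refine (e i j).trans ?_
    rw [← d_apply 0 1 (zero_add 1) f i j, hf]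
    exact map_zero _
  · have h (l) : comp (one_add_one_eq_two (R := ℤ)) (coneQ f (Sum.inr i) (Sum.inl l))
        (coneQ f (Sum.inl l) (Sum.inl j)) = 0 := LinearMap.map_zero₂ _ _
    have h' (l) : comp (one_add_one_eq_two (R := ℤ)) (coneQ f (Sum.inr i) (Sum.inr l))
        (coneQ f (Sum.inr l) (Sum.inl j)) = 0 := map_zero _
    simp only [h, h', Finset.sum_const_zero, add_zero]
    exact map_zero _
  · have h : ∑ l : Fin Y.size, comp (one_add_one_eq_two (R := ℤ)) (coneQ f (Sum.inr i) (Sum.inl l))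
        (coneQ f (Sum.inl l) (Sum.inr j)) = 0 :=
      Finset.sum_eq_zero fun l _ => LinearMap.map_zero₂ _ _
    rw [h, zero_add]
    exact (translate 1 X).d_q i j

/-- The cone of a closed morphism `f : X → Y` of degree `0` and filtration level `≤ 0`. -/
def cone (f : hom k X Y 0) (hf : f ∈ cycles k X Y 0) : Tw k A where
  size := Y.size + X.size
  obj i := coneObj X Y (finSumFinEquiv.symm i)
  q i j := coneQ f (finSumFinEquiv.symm i) (finSumFinEquiv.symm j)
  q_eq_zero i j h := coneQ_eq_zero f _ _ (by simpa using h)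
  d_q i j := by
    rw [Equiv.sum_comp finSumFinEquiv.symm fun l => comp (one_add_one_eq_two (R := ℤ))
      (coneQ f (finSumFinEquiv.symm i) l) (coneQ f l (finSumFinEquiv.symm j))]
    exact d_coneQ f hf.1 _ _
  len_q_le i j := len_coneQ_le f hf.2 _ _

/-- The inclusion `Y → cone f`. -/
def coneIncl (f : hom k X Y 0) (hf : f ∈ cycles k X Y 0) : hom k Y (cone f hf) 0 :=
  fun i j => Mat.id k (coneObj X Y) (finSumFinEquiv.symm i) (Sum.inl j)

/-- The projection `cone f → X[1]`. -/
def coneProj (f : hom k X Y 0) (hf : f ∈ cycles k X Y 0) : hom k (cone f hf) (translate 1 X) 0 :=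
  fun i j => Mat.id k (coneObj X Y) (Sum.inr i) (finSumFinEquiv.symm j)

lemma d_id_apply {I : Type*} [DecidableEq I] (Z : I → ShiftCompletion A) (i j : I) :
    d (k := k) 0 1 (Mat.id k Z i j) = 0 :=
  congrFun (congrFun (Mat.d_id (k := k) (X := Z) 1) i) j

lemma sum_comp_id {I : Type*} [Fintype I] [DecidableEq I] {Z : I → ShiftCompletion A}
    {W : ShiftCompletion A} {n : ℤ} (f : ∀ i, hom k (Z i) W n) (j : I) :
    ∑ l, comp (add_zero n) (f l) (Mat.id k Z l j) = f j := by
  rw [Finset.sum_eq_single j]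
  · rw [Mat.id_self, FilteredDGCategory.comp_id]
  · intro l _ hl
    rw [Mat.id_of_ne hl.symm]; exact map_zero _
  · simp

lemma sum_id_comp {I : Type*} [Fintype I] [DecidableEq I] {Z : I → ShiftCompletion A}
    {W : ShiftCompletion A} {n : ℤ} (f : ∀ i, hom k W (Z i) n) (i : I) :
    ∑ l, comp (zero_add n) (Mat.id k Z i l) (f l) = f i := by
  rw [Finset.sum_eq_single i]
  · rw [Mat.id_self, FilteredDGCategory.id_comp]
  · intro l _ hl
    rw [Mat.id_of_ne hl]; exact LinearMap.map_zero₂ _ _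
  · simp

lemma len_id_apply_le {I : Type*} [Fintype I] [DecidableEq I] (Z : I → ShiftCompletion A)
    (i j : I) : len (Mat.id k Z i j) ≤ 0 :=
  (Mat.le_len _ i j).trans Mat.len_id_le

lemma coneIncl_mem (f : hom k X Y 0) (hf : f ∈ cycles k X Y 0) :
    coneIncl f hf ∈ cycles k Y (cone f hf) 0 := by
  refine ⟨?_, (Mat.len_le_iff _ _).2 fun i j => len_id_apply_le (coneObj X Y) _ _⟩
  have e1 (a : Fin Y.size ⊕ Fin X.size) (j : Fin Y.size) :
      ∑ l : Fin Y.size, comp (zero_add 1) (Mat.id k (coneObj X Y) a (Sum.inl l))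
        (coneQ f (Sum.inl l) (Sum.inl j)) = coneQ f a (Sum.inl j) := by
    have h := sum_id_comp (fun l => coneQ f l (Sum.inl j)) a
    rw [Fintype.sum_sum_type] at h
    rw [← h]
    refine (add_eq_left.2 (Finset.sum_eq_zero fun l _ => ?_)).symm
    exact map_zero _
  have e2 (a : Fin Y.size ⊕ Fin X.size) (j : Fin Y.size) :
      ∑ l : Fin (Y.size + X.size), comp (add_zero 1) (coneQ f a (finSumFinEquiv.symm l))
        (Mat.id k (coneObj X Y) (finSumFinEquiv.symm l) (Sum.inl j)) = coneQ f a (Sum.inl j) := by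
    rw [Equiv.sum_comp finSumFinEquiv.symm fun l => comp (add_zero 1) (coneQ f a l)
      (Mat.id k (coneObj X Y) l (Sum.inl j))]
    exact sum_comp_id (fun l => coneQ f a l) (Sum.inl j)
  have e (a : Fin Y.size ⊕ Fin X.size) (j : Fin Y.size) :
      d (k := k) 0 1 (Mat.id k (coneObj X Y) a (Sum.inl j)) +
        ∑ l : Fin (Y.size + X.size), comp (add_zero 1) (coneQ f a (finSumFinEquiv.symm l))
          (Mat.id k (coneObj X Y) (finSumFinEquiv.symm l) (Sum.inl j)) -
        (0 : ℤ).negOnePow • ∑ l : Fin Y.size,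
          comp (zero_add 1) (Mat.id k (coneObj X Y) a (Sum.inl l))
            (coneQ f (Sum.inl l) (Sum.inl j)) = 0 := by
    rw [e1, e2, d_id_apply, Int.negOnePow_zero, one_smul, zero_add, sub_self]
  refine (d_eq 0 1 (zero_add 1) (coneIncl f hf)).trans ?_
  funext i j
  exact e (finSumFinEquiv.symm i) j

lemma coneProj_mem (f : hom k X Y 0) (hf : f ∈ cycles k X Y 0) :
    coneProj f hf ∈ cycles k (cone f hf) (translate 1 X) 0 := by
  refine ⟨?_, (Mat.len_le_iff _ _).2 fun i j => len_id_apply_le (coneObj X Y) _ _⟩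
  have e1 (i : Fin X.size) (b : Fin Y.size ⊕ Fin X.size) :
      ∑ l : Fin X.size, comp (add_zero 1) (coneQ f (Sum.inr i) (Sum.inr l))
        (Mat.id k (coneObj X Y) (Sum.inr l) b) = coneQ f (Sum.inr i) b := by
    have h := sum_comp_id (fun l => coneQ f (Sum.inr i) l) b
    rw [Fintype.sum_sum_type] at h
    rw [← h]
    refine (add_eq_right.2 (Finset.sum_eq_zero fun l _ => ?_)).symm
    exact LinearMap.map_zero₂ _ _
  have e2 (i : Fin X.size) (b : Fin Y.size ⊕ Fin X.size) :
      ∑ l : Fin (Y.size + X.size),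
        comp (zero_add 1) (Mat.id k (coneObj X Y) (Sum.inr i) (finSumFinEquiv.symm l))
          (coneQ f (finSumFinEquiv.symm l) b) = coneQ f (Sum.inr i) b := by
    rw [Equiv.sum_comp finSumFinEquiv.symm fun l => comp (zero_add 1)
      (Mat.id k (coneObj X Y) (Sum.inr i) l) (coneQ f l b)]
    exact sum_id_comp (fun l => coneQ f l b) (Sum.inr i)
  have e (i : Fin X.size) (b : Fin Y.size ⊕ Fin X.size) :
      d (k := k) 0 1 (Mat.id k (coneObj X Y) (Sum.inr i) b) +
        ∑ l : Fin X.size, comp (add_zero 1) (coneQ f (Sum.inr i) (Sum.inr l))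
          (Mat.id k (coneObj X Y) (Sum.inr l) b) -
        (0 : ℤ).negOnePow • ∑ l : Fin (Y.size + X.size),
          comp (zero_add 1) (Mat.id k (coneObj X Y) (Sum.inr i) (finSumFinEquiv.symm l))
            (coneQ f (finSumFinEquiv.symm l) b) = 0 := by
    rw [e1, e2, d_id_apply, Int.negOnePow_zero, one_smul, zero_add, sub_self]
  refine (d_eq 0 1 (zero_add 1) (coneProj f hf)).trans ?_
  funext i j
  exact e i (finSumFinEquiv.symm j)

end Tw

/-! ### Filtered pre-triangulated dg-categories -/

section

open FilteredDGCategory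

/-- A filtered dg-functor. -/
structure FilteredDGFunctor (k : Type w) [Field k] (A : Type u) (B : Type u')
    [FilteredDGCategory.{w, v} k A] [FilteredDGCategory.{w, v'} k B] where
  obj : A → B
  map : ∀ {X Y : A} {n : ℤ}, hom k X Y n →ₗ[k] hom k (obj X) (obj Y) n
  map_d : ∀ {X Y : A} (n m : ℤ) (f : hom k X Y n), map (d n m f) = d n m (map f)
  map_id : ∀ X : A, map (FilteredDGCategory.id X) = FilteredDGCategory.id (k := k) (obj X)
  map_comp : ∀ {X Y Z : A} {m n p : ℤ} (h : m + n = p) (g : hom k Y Z m) (f : hom k X Y n),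
    map (comp h g f) = comp h (map g) (map f)
  len_map_le : ∀ {X Y : A} {n : ℤ} (f : hom k X Y n), len (map f) ≤ len f

/-- Two objects of a filtered dg-category are isomorphic: there are closed morphisms of degree `0`
and filtration level `≤ 0` between them which are inverse to each other. -/
def FilteredDGCategory.Isomorphic (k : Type w) [Field k] {A : Type u}
    [FilteredDGCategory.{w, v} k A] (X Y : A) : Prop :=
  ∃ (f : hom k X Y 0) (g : hom k Y X 0), f ∈ cycles k X Y 0 ∧ g ∈ cycles k Y X 0 ∧
    comp (add_zero 0) g f = FilteredDGCategory.id X ∧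
    comp (add_zero 0) f g = FilteredDGCategory.id Y

/-- A filtered dg-functor is an equivalence of filtered dg-categories if it induces isomorphisms
of filtered cochain complexes of morphisms and is essentially surjective. -/
def FilteredDGFunctor.IsEquivalence {k : Type w} [Field k] {A : Type u} {B : Type u'}
    [FilteredDGCategory.{w, v} k A] [FilteredDGCategory.{w, v'} k B]
    (F : FilteredDGFunctor k A B) : Prop :=
  (∀ (X Y : A) (n : ℤ),
    Function.Bijective (F.map : hom k X Y n →ₗ[k] hom k (F.obj X) (F.obj Y) n)) ∧
  (∀ (X Y : A) (n : ℤ) (f : hom k X Y n), len (F.map f) = len f) ∧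
  ∀ Z : B, ∃ X : A, Isomorphic k (F.obj X) Z

namespace Tw

open ShiftCompletion

variable (k : Type w) [Field k] {A : Type u} [FilteredDGCategory.{w, v} k A]

/-- The object `X` of `A` as a twisted complex with a single term and `q = 0`. -/
def single (X : A) : Tw k A where
  size := 1
  obj _ := ⟨X, 0, 0⟩
  q _ _ := 0
  q_eq_zero _ _ _ := rfl
  d_q i j := by simp
  len_q_le i j := by simp

variable {k}

/-- A morphism `f` of `A` as a `1 × 1`-matrix. -/
def singleHom (X Y : A) (n : ℤ) : hom k X Y n →ₗ[k] hom k (single k X) (single k Y) n where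
  toFun f := fun _ _ => degCast k (A := A) (X := X) (Y := Y) (show n = n + 0 - 0 by omega) f
  map_add' f g := by
    funext i j
    exact map_add (degCast k (A := A) (X := X) (Y := Y) (show n = n + 0 - 0 by omega)) f g
  map_smul' c f := by
    funext i j
    exact map_smul (degCast k (A := A) (X := X) (Y := Y) (show n = n + 0 - 0 by omega)) c f

lemma singleHom_apply (X Y : A) (n : ℤ) (f : hom k X Y n) (i j : Fin 1) :
    singleHom X Y n f i j =
      degCast k (A := A) (X := X) (Y := Y) (show n = n + 0 - 0 by omega) f := rfl

lemma singleHom_d (X Y : A) (n m : ℤ) (f : hom k X Y n) :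
    singleHom X Y m (d n m f) = d n m (singleHom X Y n f) := by
  by_cases h : n + 1 = m
  · refine Eq.trans ?_ (d_eq n m h (singleHom X Y n f)).symm
    rw [dHom_apply]
    have e1 : Mat.comp k (show 1 + n = m by omega) (single k Y).q (singleHom X Y n f) = 0 :=
      LinearMap.map_zero₂ _ _
    have e2 : Mat.comp k h (singleHom X Y n f) (single k X).q = 0 := map_zero _
    rw [e1, e2, smul_zero, sub_zero, add_zero]
    funext i j
    have := d_degCast k (A := A) (X := X) (Y := Y) (show n = n + 0 - 0 by omega)
      (show m = m + 0 - 0 by omega) f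
    exact (this.symm.trans (one_smul ℤˣ _).symm :)
  · rw [d_shape n m h, d_shape n m h, map_zero]

lemma singleHom_id (X : A) :
    singleHom X X 0 (FilteredDGCategory.id (k := k) X) =
      FilteredDGCategory.id (single k X) := by
  have e (i j : Fin 1) : Mat.id k (fun _ : Fin 1 => (⟨X, 0, 0⟩ : ShiftCompletion A)) i j =
      FilteredDGCategory.id (⟨X, 0, 0⟩ : ShiftCompletion A) := by
    obtain rfl := Subsingleton.elim i j
    exact Mat.id_self _
  funext i j
  exact (e i j).symm

lemma singleHom_comp {X Y Z : A} {m n p : ℤ} (h : m + n = p) (g : hom k Y Z m)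
    (f : hom k X Y n) :
    singleHom X Z p (comp h g f) = comp h (singleHom Y Z m g) (singleHom X Y n f) := by
  funext i j
  refine Eq.trans ?_ (Fin.sum_univ_one fun l : Fin 1 =>
    comp (k := k) h (singleHom Y Z m g i l) (singleHom X Y n f l j)).symm
  exact (comp_degCast k (A := A) (show m = m + 0 - 0 by omega) (show n = n + 0 - 0 by omega)
    (show p = p + 0 - 0 by omega) h (by omega) g f).symm

variable (k)

/-- The inclusion of a filtered dg-category into its filtered pre-triangulated completion. -/
def inclusion (A : Type u) [FilteredDGCategory.{w, v} k A] : FilteredDGFunctor k A (Tw k A) where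
  obj X := single k X
  map {X Y n} := singleHom X Y n
  map_d := singleHom_d _ _
  map_id := singleHom_id
  map_comp := singleHom_comp
  len_map_le {X Y n} f := (Mat.len_le_iff _ _).2 fun i j => by
    have e : len (degCast k (A := A) (X := X) (Y := Y) (show n = n + 0 - 0 by omega) f) +
        ((0 - 0 : ℝ) : WithBot ℝ) ≤ len f := by
      rw [len_degCast]; simp
    exact e

end Tw

/-- A filtered dg-category `A` is pre-triangulated if the inclusion `A → Tw(A)` is an equivalence
of filtered dg-categories. -/
def IsPretriangulated (k : Type w) [Field k] (A : Type u) [FilteredDGCategory.{w, v} k A] :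
    Prop :=
  (Tw.inclusion k A).IsEquivalence

end

/-! ### Filtered cochain complexes -/

/-- A filtered cochain complex over the field `k`: a cochain complex together with a filtration
function. -/
structure FilteredComplex (k : Type w) [Field k] where
  complex : CochainComplex (ModuleCat.{v} k) ℤ
  len : ∀ {i : ℤ}, complex.X i → WithBot ℝ
  len_smul_add_le : ∀ {i : ℤ} (a : k) (x y : complex.X i), a ≠ 0 →
    len (a • x + y) ≤ max (len x) (len y)
  len_eq_bot_iff : ∀ {i : ℤ} (x : complex.X i), len x = ⊥ ↔ x = 0
  len_d_le : ∀ (i j : ℤ) (x : complex.X i), len (complex.d i j x) ≤ len x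

namespace FilteredComplex

open CochainComplex CochainComplex.HomComplex

variable {k : Type w} [Field k] {X Y Z : FilteredComplex.{w, v} k}

@[simp]
lemma len_zero (X : FilteredComplex.{w, v} k) (i : ℤ) : X.len (0 : X.complex.X i) = ⊥ :=
  (X.len_eq_bot_iff _).2 rfl

lemma len_add_le (X : FilteredComplex.{w, v} k) {i : ℤ} (x y : X.complex.X i) :
    X.len (x + y) ≤ max (X.len x) (X.len y) := by
  simpa using X.len_smul_add_le (1 : k) x y one_ne_zero

lemma len_smul_le (X : FilteredComplex.{w, v} k) {i : ℤ} (a : k) (x : X.complex.X i) :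
    X.len (a • x) ≤ X.len x := by
  rcases eq_or_ne a 0 with rfl | ha
  · simp
  · simpa using X.len_smul_add_le a x 0 ha

lemma len_units_smul_le (X : FilteredComplex.{w, v} k) {i : ℤ} (a : ℤˣ) (x : X.complex.X i) :
    X.len (a • x) ≤ X.len x := by
  rcases Int.units_eq_one_or a with rfl | rfl
  · simp
  · simpa using X.len_smul_le (-1 : k) x

/-- The graded linear map `f : X → Y` of degree `n` satisfies `ℓ(f(x)) ≤ ℓ(x) + r` for all `x`. -/
def IsBoundedBy {n : ℤ} (f : Cochain X.complex Y.complex n) (r : ℝ) : Prop :=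
  ∀ (p q : ℤ) (h : p + n = q) (x : X.complex.X p), Y.len (f.v p q h x) ≤ X.len x + (r : WithBot ℝ)

lemma IsBoundedBy.mono {n : ℤ} {f : Cochain X.complex Y.complex n} {r s : ℝ}
    (hf : IsBoundedBy f r) (h : r ≤ s) : IsBoundedBy f s :=
  fun p q e x => (hf p q e x).trans (add_le_add_right (WithBot.coe_le_coe.2 h) _)

lemma isBoundedBy_zero (n : ℤ) (r : ℝ) : IsBoundedBy (0 : Cochain X.complex Y.complex n) r :=
  fun p q h x => by
    have e : (0 : Cochain X.complex Y.complex n).v p q h x = 0 := rfl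
    rw [e, len_zero]; exact bot_le

lemma IsBoundedBy.add {n : ℤ} {f g : Cochain X.complex Y.complex n} {r : ℝ}
    (hf : IsBoundedBy f r) (hg : IsBoundedBy g r) : IsBoundedBy (f + g) r :=
  fun p q h x => (Y.len_add_le _ _).trans (max_le (hf p q h x) (hg p q h x))

lemma IsBoundedBy.smul {n : ℤ} {f : Cochain X.complex Y.complex n} {r : ℝ}
    (hf : IsBoundedBy f r) (a : k) : IsBoundedBy (a • f) r :=
  fun p q h x => (Y.len_smul_le a _).trans (hf p q h x)

lemma IsBoundedBy.comp {m n p : ℤ} {g : Cochain Y.complex Z.complex m}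
    {f : Cochain X.complex Y.complex n} {r s : ℝ} (hg : IsBoundedBy g s) (hf : IsBoundedBy f r)
    (h : n + m = p) : IsBoundedBy (f.comp g h) (r + s) := fun a b e x => by
  rw [Cochain.comp_v f g h a _ b rfl (by omega)]
  refine (hg _ _ _ _).trans ?_
  rw [WithBot.coe_add, ← add_assoc]
  gcongr
  exact hf _ _ _ _

lemma IsBoundedBy.delta {n : ℤ} {f : Cochain X.complex Y.complex n} {r : ℝ}
    (hf : IsBoundedBy f r) (m : ℤ) : IsBoundedBy (δ n m f) r := by
  by_cases h : n + 1 = m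
  · intro a b e x
    rw [δ_v n m h f a b e (b - 1) (a + 1) rfl rfl]
    refine (Y.len_add_le _ _).trans (max_le ?_ ?_)
    · exact (Y.len_d_le _ _ _).trans (hf _ _ _ _)
    · refine (Y.len_units_smul_le _ _).trans ((hf _ _ _ _).trans ?_)
      gcongr
      exact X.len_d_le _ _ _
  · rw [δ_shape n m h]
    exact isBoundedBy_zero m r

variable (X Y) in
/-- The graded linear maps `f : X → Y` of degree `n` for which there is an `r` with
`ℓ(f(x)) ≤ ℓ(x) + r` for all `x`. -/
def homSubmodule (n : ℤ) : Submodule k (Cochain X.complex Y.complex n) where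
  carrier := {f | ∃ r : ℝ, IsBoundedBy f r}
  zero_mem' := ⟨0, isBoundedBy_zero n 0⟩
  add_mem' := by
    rintro f g ⟨r, hf⟩ ⟨s, hg⟩
    exact ⟨max r s, (hf.mono (le_max_left _ _)).add (hg.mono (le_max_right _ _))⟩
  smul_mem' := by
    rintro a f ⟨r, hf⟩
    exact ⟨r, hf.smul a⟩

open Classical in
/-- The infimum of the real numbers `r` such that `ℓ(f(x)) ≤ ℓ(x) + r` for all `x`. -/
noncomputable def homLen {n : ℤ} (f : Cochain X.complex Y.complex n) : WithBot ℝ :=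
  if f = 0 then ⊥ else ((sInf {r : ℝ | IsBoundedBy f r} : ℝ) : WithBot ℝ)

lemma exists_lt {n : ℤ} {f : Cochain X.complex Y.complex n} (hf : f ≠ 0) :
    ∃ (p q : ℤ) (h : p + n = q) (x : X.complex.X p) (a b : ℝ), f.v p q h x ≠ 0 ∧
      X.len x = a ∧ Y.len (f.v p q h x) = b := by
  by_contra! H
  apply hf
  ext p q h x
  by_contra hx
  have hx' : f.v p q h x ≠ 0 := hx
  have h1 : X.len x ≠ ⊥ := fun e => hx' (by rw [(X.len_eq_bot_iff x).1 e, map_zero])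
  have h2 : Y.len (f.v p q h x) ≠ ⊥ := fun e => hx' ((Y.len_eq_bot_iff _).1 e)
  obtain ⟨a, ha⟩ := WithBot.ne_bot_iff_exists.1 h1
  obtain ⟨b, hb⟩ := WithBot.ne_bot_iff_exists.1 h2
  exact H p q h x a b hx' ha.symm hb.symm

lemma bddBelow_setOf {n : ℤ} {f : Cochain X.complex Y.complex n} (hf : f ≠ 0) :
    BddBelow {r : ℝ | IsBoundedBy f r} := by
  obtain ⟨p, q, h, x, a, b, -, ha, hb⟩ := exists_lt hf
  refine ⟨b - a, fun r hr => ?_⟩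
  have := hr p q h x
  rw [ha, hb, ← WithBot.coe_add, WithBot.coe_le_coe] at this
  linarith

lemma homLen_le_iff {n : ℤ} {f : Cochain X.complex Y.complex n} (hf : ∃ r : ℝ, IsBoundedBy f r)
    (c : ℝ) : homLen f ≤ c ↔ IsBoundedBy f c := by
  classical
  rcases eq_or_ne f 0 with rfl | h0
  · simp [homLen, isBoundedBy_zero]
  rw [homLen, if_neg h0, WithBot.coe_le_coe]
  refine ⟨fun h p q e x => ?_, fun h => csInf_le (bddBelow_setOf h0) h⟩
  rcases eq_or_ne (f.v p q e x) 0 with hx | hx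
  · rw [hx, len_zero]; exact bot_le
  have h1 : X.len x ≠ ⊥ := fun e => hx (by rw [(X.len_eq_bot_iff x).1 e, map_zero])
  have h2 : Y.len (f.v p q e x) ≠ ⊥ := fun e => hx ((Y.len_eq_bot_iff _).1 e)
  obtain ⟨a, ha⟩ := WithBot.ne_bot_iff_exists.1 h1
  obtain ⟨b, hb⟩ := WithBot.ne_bot_iff_exists.1 h2
  have : b - a ≤ sInf {r : ℝ | IsBoundedBy f r} := by
    refine le_csInf hf fun r hr => ?_
    have := hr p q e x
    rw [← ha, ← hb, ← WithBot.coe_add, WithBot.coe_le_coe] at this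
    linarith
  rw [← ha, ← hb, ← WithBot.coe_add, WithBot.coe_le_coe]
  linarith

lemma homLen_eq_bot_iff {n : ℤ} (f : Cochain X.complex Y.complex n) : homLen f = ⊥ ↔ f = 0 := by
  classical
  rw [homLen]
  split_ifs with h <;> simp [h]

lemma le_of_forall_real {a b : WithBot ℝ} (h : ∀ c : ℝ, b ≤ c → a ≤ c) : a ≤ b := by
  induction b with
  | bot =>
    induction a with
    | bot => exact le_rfl
    | coe a =>
      have := h (a - 1) bot_le
      rw [WithBot.coe_le_coe] at this
      linarith
  | coe b => exact h b le_rfl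

lemma homLen_comp_le {m n p : ℤ} {g : Cochain Y.complex Z.complex m}
    {f : Cochain X.complex Y.complex n} (h : n + m = p) (hg : ∃ r : ℝ, IsBoundedBy g r)
    (hf : ∃ r : ℝ, IsBoundedBy f r) : homLen (f.comp g h) ≤ homLen g + homLen f := by
  rcases eq_or_ne g 0 with rfl | hg0
  · rw [Cochain.comp_zero, (homLen_eq_bot_iff _).2 rfl]
    exact bot_le
  rcases eq_or_ne f 0 with rfl | hf0
  · rw [Cochain.zero_comp, (homLen_eq_bot_iff _).2 rfl]
    exact bot_le
  obtain ⟨s, hs⟩ := WithBot.ne_bot_iff_exists.1 fun e => hg0 ((homLen_eq_bot_iff g).1 e)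
  obtain ⟨r, hr⟩ := WithBot.ne_bot_iff_exists.1 fun e => hf0 ((homLen_eq_bot_iff f).1 e)
  rw [← hs, ← hr, ← WithBot.coe_add, add_comm s r]
  have h' := ((homLen_le_iff hg s).1 hs.symm.le).comp ((homLen_le_iff hf r).1 hr.symm.le) h
  exact (homLen_le_iff ⟨_, h'⟩ _).2 h'

/-- Filtered cochain complexes form a filtered dg-category: the morphisms of degree `n` are the
graded linear maps `f` of degree `n` with `ℓ(f) < ∞`, and the differential is
`f ↦ ∂ f - (-1)^n f ∂`. -/
noncomputable instance filteredDGCategory (k : Type w) [Field k] :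
    FilteredDGCategory.{w, v} k (FilteredComplex.{w, v} k) where
  hom X Y n := homSubmodule X Y n
  d {X Y} n m :=
    (δ_hom k X.complex Y.complex n m).restrict fun _ ⟨r, hf⟩ => ⟨r, hf.delta m⟩
  d_shape n m h f := Subtype.ext (δ_shape n m h f.1)
  d_d n m p f := Subtype.ext (δ_δ n m p f.1)
  comp {X Y Z m n p} h := LinearMap.mk₂ k
    (fun g f => ⟨f.1.comp g.1 ((add_comm n m).trans h), by
      obtain ⟨s, hs⟩ := g.2
      obtain ⟨r, hr⟩ := f.2
      exact ⟨r + s, hs.comp hr _⟩⟩)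
    (fun _ _ _ => Subtype.ext (Cochain.comp_add _ _ _ ((add_comm n m).trans h)))
    (fun _ _ _ => Subtype.ext (Cochain.comp_smul _ _ _ ((add_comm n m).trans h)))
    (fun _ _ _ => Subtype.ext (Cochain.add_comp _ _ _ ((add_comm n m).trans h)))
    (fun _ _ _ => Subtype.ext (Cochain.smul_comp _ _ _ ((add_comm n m).trans h)))
  d_comp {X Y Z m n p m' n' p'} h hm hn hp h₁ h₂ g f :=
    Subtype.ext (δ_comp f.1 g.1 (by omega) n' m' p' hp hn hm)
  id X := ⟨Cochain.ofHom (𝟙 X.complex), 0, fun p q h x => by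
    obtain rfl : p = q := by omega
    rw [Cochain.ofHom_v]
    simp⟩
  d_id X m := Subtype.ext (δ_ofHom (𝟙 X.complex))
  id_comp f := Subtype.ext (Cochain.comp_id _)
  comp_id f := Subtype.ext (Cochain.id_comp _)
  assoc h₁ h₂ h₃ h₄ x y z :=
    Subtype.ext (Cochain.comp_assoc z.1 y.1 x.1 (by omega) (by omega) (by omega)).symm
  len f := homLen f.1
  len_smul_add_le a f g ha := le_of_forall_real fun c hc => by
    rw [max_le_iff, homLen_le_iff f.2, homLen_le_iff g.2] at hc
    exact (homLen_le_iff (a • f + g).2 c).2 ((hc.1.smul a).add hc.2)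
  len_eq_bot_iff f := (homLen_eq_bot_iff f.1).trans Submodule.coe_eq_zero
  len_d_le n m f := le_of_forall_real fun c hc => by
    rw [homLen_le_iff f.2] at hc
    exact (homLen_le_iff ⟨c, hc.delta m⟩ c).2 (hc.delta m)
  len_comp_le {X Y Z m n p} h g f := homLen_comp_le ((add_comm n m).trans h) g.2 f.2
  len_id_le X := by
    have h : IsBoundedBy (Cochain.ofHom (𝟙 X.complex)) 0 := fun p q h x => by
      obtain rfl : p = q := by omega
      rw [Cochain.ofHom_v]
      simp
    exact (homLen_le_iff ⟨0, h⟩ 0).2 h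

/-- The filtration shift `Σ^r X`: the same complex, with the filtration function `ℓ + r`. -/
def shiftBy (r : ℝ) (X : FilteredComplex.{w, v} k) : FilteredComplex.{w, v} k where
  complex := X.complex
  len x := X.len x + (r : WithBot ℝ)
  len_smul_add_le a x y ha := by
    refine (add_le_add_left (X.len_smul_add_le a x y ha) _).trans (le_of_eq ?_)
    exact max_add (X.len x) (X.len y) _
  len_eq_bot_iff x := by
    rw [WithBot.add_eq_bot, X.len_eq_bot_iff]
    simp
  len_d_le i j x := add_le_add_left (X.len_d_le i j x) _

/-- The translation `X[a]`: the complex `X[a]` with `X[a]^i = X^{i+a}` and differential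
`(-1)^a ∂`, with the same filtration function. -/
def translate (a : ℤ) (X : FilteredComplex.{w, v} k) : FilteredComplex.{w, v} k where
  complex := (CategoryTheory.shiftFunctor (CochainComplex (ModuleCat.{v} k) ℤ) a).obj X.complex
  len {i} x := X.len (i := i + a) x
  len_smul_add_le {i} b x y hb := X.len_smul_add_le (i := i + a) b x y hb
  len_eq_bot_iff {i} x := X.len_eq_bot_iff (i := i + a) x
  len_d_le i j x := by
    rw [CochainComplex.shiftFunctor_obj_d']
    exact (X.len_units_smul_le _ _).trans (X.len_d_le _ _ _)

lemma isBoundedBy_toShift (r : ℝ) (X : FilteredComplex.{w, v} k) :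
    IsBoundedBy (X := X) (Y := shiftBy r X) (Cochain.ofHom (𝟙 X.complex)) r := fun p q h x => by
  obtain rfl : p = q := by omega
  have e : (Cochain.ofHom (𝟙 X.complex)).v p p h x = x := by simp
  exact (congrArg (shiftBy r X).len e).le

lemma isBoundedBy_fromShift (r : ℝ) (X : FilteredComplex.{w, v} k) :
    IsBoundedBy (X := shiftBy r X) (Y := X) (Cochain.ofHom (𝟙 X.complex)) (-r) :=
  fun p q h (x : X.complex.X p) => by
    obtain rfl : p = q := by omega
    have e : (Cochain.ofHom (𝟙 X.complex)).v p p h x = x := by simp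
    refine (congrArg X.len e).le.trans ?_
    change X.len x ≤ X.len x + (r : WithBot ℝ) + ((-r : ℝ) : WithBot ℝ)
    rw [add_assoc, ← WithBot.coe_add, add_neg_cancel, WithBot.coe_zero, add_zero]

/-- The identity of the underlying complex, as a morphism `X → Σ^r X`. -/
def toShift (r : ℝ) (X : FilteredComplex.{w, v} k) :
    FilteredDGCategory.hom k X (shiftBy r X) 0 :=
  (⟨Cochain.ofHom (𝟙 X.complex), r, isBoundedBy_toShift r X⟩ : homSubmodule X (shiftBy r X) 0)

/-- The identity of the underlying complex, as a morphism `Σ^r X → X`. -/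
def fromShift (r : ℝ) (X : FilteredComplex.{w, v} k) :
    FilteredDGCategory.hom k (shiftBy r X) X 0 :=
  (⟨Cochain.ofHom (𝟙 X.complex), -r, isBoundedBy_fromShift r X⟩ : homSubmodule (shiftBy r X) X 0)

lemma toShift_mem (r : ℝ) (X : FilteredComplex.{w, v} k) :
    toShift r X ∈ FilteredDGCategory.cycles k X (shiftBy r X) r :=
  ⟨Subtype.ext (p := fun f => f ∈ homSubmodule X (shiftBy r X) 1) (δ_ofHom (𝟙 X.complex)),
    (homLen_le_iff ⟨r, isBoundedBy_toShift r X⟩ r).2 (isBoundedBy_toShift r X)⟩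

lemma fromShift_mem (r : ℝ) (X : FilteredComplex.{w, v} k) :
    fromShift r X ∈ FilteredDGCategory.cycles k (shiftBy r X) X (-r) :=
  ⟨Subtype.ext (p := fun f => f ∈ homSubmodule (shiftBy r X) X 1) (δ_ofHom (𝟙 X.complex)),
    (homLen_le_iff ⟨-r, isBoundedBy_fromShift r X⟩ (-r)).2 (isBoundedBy_fromShift r X)⟩

/-- The shift functor of the degree-`0` cohomology category of the category of filtered cochain
complexes: on objects it is `X ↦ Σ^r X`, and the natural transformations `η_{r,s}` are given by
identities. -/
noncomputable def shiftFunctor (k : Type w) [Field k] :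
    ShiftFunctor k (H0 k (FilteredComplex.{w, v} k)) :=
  ShiftData.shiftFunctor
    { obj r X := ⟨shiftBy r X.obj⟩
      e r X := FilteredDGCategory.H0Hom.mk (toShift r X.obj) (toShift_mem r X.obj)
      e' r X := FilteredDGCategory.H0Hom.mk (fromShift r X.obj) (fromShift_mem r X.obj)
      e'_e r X := congrArg _ (Subtype.ext
        (Subtype.ext (p := fun f => f ∈ homSubmodule X.obj X.obj 0)
          (Cochain.id_comp (Cochain.ofHom (𝟙 X.obj.complex)))))
      e_e' r X := congrArg _ (Subtype.ext
        (Subtype.ext (p := fun f => f ∈ homSubmodule (shiftBy r X.obj) (shiftBy r X.obj) 0)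
          (Cochain.id_comp (Cochain.ofHom (𝟙 X.obj.complex))))) }

end FilteredComplex

/-! ### The triangulated persistence structure on `H^0(Tw(A))` -/

/-- The class of a closed morphism of degree `0` and filtration level `≤ 0`, as a morphism of the
`0`-level of the degree-`0` cohomology category. -/
def H0.homMk {k : Type w} [Field k] {A : Type u} [FilteredDGCategory.{w, v} k A] {X Y : A}
    (f : FilteredDGCategory.hom k X Y 0) (hf : f ∈ FilteredDGCategory.cycles k X Y 0) :
    (⟨⟨X⟩⟩ : Level0 k (H0 k A)) ⟶ ⟨⟨Y⟩⟩ :=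
  FilteredDGCategory.H0Hom.mk f hf

/-- In the structure `t` the translation functors are the `X ↦ X[n]`, and the exact triangles are
the triangles isomorphic to one of the form `X → Y → cone f → X[1]`, given by a closed morphism
`f : X → Y` of degree `0` and filtration level `≤ 0`, the inclusion and the projection. -/
def Tw.IsConeTPC {k : Type w} [Field k] {A : Type u} [FilteredDGCategory.{w, v} k A]
    (t : TPC k (H0 k (Tw k A)) (Tw.shiftFunctor k A)) : Prop :=
  letI := t.hasZeroObject
  letI := t.hasShift
  letI := t.shiftAdditive
  letI := t.pretriangulated
  ∃ hT : ∀ n : ℤ, CategoryTheory.shiftFunctor (Level0 k (H0 k (Tw k A))) n =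
      (Tw.translation k A n).level0,
    ∀ T : Triangle (Level0 k (H0 k (Tw k A))), T ∈ distTriang (Level0 k (H0 k (Tw k A))) ↔
      ∃ (X Y : Tw k A) (f : FilteredDGCategory.hom k X Y 0)
        (hf : f ∈ FilteredDGCategory.cycles k X Y 0),
        Nonempty (T ≅ Triangle.mk (H0.homMk f hf)
          (H0.homMk (Tw.coneIncl f hf) (Tw.coneIncl_mem f hf))
          (H0.homMk (Tw.coneProj f hf) (Tw.coneProj_mem f hf) ≫
            eqToHom (Functor.congr_obj (hT 1) ⟨⟨X⟩⟩).symm))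

/-- In the structure `t` the translation is given on objects by `X ↦ X[1]`. -/
def FilteredComplex.IsTranslateTPC {k : Type w} [Field k]
    (t : TPC k (H0 k (FilteredComplex.{w, v} k)) (FilteredComplex.shiftFunctor k)) : Prop :=
  letI := t.hasShift
  ∀ X : FilteredComplex.{w, v} k,
    ((⟨⟨X⟩⟩ : Level0 k (H0 k (FilteredComplex.{w, v} k)))⟦(1 : ℤ)⟧).obj.obj =
      FilteredComplex.translate 1 X

end FiltDG

/-! A morphism of a filtered dg-category acts by composition on families of morphisms into its
source, and the differential acts on such families entrywise. By the Leibniz rule the operator of `d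
f` is the graded commutator of the operator of `f` with the differential (`act_d`), and by the
Yoneda argument (`act_injective`) identities between morphisms may be checked on operators. Degrees
need not be matched there, so the verifications become computations in a preadditive category: move
the differential to the front, cancel inverse pairs, compare the terms.

The structure that carries the theorem is `ConeStable`. It asks for objects Σ^r X linked to X by
closed mutually inverse morphisms of degree 0 and levels r and -r, objects X[n] linked to X by
closed mutually inverse morphisms of degrees -n and n and level ≤ 0, a zero object, and, for each
closed f : X → Y of degree 0 and level ≤ 0, an object split into Y and a translate of X whose
differential has f as off-diagonal part (`ConeData`). All this is expressed by morphisms and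
equations, so filtered dg-functors preserve cones and equivalences allow the whole structure to be
pulled back.

For such a category H^0 is a triangulated persistence category (`ConeStable.tpc`). The classical
argument for homotopy categories of complexes applies, because every map and homotopy it uses is a
sum of composites of structure maps of cones and given maps and homotopies, all of level ≤ 0.
Nothing leaves the 0-level: see `rotate_triangle_mem`, `invRotate_triangle_mem`,
`complete_triangle_morphism` and `octahedron`. The persistence axiom holds because η^A_r is
represented by an invertible morphism whose inverse has level r. The contraction of the cone of an
isomorphism contains this inverse once, hence has level r, and the cone is r-acyclic
(`ConeData.id_mem_boundaries`, `exists_acyclic`).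

Block matrices make Tw(A) cone-stable, which gives (a); since cones are unique up to isomorphism,
the exact triangles are those of the standard cones. If A is pre-triangulated, the structure is
pulled back along the equivalence A → Tw(A), which gives (b). Filtered complexes are cone-stable
through the mapping cone with the maximum filtration. Conversely a cone-stable category is
pre-triangulated (`ConeStable.isPretriangulated`): strict triangularity exhibits a twisted complex
as the cone of a morphism from a translate of its last term to the complex of the other terms, and
induction on the number of terms produces an isomorphic object of A. This completes (c). -/

namespace FiltDG

/-! ### Graded morphisms as operators -/

namespace FilteredDGCategory

section

variable (k : Type w) [Field k] {B : Type u} [FilteredDGCategory.{w, v} k B] {X Y Z : B}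

/-- The families of morphisms with target `X`, one of each degree from each object. -/
abbrev Yo (X : B) : AddCommGrpCat.{max u v} :=
  AddCommGrpCat.of (∀ (W : B) (m : ℤ), hom k W X m)

/-- The differential, as an operator on families of morphisms. -/
def dOp (X : B) : Yo k X ⟶ Yo k X :=
  AddCommGrpCat.ofHom
    { toFun := fun v W m => d (m - 1) m (v W (m - 1))
      map_zero' := by ext; simp
      map_add' := fun _ _ => by ext; simp }

variable {k}

/-- A morphism of degree `n`, as an operator on families of morphisms. -/
def act {n : ℤ} (f : hom k X Y n) : Yo k X ⟶ Yo k Y :=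
  AddCommGrpCat.ofHom
    { toFun := fun v W m => comp (add_sub_cancel n m) f (v W (m - n))
      map_zero' := by ext; simp
      map_add' := fun _ _ => by ext; simp }

lemma act_apply {n : ℤ} (f : hom k X Y n) (v : Yo k X) (W : B) (m : ℤ) :
    (act f) v W m = comp (add_sub_cancel n m) f (v W (m - n)) := rfl

lemma comp_family_congr {n m a b : ℤ} (f : hom k X Y n) (v : Yo k X) (W : B) (h : n + a = m)
    (h' : n + b = m) : comp h f (v W a) = comp h' f (v W b) := by
  obtain rfl : a = b := by omega
  rfl

-- The degree equation `h` disappears on the right: operators of all degrees live in the same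
-- category, so composites can be simplified without reindexing.
@[simp]
lemma act_comp {m n p : ℤ} (h : m + n = p) (g : hom k Y Z m) (f : hom k X Y n) :
    act (comp h g f) = act f ≫ act g := by
  refine AddCommGrpCat.hom_ext (AddMonoidHom.ext fun v => ?_)
  funext W q
  subst h
  change comp (add_sub_cancel (m + n) q) (comp rfl g f) (v W (q - (m + n))) =
    comp (add_sub_cancel m q) g (comp (add_sub_cancel n (q - m)) f (v W (q - m - n)))
  rw [assoc rfl _ (show n + (q - (m + n)) = q - m by omega) (by omega)]
  congr 1
  exact comp_family_congr _ _ _ _ _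

@[simp]
lemma act_id (X : B) : act (id (k := k) X) = 𝟙 (Yo k X) := by
  refine AddCommGrpCat.hom_ext (AddMonoidHom.ext fun v => ?_)
  funext W q
  change comp (add_sub_cancel 0 q) (id (k := k) X) (v W (q - 0)) = v W q
  rw [comp_family_congr _ v W _ (zero_add q), id_comp]

@[simp]
lemma act_add {n : ℤ} (f g : hom k X Y n) : act (f + g) = act f + act g := by
  refine AddCommGrpCat.hom_ext (AddMonoidHom.ext fun v => ?_)
  funext W q
  exact LinearMap.map_add₂ _ _ _ _

@[simp]
lemma act_zero {n : ℤ} : act (0 : hom k X Y n) = 0 := by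
  refine AddCommGrpCat.hom_ext (AddMonoidHom.ext fun v => ?_)
  funext W q
  exact LinearMap.map_zero₂ _ _

@[simp]
lemma act_neg {n : ℤ} (f : hom k X Y n) : act (-f) = - act f := by
  rw [eq_neg_iff_add_eq_zero, ← act_add, neg_add_cancel, act_zero]

@[simp]
lemma act_sub {n : ℤ} (f g : hom k X Y n) : act (f - g) = act f - act g := by
  rw [sub_eq_add_neg, act_add, act_neg, ← sub_eq_add_neg]

@[simp]
lemma act_degCast {n m : ℤ} (h : n = m) (f : hom k X Y n) : act (degCast k h f) = act f := by
  subst h; rfl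

open Classical in
lemma act_injective {n : ℤ} {f g : hom k X Y n} (h : act f = act g) : f = g := by
  -- The universal family: the identity of `X` at the place `(X, 0)` and zero elsewhere. Applying
  -- `f` to it and reading off the place `(X, n)` returns `f`.
  let v : Yo k X := fun W m =>
    if h : W = X ∧ 0 = m then h.1 ▸ degCast k h.2 (id (k := k) W) else 0
  have hv : v X 0 = id X := by simp [v]
  have key (f : hom k X Y n) : (act f) v X n = f := by
    rw [act_apply, comp_family_congr _ v X _ (add_zero n), hv, comp_id]
  rw [← key f, h, key g]

/-- The Leibniz rule, for operators. -/
lemma act_d {n m : ℤ} (h : n + 1 = m) (f : hom k X Y n) :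
    act (d n m f) = act f ≫ dOp k Y - n.negOnePow • (dOp k X ≫ act f) := by
  rw [eq_sub_iff_add_eq]
  refine AddCommGrpCat.hom_ext (AddMonoidHom.ext fun v => ?_)
  funext W q
  subst h
  refine Eq.trans ?_ (d_comp (add_sub_cancel n (q - 1)) rfl rfl (sub_add_cancel q 1) (by omega)
    (show n + (q - 1 - n + 1) = q by omega) f (v W (q - 1 - n))).symm
  -- The Leibniz rule is applied to the entry of `v` of degree `q - 1 - n`; `e1` and `e2` identify
  -- degrees that are equal only after rearrangement.
  have e1 : comp (add_sub_cancel (n + 1) q) (d n (n + 1) f) (v W (q - (n + 1))) =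
      comp (show n + 1 + (q - 1 - n) = q by omega) (d n (n + 1) f) (v W (q - 1 - n)) :=
    comp_family_congr _ _ _ _ _
  have e2 : comp (add_sub_cancel n q) f (d (q - n - 1) (q - n) (v W (q - n - 1))) =
      comp (show n + (q - 1 - n + 1) = q by omega) f
        (d (q - 1 - n) (q - 1 - n + 1) (v W (q - 1 - n))) := by
    have aux (a b : ℤ) (ha : a = q - n - 1) (hb : b = q - n) (h : n + b = q) :
        comp (add_sub_cancel n q) f (d (q - n - 1) (q - n) (v W (q - n - 1))) =
          comp h f (d a b (v W a)) := by
      subst ha hb; rfl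
    exact aux _ _ (by omega) (by omega) _
  rw [← e1, ← e2]
  rcases Int.units_eq_one_or n.negOnePow with hn | hn <;> rw [hn] <;> simp <;> rfl

end

end FilteredDGCategory

end FiltDG

namespace FiltDG

open FilteredDGCategory

section

variable {k : Type w} [Field k] {B : Type u} [FilteredDGCategory.{w, v} k B] {X Y Z : B}

/-! ### Morphisms of the `0`-level -/

namespace FilteredDGCategory

lemma len_comp_le_zero {m n p : ℤ} (h : m + n = p) {g : hom k Y Z m} {f : hom k X Y n}
    (hg : len g ≤ 0) (hf : len f ≤ 0) : len (comp h g f) ≤ 0 :=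
  (len_comp_le h g f).trans (add_nonpos hg hf)

lemma len_comp_le_coe {m n p : ℤ} (h : m + n = p) {g : hom k Y Z m} {f : hom k X Y n} {a b c : ℝ}
    (hg : len g ≤ a) (hf : len f ≤ b) (hc : a + b = c) : len (comp h g f) ≤ c :=
  (len_comp_le h g f).trans ((add_le_add hg hf).trans (by rw [← WithBot.coe_add, hc]))

lemma len_add_le_zero {n : ℤ} {f g : hom k X Y n} (hf : len f ≤ 0) (hg : len g ≤ 0) :
    len (f + g) ≤ 0 :=
  (len_add_le f g).trans (max_le hf hg)

lemma len_neg_le_zero {n : ℤ} {f : hom k X Y n} (hf : len f ≤ 0) : len (-f) ≤ 0 := by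
  rwa [len_neg]

lemma len_sub_le_zero {n : ℤ} {f g : hom k X Y n} (hf : len f ≤ 0) (hg : len g ≤ 0) :
    len (f - g) ≤ 0 := by
  rw [sub_eq_add_neg]
  exact len_add_le_zero hf (len_neg_le_zero hg)

lemma len_degCast_le_zero {n m : ℤ} (h : n = m) {f : hom k X Y n} (hf : len f ≤ 0) :
    len (degCast k h f) ≤ 0 := by
  rwa [len_degCast]

@[simp]
lemma act_units_smul {n : ℤ} (a : ℤˣ) (f : hom k X Y n) : act (a • f) = a • act f := by
  rcases Int.units_eq_one_or a with rfl | rfl <;> simp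

/-- Closed means graded-commuting with the differential. In this form closedness is a rewriting rule
that moves the differential to the front of a composite. -/
lemma closed_iff {n m : ℤ} (h : n + 1 = m) (f : hom k X Y n) :
    d n m f = 0 ↔ act f ≫ dOp k Y = n.negOnePow • (dOp k X ≫ act f) := by
  rw [← sub_eq_zero (a := act f ≫ _), ← act_d h]
  exact ⟨fun h => by rw [h, act_zero], fun h => act_injective (h.trans act_zero.symm)⟩

lemma closed_zero_iff (f : hom k X Y 0) :
    d 0 1 f = 0 ↔ act f ≫ dOp k Y = dOp k X ≫ act f := by
  simp [closed_iff (zero_add 1)]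

lemma mem_cycles_iff {r : ℝ} {f : hom k X Y 0} :
    f ∈ cycles k X Y r ↔ act f ≫ dOp k Y = dOp k X ≫ act f ∧ len f ≤ r := by
  rw [← closed_zero_iff]
  rfl

lemma act_comm {r : ℝ} {f : hom k X Y 0} (hf : f ∈ cycles k X Y r) :
    act f ≫ dOp k Y = dOp k X ≫ act f := (mem_cycles_iff.1 hf).1

lemma act_comm_assoc {r : ℝ} {f : hom k X Y 0} (hf : f ∈ cycles k X Y r)
    {W : AddCommGrpCat.{max u v}} (g : Yo k Y ⟶ W) :
    act f ≫ dOp k Y ≫ g = dOp k X ≫ act f ≫ g := by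
  rw [← Category.assoc, act_comm hf, Category.assoc]

lemma act_d_neg_one (u : hom k X Y (-1)) :
    act (d (-1) 0 u) = act u ≫ dOp k Y + dOp k X ≫ act u := by
  rw [act_d (neg_add_cancel 1)]
  simp

lemma mem_boundaries {r : ℝ} {f : hom k X Y 0} (u : hom k X Y (-1)) (hu : len u ≤ r)
    (h : act u ≫ dOp k Y + dOp k X ≫ act u = act f) : f ∈ boundaries k X Y r :=
  ⟨u, hu, act_injective ((act_d_neg_one u).trans h)⟩

end FilteredDGCategory

namespace H0

lemma exists_homMk {A A' : Level0 k (H0 k B)} (φ : A ⟶ A') :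
    ∃ (f : hom k A.obj.obj A'.obj.obj 0) (hf : f ∈ cycles k A.obj.obj A'.obj.obj 0),
      φ = homMk f hf := by
  obtain ⟨⟨f, hf⟩, rfl⟩ := Submodule.Quotient.mk_surjective _ φ
  exact ⟨f, hf, rfl⟩

lemma homMk_congr {f g : hom k X Y 0} {hf : f ∈ cycles k X Y 0} {hg : g ∈ cycles k X Y 0}
    (h : act f = act g) : homMk f hf = homMk g hg := by
  obtain rfl := act_injective h
  rfl

lemma homMk_eq {f g : hom k X Y 0} {hf : f ∈ cycles k X Y 0} {hg : g ∈ cycles k X Y 0}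
    (u : hom k X Y (-1)) (hu : len u ≤ 0)
    (h : act u ≫ dOp k Y + dOp k X ≫ act u = act f - act g) : homMk f hf = homMk g hg :=
  H0Hom.mk_eq hf hg (mem_boundaries u hu (h.trans (act_sub f g).symm))

/-- Boundaries at level 0 are differentials of morphisms of level ≤ 0, so the homotopy comes with
the bound that allows it to enter further constructions without leaving the 0-level. -/
lemma exists_homotopy {f g : hom k X Y 0} {hf : f ∈ cycles k X Y 0} {hg : g ∈ cycles k X Y 0}
    (h : homMk f hf = homMk g hg) : ∃ u : hom k X Y (-1), len u ≤ 0 ∧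
      act u ≫ dOp k Y + dOp k X ≫ act u = act f - act g := by
  obtain ⟨u, hu, h⟩ := (Submodule.Quotient.eq _).1 h
  refine ⟨u, hu, ?_⟩
  rw [← act_d_neg_one, ← act_sub]
  exact congrArg act h

/-- The isomorphism of the `0`-level given by a closed morphism with a closed inverse. -/
def isoMk (f : hom k X Y 0) (hf : f ∈ cycles k X Y 0) (g : hom k Y X 0) (hg : g ∈ cycles k Y X 0)
    (h : act f ≫ act g = 𝟙 _) (h' : act g ≫ act f = 𝟙 _) :
    (⟨⟨X⟩⟩ : Level0 k (H0 k B)) ≅ ⟨⟨Y⟩⟩ where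
  hom := homMk f hf
  inv := homMk g hg
  hom_inv_id := homMk_congr (by simpa using h)
  inv_hom_id := homMk_congr (by simpa using h')

/-- The isomorphism of the `0`-level given by a split monomorphism whose retraction is an
inverse up to homotopy. -/
def isoOfHomotopy (f : hom k X Y 0) (hf : f ∈ cycles k X Y 0) (g : hom k Y X 0)
    (hg : g ∈ cycles k Y X 0) (h : act f ≫ act g = 𝟙 _) (u : hom k Y Y (-1)) (hu : len u ≤ 0)
    (h' : act u ≫ dOp k Y + dOp k Y ≫ act u = act g ≫ act f - 𝟙 _) :
    (⟨⟨X⟩⟩ : Level0 k (H0 k B)) ≅ ⟨⟨Y⟩⟩ where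
  hom := homMk f hf
  inv := homMk g hg
  hom_inv_id := homMk_congr (by simpa using h)
  inv_hom_id := homMk_eq u hu (by simpa using h')

end H0

/-! ### Cones in filtered dg-categories -/

/-- A cone of a morphism `f` of degree `0`: an object `pt` which is the direct sum of `Y` and a
translate of `X`, where the off-diagonal part of the differential is `f`. -/
structure ConeData (f : hom k X Y 0) where
  pt : B
  incl : hom k Y pt 0
  ret : hom k pt Y 0
  sec : hom k X pt (-1)
  proj : hom k pt X 1
  d_incl : d 0 1 incl = 0
  d_ret : d 0 1 ret = - comp (zero_add 1) f proj
  d_sec : d (-1) 0 sec = comp (add_zero 0) incl f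
  d_proj : d 1 2 proj = 0
  len_incl : len incl ≤ 0
  len_ret : len ret ≤ 0
  len_sec : len sec ≤ 0
  len_proj : len proj ≤ 0
  ret_incl : comp (add_zero 0) ret incl = FilteredDGCategory.id Y
  proj_sec : comp (add_neg_cancel 1) proj sec = FilteredDGCategory.id X
  proj_incl : comp (add_zero 1) proj incl = 0
  ret_sec : comp (zero_add (-1)) ret sec = 0
  total : comp (add_zero 0) incl ret + comp (neg_add_cancel 1) sec proj = FilteredDGCategory.id pt

namespace ConeData

variable {f : hom k X Y 0} (c : ConeData f) {W : AddCommGrpCat.{max u v}}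

lemma incl_mem : c.incl ∈ cycles k Y c.pt 0 := ⟨c.d_incl, c.len_incl⟩

/-- The four structure equations of the cone are read as rules moving the differential to the front.
Combined with the splitting equations, they bring sums of composites of structure maps to a normal
form in which only additive cancellation is left. -/
lemma incl_dOp : act c.incl ≫ dOp k c.pt = dOp k Y ≫ act c.incl := act_comm c.incl_mem

lemma incl_dOp_assoc (g : Yo k c.pt ⟶ W) :
    act c.incl ≫ dOp k c.pt ≫ g = dOp k Y ≫ act c.incl ≫ g := act_comm_assoc c.incl_mem g

lemma proj_dOp : act c.proj ≫ dOp k X = -(dOp k c.pt ≫ act c.proj) := by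
  simpa using (closed_iff one_add_one_eq_two _).1 c.d_proj

lemma proj_dOp_assoc (g : Yo k X ⟶ W) :
    act c.proj ≫ dOp k X ≫ g = -(dOp k c.pt ≫ act c.proj ≫ g) := by
  rw [← Category.assoc, proj_dOp]; simp

lemma ret_dOp : act c.ret ≫ dOp k Y = dOp k c.pt ≫ act c.ret - act c.proj ≫ act f := by
  have h := congrArg act c.d_ret
  simp only [act_d (zero_add 1), Int.negOnePow_zero, one_smul, act_neg, act_comp] at h
  rw [sub_eq_iff_eq_add.1 h]
  abel

lemma ret_dOp_assoc (g : Yo k Y ⟶ W) :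
    act c.ret ≫ dOp k Y ≫ g = dOp k c.pt ≫ act c.ret ≫ g - act c.proj ≫ act f ≫ g := by
  rw [← Category.assoc, ret_dOp]; simp

lemma sec_dOp : act c.sec ≫ dOp k c.pt = act f ≫ act c.incl - dOp k X ≫ act c.sec := by
  have h := congrArg act c.d_sec
  rw [act_d_neg_one, act_comp] at h
  exact eq_sub_of_add_eq h

lemma sec_dOp_assoc (g : Yo k c.pt ⟶ W) :
    act c.sec ≫ dOp k c.pt ≫ g = act f ≫ act c.incl ≫ g - dOp k X ≫ act c.sec ≫ g := by
  rw [← Category.assoc, sec_dOp]; simp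

@[simp]
lemma act_incl_ret : act c.incl ≫ act c.ret = 𝟙 _ := by
  rw [← act_comp (add_zero 0), ret_incl, act_id]

@[simp]
lemma act_incl_ret_assoc (g : Yo k Y ⟶ W) : act c.incl ≫ act c.ret ≫ g = g := by
  rw [← Category.assoc, act_incl_ret, Category.id_comp]

@[simp]
lemma act_sec_proj : act c.sec ≫ act c.proj = 𝟙 _ := by
  rw [← act_comp (add_neg_cancel 1), proj_sec, act_id]

@[simp]
lemma act_sec_proj_assoc (g : Yo k X ⟶ W) : act c.sec ≫ act c.proj ≫ g = g := by
  rw [← Category.assoc, act_sec_proj, Category.id_comp]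

@[simp]
lemma act_incl_proj : act c.incl ≫ act c.proj = 0 := by
  rw [← act_comp (add_zero 1), proj_incl, act_zero]

@[simp]
lemma act_incl_proj_assoc (g : Yo k X ⟶ W) : act c.incl ≫ act c.proj ≫ g = 0 := by
  rw [← Category.assoc, act_incl_proj, zero_comp]

@[simp]
lemma act_sec_ret : act c.sec ≫ act c.ret = 0 := by
  rw [← act_comp (zero_add (-1)), ret_sec, act_zero]

@[simp]
lemma act_sec_ret_assoc (g : Yo k Y ⟶ W) : act c.sec ≫ act c.ret ≫ g = 0 := by
  rw [← Category.assoc, act_sec_ret, zero_comp]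

-- The decomposition of the identity is oriented so that `ret ≫ incl` is eliminated; otherwise both
-- splitting idempotents would survive in normal forms.
@[simp]
lemma act_ret_incl : act c.ret ≫ act c.incl = 𝟙 _ - act c.proj ≫ act c.sec := by
  have h := congrArg act c.total
  simp only [act_add, act_comp, act_id] at h
  exact eq_sub_of_add_eq h

@[simp]
lemma act_ret_incl_assoc (g : Yo k c.pt ⟶ W) :
    act c.ret ≫ act c.incl ≫ g = g - act c.proj ≫ act c.sec ≫ g := by
  rw [← Category.assoc, act_ret_incl]; simp

/-- The cone of an isomorphism is contractible. -/
lemma id_mem_boundaries {r : ℝ} (hf : f ∈ cycles k X Y 0) (g : hom k Y X 0) (hg : len g ≤ r)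
    (h : act f ≫ act g = 𝟙 _) (h' : act g ≫ act f = 𝟙 _) :
    FilteredDGCategory.id c.pt ∈ boundaries k c.pt c.pt r := by
  -- The contraction goes from the summand `Y` to the translate of `X` through the inverse `g`. It
  -- involves `g` exactly once, so its level is that of `g`, even when this exceeds the level of
  -- `f`.
  refine mem_boundaries (comp (add_zero (-1)) c.sec (comp (add_zero 0) g c.ret)) ?_ ?_
  · exact len_comp_le_coe _ (a := 0) (b := r) c.len_sec
      (len_comp_le_coe _ (a := r) (b := 0) hg c.len_ret (add_zero r)) (zero_add r)
  -- The inverse of a closed morphism is closed: conjugate the commutation relation of `f` by `g`.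
  · have e : act g ≫ dOp k X = dOp k Y ≫ act g := by
      have := congrArg (fun x => act g ≫ x ≫ act g) (act_comm hf)
      simp only [Category.assoc, h, Category.comp_id] at this
      rw [← this, ← Category.assoc, h', Category.id_comp]
    have h₁ : act f ≫ act g ≫ act c.sec = act c.sec := by rw [← Category.assoc, h, Category.id_comp]
    have h₂ : act g ≫ act f ≫ act c.incl = act c.incl := by
      rw [← Category.assoc, h', Category.id_comp]
    have e' : act g ≫ dOp k X ≫ act c.sec = dOp k Y ≫ act g ≫ act c.sec := by
      rw [← Category.assoc, e, Category.assoc]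
    simp [sec_dOp, ret_dOp_assoc, e', h₁, h₂]

end ConeData

end

end FiltDG

namespace FiltDG

open FilteredDGCategory

/-! ### Filtered dg-categories with shifts, translations and cones -/

/-- A filtered dg-category with objects `Σ^r X` and `X[n]`, a zero object and cones, all
characterized by morphisms of the dg-category itself. -/
class ConeStable (k : Type w) [Field k] (B : Type u) [FilteredDGCategory.{w, v} k B] where
  sh : ℝ → B → B
  toSh : ∀ (r : ℝ) (X : B), hom k X (sh r X) 0
  ofSh : ∀ (r : ℝ) (X : B), hom k (sh r X) X 0
  toSh_mem : ∀ (r : ℝ) (X : B), toSh r X ∈ cycles k X (sh r X) r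
  ofSh_mem : ∀ (r : ℝ) (X : B), ofSh r X ∈ cycles k (sh r X) X (-r)
  ofSh_toSh : ∀ (r : ℝ) (X : B), comp (add_zero 0) (ofSh r X) (toSh r X) = FilteredDGCategory.id X
  toSh_ofSh : ∀ (r : ℝ) (X : B), comp (add_zero 0) (toSh r X) (ofSh r X) = FilteredDGCategory.id (sh r X)
  tr : ℤ → B → B
  toTr : ∀ (n : ℤ) (X : B), hom k X (tr n X) (-n)
  ofTr : ∀ (n : ℤ) (X : B), hom k (tr n X) X n
  d_toTr : ∀ (n : ℤ) (X : B), d (-n) (-n + 1) (toTr n X) = 0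
  d_ofTr : ∀ (n : ℤ) (X : B), d n (n + 1) (ofTr n X) = 0
  len_toTr : ∀ (n : ℤ) (X : B), len (toTr n X) ≤ 0
  len_ofTr : ∀ (n : ℤ) (X : B), len (ofTr n X) ≤ 0
  ofTr_toTr : ∀ (n : ℤ) (X : B), comp (add_neg_cancel n) (ofTr n X) (toTr n X) = FilteredDGCategory.id X
  toTr_ofTr : ∀ (n : ℤ) (X : B), comp (neg_add_cancel n) (toTr n X) (ofTr n X) = FilteredDGCategory.id (tr n X)
  exists_zero : ∃ X : B, FilteredDGCategory.id (k := k) X = 0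
  exists_cone : ∀ {X Y : B} (f : hom k X Y 0), f ∈ cycles k X Y 0 → Nonempty (ConeData f)

namespace ConeStable

variable {k : Type w} [Field k] {B : Type u} [FilteredDGCategory.{w, v} k B] [ConeStable k B]
  {X Y Z : B} {W : AddCommGrpCat.{max u v}}

@[simp]
lemma act_toSh_ofSh (r : ℝ) (X : B) : act (toSh (k := k) r X) ≫ act (ofSh r X) = 𝟙 _ := by
  rw [← act_comp (add_zero 0), ofSh_toSh, act_id]

@[simp]
lemma act_toSh_ofSh_assoc (r : ℝ) (X : B) (g : Yo k X ⟶ W) :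
    act (toSh (k := k) r X) ≫ act (ofSh r X) ≫ g = g := by
  rw [← Category.assoc, act_toSh_ofSh, Category.id_comp]

@[simp]
lemma act_ofSh_toSh (r : ℝ) (X : B) : act (ofSh (k := k) r X) ≫ act (toSh r X) = 𝟙 _ := by
  rw [← act_comp (add_zero 0), toSh_ofSh, act_id]

@[simp]
lemma act_ofSh_toSh_assoc (r : ℝ) (X : B) (g : Yo k (sh k r X) ⟶ W) :
    act (ofSh (k := k) r X) ≫ act (toSh r X) ≫ g = g := by
  rw [← Category.assoc, act_ofSh_toSh, Category.id_comp]

@[simp]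
lemma act_toTr_ofTr (n : ℤ) (X : B) : act (toTr (k := k) n X) ≫ act (ofTr n X) = 𝟙 _ := by
  rw [← act_comp (add_neg_cancel n), ofTr_toTr, act_id]

@[simp]
lemma act_toTr_ofTr_assoc (n : ℤ) (X : B) (g : Yo k X ⟶ W) :
    act (toTr (k := k) n X) ≫ act (ofTr n X) ≫ g = g := by
  rw [← Category.assoc, act_toTr_ofTr, Category.id_comp]

@[simp]
lemma act_ofTr_toTr (n : ℤ) (X : B) : act (ofTr (k := k) n X) ≫ act (toTr n X) = 𝟙 _ := by
  rw [← act_comp (neg_add_cancel n), toTr_ofTr, act_id]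

@[simp]
lemma act_ofTr_toTr_assoc (n : ℤ) (X : B) (g : Yo k (tr k n X) ⟶ W) :
    act (ofTr (k := k) n X) ≫ act (toTr n X) ≫ g = g := by
  rw [← Category.assoc, act_ofTr_toTr, Category.id_comp]

lemma toSh_dOp (r : ℝ) (X : B) :
    act (toSh (k := k) r X) ≫ dOp k (sh k r X) = dOp k X ≫ act (toSh r X) :=
  act_comm (toSh_mem r X)

lemma toSh_dOp_assoc (r : ℝ) (X : B) (g : Yo k (sh k r X) ⟶ W) :
    act (toSh (k := k) r X) ≫ dOp k (sh k r X) ≫ g = dOp k X ≫ act (toSh r X) ≫ g :=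
  act_comm_assoc (toSh_mem r X) g

lemma ofSh_dOp_assoc (r : ℝ) (X : B) (g : Yo k X ⟶ W) :
    act (ofSh (k := k) r X) ≫ dOp k X ≫ g = dOp k (sh k r X) ≫ act (ofSh r X) ≫ g :=
  act_comm_assoc (ofSh_mem r X) g

lemma toTr_dOp (n : ℤ) (X : B) :
    act (toTr (k := k) n X) ≫ dOp k (tr k n X) = n.negOnePow • (dOp k X ≫ act (toTr n X)) := by
  rw [(closed_iff rfl _).1 (d_toTr n X), Int.negOnePow_neg]

lemma toTr_dOp_assoc (n : ℤ) (X : B) (g : Yo k (tr k n X) ⟶ W) :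
    act (toTr (k := k) n X) ≫ dOp k (tr k n X) ≫ g =
      n.negOnePow • (dOp k X ≫ act (toTr n X) ≫ g) := by
  rw [← Category.assoc, toTr_dOp]
  rcases Int.units_eq_one_or n.negOnePow with hn | hn <;> rw [hn] <;> simp

lemma ofTr_dOp (n : ℤ) (X : B) :
    act (ofTr (k := k) n X) ≫ dOp k X = n.negOnePow • (dOp k (tr k n X) ≫ act (ofTr n X)) :=
  (closed_iff rfl _).1 (d_ofTr n X)

lemma ofTr_dOp_assoc (n : ℤ) (X : B) (g : Yo k X ⟶ W) :
    act (ofTr (k := k) n X) ≫ dOp k X ≫ g =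
      n.negOnePow • (dOp k (tr k n X) ≫ act (ofTr n X) ≫ g) := by
  rw [← Category.assoc, ofTr_dOp]
  rcases Int.units_eq_one_or n.negOnePow with hn | hn <;> rw [hn] <;> simp

/-! #### The translation functors -/

/-- The morphism `f[n] : X[n] → Y[n]`, up to sign, given by a morphism `f : X → Y`. -/
def trMap (n : ℤ) (X Y : B) (m : ℤ) : hom k X Y m →ₗ[k] hom k (tr k n X) (tr k n Y) m :=
  comp (show -n + (m + n) = m by omega) (toTr n Y) ∘ₗ (comp rfl).flip (ofTr n X)

@[simp]
lemma act_trMap (n : ℤ) {m : ℤ} (f : hom k X Y m) :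
    act (trMap n X Y m f) = act (ofTr n X) ≫ act f ≫ act (toTr n Y) := by
  simp only [trMap, LinearMap.comp_apply, LinearMap.flip_apply, act_comp, Category.assoc]

lemma len_trMap_le (n : ℤ) {m : ℤ} {f : hom k X Y m} {r : ℝ} (hf : len f ≤ r) :
    len (trMap n X Y m f) ≤ r :=
  len_comp_le_coe _ (a := 0) (b := r) (len_toTr n Y)
    (len_comp_le_coe _ (a := r) (b := 0) hf (len_ofTr n X) (add_zero r)) (zero_add r)

lemma trMap_mem (n : ℤ) {f : hom k X Y 0} {r : ℝ} (hf : f ∈ cycles k X Y r) :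
    trMap n X Y 0 f ∈ cycles k (tr k n X) (tr k n Y) r := by
  refine mem_cycles_iff.2 ⟨?_, len_trMap_le n hf.2⟩
  have := act_comm_assoc hf (act (toTr n Y))
  rcases Int.units_eq_one_or n.negOnePow with hn | hn <;>
  simp [toTr_dOp, ofTr_dOp_assoc, hn, this]

/-- The translation on the `0`-level. -/
def trLin (n : ℤ) (X Y : B) :
    H0Hom k X Y 0 →ₗ[k] H0Hom k (tr k n X) (tr k n Y) 0 :=
  Submodule.mapQ _ _ ((trMap n X Y 0).restrict fun _ hf => trMap_mem n hf) (by
    rintro ⟨f, hf⟩ hf'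
    obtain ⟨u, hu, rfl⟩ : f ∈ boundaries k X Y 0 := hf'
    -- The differential commutes with translation by `n` up to the sign `(-1)^n`, which the homotopy
    -- has to absorb.
    refine mem_boundaries (n.negOnePow • trMap n X Y (-1) u)
      ((len_units_smul _ _).le.trans (len_trMap_le n hu)) ?_
    change _ = act (trMap n X Y 0 (d (-1) 0 u))
    rw [act_trMap, act_d_neg_one, act_units_smul]
    rcases Int.units_eq_one_or n.negOnePow with hn | hn <;>
    simp [toTr_dOp, ofTr_dOp_assoc, hn])

variable (k B) in
/-- The translation functors of the `0`-level. -/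
def trFunctor (n : ℤ) : Level0 k (H0 k B) ⥤ Level0 k (H0 k B) where
  obj A := ⟨⟨tr k n A.obj.obj⟩⟩
  map φ := trLin n _ _ φ
  map_id A := H0.homMk_congr (hf := trMap_mem n (id_mem_cycles _)) (hg := id_mem_cycles _) (by simp)
  map_comp {A A' A''} φ ψ := by
    obtain ⟨f, hf, rfl⟩ := H0.exists_homMk φ
    obtain ⟨g, hg, rfl⟩ := H0.exists_homMk ψ
    -- The composite of two classes is by definition the class of the composite, so the equation
    -- reduces to one between explicit representatives.
    exact H0.homMk_congr (hf := trMap_mem n (comp_mem_cycles (add_zero 0) hg hf))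
      (hg := comp_mem_cycles (add_zero 0) (trMap_mem n hg) (trMap_mem n hf)) (by simp)

instance (n : ℤ) : (trFunctor k B n).Additive where
  map_add := map_add (trLin n _ _) _ _

/-- The morphism `X[n] → X[m]` for `n = m`. -/
def trCast (X : B) {n m : ℤ} (h : n = m) : hom k (tr k n X) (tr k m X) 0 :=
  comp (show -m + n = 0 by omega) (toTr m X) (ofTr n X)

@[simp]
lemma act_trCast (X : B) {n m : ℤ} (h : n = m) :
    act (trCast (k := k) X h) = act (ofTr n X) ≫ act (toTr m X) := act_comp _ _ _

lemma trCast_mem (X : B) {n m : ℤ} (h : n = m) :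
    trCast X h ∈ cycles k (tr k n X) (tr k m X) 0 := by
  refine mem_cycles_iff.2 ⟨?_, len_comp_le_zero _ (len_toTr m X) (len_ofTr n X)⟩
  subst h
  simp

/-- The coherence axioms of a shift contain transports along equalities of integers. Writing them
with `ofTr` and `toTr` lets them cancel like all the other operators. -/
lemma eqToHom_tr (A : Level0 k (H0 k B)) {n m : ℤ} (h : n = m)
    (h' : (trFunctor k B n).obj A = (trFunctor k B m).obj A) :
    eqToHom h' = H0.homMk (trCast A.obj.obj h) (trCast_mem _ h) := by
  subst h
  exact H0.homMk_congr (hf := id_mem_cycles _) (by simp)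

variable (k) in
/-- The canonical morphism `X → X[0]`. -/
def toTrZero (X : B) : hom k X (tr k 0 X) 0 := degCast k neg_zero (toTr 0 X)

@[simp]
lemma act_toTrZero (X : B) : act (toTrZero k X) = act (toTr 0 X) := act_degCast _ _

lemma toTrZero_mem (X : B) : toTrZero k X ∈ cycles k X (tr k 0 X) 0 :=
  mem_cycles_iff.2 ⟨by simp [toTr_dOp], len_degCast_le_zero _ (len_toTr 0 X)⟩

lemma ofTrZero_mem (X : B) : ofTr 0 X ∈ cycles k (tr k 0 X) X 0 :=
  mem_cycles_iff.2 ⟨by simp [ofTr_dOp], len_ofTr 0 X⟩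

variable (k) in
/-- The canonical morphism `X[n + m] → X[n][m]`. -/
def trAdd (n m : ℤ) (X : B) : hom k (tr k (n + m) X) (tr k m (tr k n X)) 0 :=
  comp (neg_add_cancel m) (toTr m (tr k n X))
    (comp (show -n + (n + m) = m by omega) (toTr n X) (ofTr (n + m) X))

@[simp]
lemma act_trAdd (n m : ℤ) (X : B) : act (trAdd k n m X) =
    act (ofTr (n + m) X) ≫ act (toTr n X) ≫ act (toTr m (tr k n X)) := by
  simp [trAdd]

/-- The signs of the three factors cancel because `(-1)^(n + m) = (-1)^n (-1)^m`. -/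
lemma trAdd_mem (n m : ℤ) (X : B) :
    trAdd k n m X ∈ cycles k (tr k (n + m) X) (tr k m (tr k n X)) 0 := by
  refine mem_cycles_iff.2 ⟨?_, len_comp_le_zero _ (len_toTr _ _)
    (len_comp_le_zero _ (len_toTr _ _) (len_ofTr _ _))⟩
  rcases Int.units_eq_one_or n.negOnePow with hn | hn <;>
  rcases Int.units_eq_one_or m.negOnePow with hm | hm <;>
  simp [toTr_dOp, toTr_dOp_assoc, ofTr_dOp_assoc, hn, hm, Int.negOnePow_add]

variable (k) in
/-- The canonical morphism `X[n][m] → X[n + m]`. -/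
def trAddInv (n m : ℤ) (X : B) : hom k (tr k m (tr k n X)) (tr k (n + m) X) 0 :=
  comp (neg_add_cancel (n + m)) (toTr (n + m) X) (comp rfl (ofTr n X) (ofTr m (tr k n X)))

@[simp]
lemma act_trAddInv (n m : ℤ) (X : B) : act (trAddInv k n m X) =
    act (ofTr m (tr k n X)) ≫ act (ofTr n X) ≫ act (toTr (n + m) X) := by
  simp [trAddInv]

lemma trAddInv_mem (n m : ℤ) (X : B) :
    trAddInv k n m X ∈ cycles k (tr k m (tr k n X)) (tr k (n + m) X) 0 := by
  refine mem_cycles_iff.2 ⟨?_, len_comp_le_zero _ (len_toTr _ _)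
    (len_comp_le_zero _ (len_ofTr _ _) (len_ofTr _ _))⟩
  rcases Int.units_eq_one_or n.negOnePow with hn | hn <;>
  rcases Int.units_eq_one_or m.negOnePow with hm | hm <;>
  simp [toTr_dOp, ofTr_dOp_assoc, hn, hm, Int.negOnePow_add]

variable (k) in
/-- The isomorphism `X[0] ≅ X`. -/
def trZeroIso (X : B) : (⟨⟨tr k 0 X⟩⟩ : Level0 k (H0 k B)) ≅ ⟨⟨X⟩⟩ :=
  H0.isoMk (ofTr 0 X) (ofTrZero_mem _) (toTrZero k X) (toTrZero_mem _) (by simp) (by simp)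

variable (k) in
/-- The isomorphism `X[n + m] ≅ X[n][m]`. -/
def trAddIso (n m : ℤ) (X : B) :
    (⟨⟨tr k (n + m) X⟩⟩ : Level0 k (H0 k B)) ≅ ⟨⟨tr k m (tr k n X)⟩⟩ :=
  H0.isoMk (trAdd k n m X) (trAdd_mem _ _ _) (trAddInv k n m X) (trAddInv_mem _ _ _)
    (by simp) (by simp)

variable (k B) in
/-- The translation functors of the `0`-level and their coherence isomorphisms. -/
def shiftMkCore : ShiftMkCore (Level0 k (H0 k B)) ℤ where
  F := trFunctor k B
  zero := NatIso.ofComponents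
    (fun A => trZeroIso k A.obj.obj)
    (fun {A A'} φ => by
      obtain ⟨f, hf, rfl⟩ := H0.exists_homMk φ
      exact H0.homMk_congr (hf := comp_mem_cycles (add_zero 0) (ofTrZero_mem _) (trMap_mem 0 hf))
        (hg := comp_mem_cycles (add_zero 0) hf (ofTrZero_mem _)) (by simp))
  add n m := NatIso.ofComponents
    (fun A => trAddIso k n m A.obj.obj)
    (fun {A A'} φ => by
      obtain ⟨f, hf, rfl⟩ := H0.exists_homMk φ
      exact H0.homMk_congr
        (hf := comp_mem_cycles (add_zero 0) (trAdd_mem _ _ _) (trMap_mem _ hf))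
        (hg := comp_mem_cycles (add_zero 0) (trMap_mem m (trMap_mem n hf)) (trAdd_mem _ _ _))
        (by simp))
  assoc_hom_app m₁ m₂ m₃ A := by
    rw [eqToHom_tr A (add_assoc m₁ m₂ m₃)]
    exact H0.homMk_congr
      (hf := comp_mem_cycles (add_zero 0) (trMap_mem _ (trAdd_mem _ _ _)) (trAdd_mem _ _ _))
      (hg := comp_mem_cycles (add_zero 0) (comp_mem_cycles (add_zero 0) (trAdd_mem m₂ m₃ _)
        (trAdd_mem _ _ _)) (trCast_mem _ (add_assoc m₁ m₂ m₃))) (by simp)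
  zero_add_hom_app n A := by
    rw [eqToHom_tr A (zero_add n)]
    exact H0.homMk_congr (hf := trAdd_mem _ _ _)
      (hg := comp_mem_cycles (add_zero 0) (trMap_mem n (toTrZero_mem _)) (trCast_mem _ (zero_add n)))
      (by simp)
  add_zero_hom_app n A := by
    rw [eqToHom_tr A (add_zero n)]
    exact H0.homMk_congr (hf := trAdd_mem _ _ _)
      (hg := comp_mem_cycles (add_zero 0) (toTrZero_mem _) (trCast_mem _ (add_zero n)))
      (by simp)

instance hasShift : HasShift (Level0 k (H0 k B)) ℤ := hasShiftMk _ _ (shiftMkCore k B)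

instance shiftFunctor_additive (n : ℤ) :
    (CategoryTheory.shiftFunctor (Level0 k (H0 k B)) n).Additive :=
  inferInstanceAs (trFunctor k B n).Additive

instance hasZeroObject : HasZeroObject (Level0 k (H0 k B)) := by
  obtain ⟨Z, hZ⟩ := exists_zero (k := k) (B := B)
  refine ⟨⟨⟨⟨Z⟩⟩, (IsZero.iff_id_eq_zero _).2 ?_⟩⟩
  exact H0.homMk_congr (hf := id_mem_cycles Z) (hg := zero_mem _) (by rw [hZ])

end ConeStable

end FiltDG

namespace FiltDG

open FilteredDGCategory

namespace ConeStable

variable {k : Type w} [Field k] {B : Type u} [FilteredDGCategory.{w, v} k B] [ConeStable k B]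
  {X Y Z : B}

/-! ### The triangulated structure -/

variable (k) in
/-- The canonical morphism `X[n][m] → X` for `n + m = 0`. -/
def trCancel {n m : ℤ} (h : n + m = 0) (X : B) : hom k (tr k m (tr k n X)) X 0 :=
  comp h (ofTr n X) (ofTr m (tr k n X))

@[simp]
lemma act_trCancel {n m : ℤ} (h : n + m = 0) (X : B) :
    act (trCancel k h X) = act (ofTr m (tr k n X)) ≫ act (ofTr n X) := act_comp _ _ _

lemma trCancel_mem {n m : ℤ} (h : n + m = 0) (X : B) :
    trCancel k h X ∈ cycles k (tr k m (tr k n X)) X 0 := by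
  obtain rfl : m = -n := by omega
  refine mem_cycles_iff.2 ⟨?_, len_comp_le_zero _ (len_ofTr _ _) (len_ofTr _ _)⟩
  rcases Int.units_eq_one_or n.negOnePow with hn | hn <;>
  simp [ofTr_dOp, ofTr_dOp_assoc, hn, Int.negOnePow_neg]

variable (k) in
/-- The canonical morphism `X → X[n][m]` for `n + m = 0`. -/
def trCancelInv {n m : ℤ} (h : n + m = 0) (X : B) : hom k X (tr k m (tr k n X)) 0 :=
  comp (show -m + -n = 0 by omega) (toTr m (tr k n X)) (toTr n X)

@[simp]
lemma act_trCancelInv {n m : ℤ} (h : n + m = 0) (X : B) :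
    act (trCancelInv k h X) = act (toTr n X) ≫ act (toTr m (tr k n X)) := act_comp _ _ _

lemma trCancelInv_mem {n m : ℤ} (h : n + m = 0) (X : B) :
    trCancelInv k h X ∈ cycles k X (tr k m (tr k n X)) 0 := by
  obtain rfl : m = -n := by omega
  refine mem_cycles_iff.2 ⟨?_, len_comp_le_zero _ (len_toTr _ _) (len_toTr _ _)⟩
  rcases Int.units_eq_one_or n.negOnePow with hn | hn <;>
  simp [toTr_dOp, toTr_dOp_assoc, hn, Int.negOnePow_neg]

/-- The inverse rotation of a triangle is defined through the unit and counit of the shift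
equivalence. This formula and the next turn those abstract isomorphisms into explicit operators. -/
lemma shiftFunctorCompIsoId_hom_app {n m : ℤ} (h : n + m = 0) (X : B) :
    (shiftFunctorCompIsoId (Level0 k (H0 k B)) n m h).hom.app ⟨⟨X⟩⟩ =
      H0.homMk (trCancel k h X) (trCancel_mem h X) := by
  -- By construction the isomorphism is the composite `X[n][m] → X[n + m] → X[0] → X`, with a
  -- transport along `n + m = 0` in the middle.
  have e : (shiftFunctorCompIsoId (Level0 k (H0 k B)) n m h).hom.app ⟨⟨X⟩⟩ =
      (trAddIso k n m X).inv ≫ eqToHom (congrArg (fun i => (trFunctor k B i).obj ⟨⟨X⟩⟩) h) ≫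
        (trZeroIso k X).hom := by
    simp only [shiftFunctorCompIsoId, shiftFunctorAdd', Iso.trans_hom, Iso.symm_hom, Iso.trans_inv,
      NatTrans.comp_app, eqToIso.inv, eqToHom_app, Category.assoc]
    rfl
  refine e.trans ?_
  refine Eq.trans (congrArg (fun x => (trAddIso k n m X).inv ≫ x ≫ (trZeroIso k X).hom)
    (eqToHom_tr ⟨⟨X⟩⟩ h _)) ?_
  exact H0.homMk_congr
    (hf := comp_mem_cycles (add_zero 0) (comp_mem_cycles (add_zero 0) (ofTrZero_mem X)
      (trCast_mem X h)) (trAddInv_mem n m X)) (by simp)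

lemma shiftFunctorCompIsoId_inv_app {n m : ℤ} (h : n + m = 0) (X : B) :
    (shiftFunctorCompIsoId (Level0 k (H0 k B)) n m h).inv.app ⟨⟨X⟩⟩ =
      H0.homMk (trCancelInv k h X) (trCancelInv_mem h X) := by
  have e := (shiftFunctorCompIsoId (Level0 k (H0 k B)) n m h).inv_hom_id_app ⟨⟨X⟩⟩
  refine ((cancel_mono ((shiftFunctorCompIsoId (Level0 k (H0 k B)) n m h).hom.app ⟨⟨X⟩⟩)).1
    (e.trans (Eq.trans ?_ (congrArg (fun x => H0.homMk (trCancelInv k h X) (trCancelInv_mem h X) ≫ x)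
      (shiftFunctorCompIsoId_hom_app h X)).symm)))
  exact H0.homMk_congr (hf := id_mem_cycles X)
    (hg := comp_mem_cycles (add_zero 0) (trCancel_mem h X) (trCancelInv_mem h X)) (by simp)

end ConeStable

namespace ConeData

open ConeStable

variable {k : Type w} [Field k] {B : Type u} [FilteredDGCategory.{w, v} k B] [ConeStable k B]
  {X Y Z : B} {f : hom k X Y 0}

/-- The projection from the cone to `X[1]`. -/
def projTr (c : ConeData f) : hom k c.pt (tr k 1 X) 0 :=
  comp (neg_add_cancel 1) (toTr 1 X) c.proj

@[simp]
lemma act_projTr (c : ConeData f) : act c.projTr = act c.proj ≫ act (toTr 1 X) := act_comp _ _ _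

lemma projTr_mem (c : ConeData f) : c.projTr ∈ cycles k c.pt (tr k 1 X) 0 :=
  mem_cycles_iff.2 ⟨by simp [toTr_dOp, proj_dOp_assoc],
    len_comp_le_zero _ (len_toTr _ _) c.len_proj⟩

/-- The class of the projection from the cone to `X[1]`. -/
def projMor (c : ConeData f) : (⟨⟨c.pt⟩⟩ : Level0 k (H0 k B)) ⟶
    (CategoryTheory.shiftFunctor (Level0 k (H0 k B)) (1 : ℤ)).obj ⟨⟨X⟩⟩ :=
  H0.homMk c.projTr c.projTr_mem

/-- The triangle given by a cone. -/
abbrev triangle (c : ConeData f) (hf : f ∈ cycles k X Y 0) : Triangle (Level0 k (H0 k B)) :=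
  Triangle.mk (H0.homMk f hf) (H0.homMk c.incl c.incl_mem) c.projMor

end ConeData

namespace ConeStable

variable {k : Type w} [Field k] {B : Type u} [FilteredDGCategory.{w, v} k B] [ConeStable k B]
  {X Y Z : B}

variable (k B) in
/-- The exact triangles: those isomorphic to the triangle of a cone. -/
def distTriangles : Set (Triangle (Level0 k (H0 k B))) :=
  {T | ∃ (X Y : B) (f : hom k X Y 0) (hf : f ∈ cycles k X Y 0) (c : ConeData f),
    Nonempty (T ≅ c.triangle hf)}

lemma mem_distTriangles_of_iso {T T' : Triangle (Level0 k (H0 k B))} (e : T ≅ T')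
    (h : T' ∈ distTriangles k B) : T ∈ distTriangles k B := by
  obtain ⟨X, Y, f, hf, c, ⟨e'⟩⟩ := h
  exact ⟨X, Y, f, hf, c, ⟨e ≪≫ e'⟩⟩

/-- The criterion by which triangles are shown to be exact: keep the first two vertices and compare
the third with a cone. The two equations are needed only in cohomology, that is, up to homotopy. -/
lemma mk_mem_distTriangles {f : hom k X Y 0} (hf : f ∈ cycles k X Y 0) (c : ConeData f)
    {Z : Level0 k (H0 k B)} (e : Z ≅ ⟨⟨c.pt⟩⟩) (g : (⟨⟨Y⟩⟩ : Level0 k (H0 k B)) ⟶ Z)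
    (h : Z ⟶ (CategoryTheory.shiftFunctor (Level0 k (H0 k B)) (1 : ℤ)).obj ⟨⟨X⟩⟩)
    {φ : (⟨⟨X⟩⟩ : Level0 k (H0 k B)) ⟶ ⟨⟨Y⟩⟩} (hφ : φ = H0.homMk f hf)
    (hg : g ≫ e.hom = H0.homMk c.incl c.incl_mem) (hh : h = e.hom ≫ c.projMor) :
    Triangle.mk φ g h ∈ distTriangles k B := by
  subst hφ
  exact
  ⟨X, Y, f, hf, c, ⟨Triangle.isoMk _ _ (Iso.refl _) (Iso.refl _) e
    ((Category.comp_id _).trans (Category.id_comp _).symm) (hg.trans (Category.id_comp _).symm)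
    -- In the last square the translate of the identity of `X` appears; it is again an identity.
    (by
      refine Eq.trans ?_ hh
      refine (congrArg (fun x => h ≫ x) ?_).trans (Category.comp_id h)
      exact (shiftFunctor (Level0 k (H0 k B)) (1 : ℤ)).map_id _)⟩⟩

lemma triangle_mem {f : hom k X Y 0} (hf : f ∈ cycles k X Y 0) (c : ConeData f) :
    c.triangle hf ∈ distTriangles k B := ⟨X, Y, f, hf, c, ⟨Iso.refl _⟩⟩

end ConeStable

end FiltDG

/-! ### Rotation of triangles and cones of identities. -/

namespace FiltDG

open FilteredDGCategory

namespace ConeStable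

variable {k : Type w} [Field k] {B : Type u} [FilteredDGCategory.{w, v} k B] [ConeStable k B]
  {X Y Z : B}

/-- The cone of `incl : Y → C` consists of `Y`, `X[1]` and `Y[1]`. The two copies of `Y` cancel up
to homotopy and `X[1]` remains. -/
lemma rotate_triangle_mem {f : hom k X Y 0} (hf : f ∈ cycles k X Y 0) (c : ConeData f) :
    (c.triangle hf).rotate ∈ distTriangles k B := by
  obtain ⟨c'⟩ := exists_cone c.incl c.incl_mem
  -- The plain inclusion of `X[1]` is not closed, since the differential of `c.sec` is `incl ∘ f`.
  -- The term `c'.sec ∘ f` compensates for this, and it also produces the sign in the third map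
  -- `-f[1]`.
  let a : hom k (tr k 1 X) c'.pt 0 := comp (neg_add_cancel 1)
    (comp (zero_add (-1)) c'.incl c.sec - comp (add_zero (-1)) c'.sec f) (ofTr 1 X)
  let b : hom k c'.pt (tr k 1 X) 0 := comp (add_zero 0) c.projTr c'.ret
  have e₀ := act_comm hf
  have e₁ {W : AddCommGrpCat} (g : _ ⟶ W) := act_comm_assoc hf g
  have ha : a ∈ cycles k (tr k 1 X) c'.pt 0 := by
    refine mem_cycles_iff.2 ⟨?_, len_comp_le_zero _ (len_sub_le_zero
      (len_comp_le_zero _ c'.len_incl c.len_sec) (len_comp_le_zero _ c'.len_sec hf.2))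
      (len_ofTr _ _)⟩
    simp [a, c'.incl_dOp, c.sec_dOp_assoc, c'.sec_dOp, ofTr_dOp_assoc, e₁]
  have hb : b ∈ cycles k c'.pt (tr k 1 X) 0 := by
    refine mem_cycles_iff.2 ⟨?_, len_comp_le_zero _ c.projTr_mem.2 c'.len_ret⟩
    simp [b, toTr_dOp, c.proj_dOp_assoc, c'.ret_dOp_assoc]
  have hu : len (comp (add_zero (-1)) c'.sec (comp (add_zero 0) c.ret c'.ret)) ≤ 0 :=
    len_comp_le_zero _ c'.len_sec (len_comp_le_zero _ c.len_ret c'.len_ret)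
  have hu' : len (comp (add_zero (-1)) c'.sec c.ret) ≤ 0 := len_comp_le_zero _ c'.len_sec c.len_ret
  refine mk_mem_distTriangles c.incl_mem c'
    (H0.isoOfHomotopy a ha b hb (by simp [a, b])
      (-comp (add_zero (-1)) c'.sec (comp (add_zero 0) c.ret c'.ret)) (len_neg_le_zero hu) ?_)
    (H0.homMk c.projTr c.projTr_mem) (-H0.homMk (trMap 1 X Y 0 f) (trMap_mem 1 hf)) rfl ?_ ?_
  · simp [a, b, c'.sec_dOp, c.ret_dOp_assoc, c'.ret_dOp_assoc]
    abel
  -- This square commutes only up to homotopy: `a ∘ projTr` and the inclusion of `C` differ on the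
  -- summand `Y`, which is contracted against `Y[1]`.
  · refine H0.homMk_eq (hf := comp_mem_cycles (add_zero 0) ha c.projTr_mem)
      (-comp (add_zero (-1)) c'.sec c.ret) (len_neg_le_zero hu') ?_
    simp [a, c'.sec_dOp, c.ret_dOp_assoc]
    abel
  · exact H0.homMk_congr (hf := neg_mem (trMap_mem 1 hf))
      (hg := comp_mem_cycles (add_zero 0) c'.projTr_mem ha) (by simp [a])

/-- The cone of `C[-1] → X` consists of `X` and of the summands `Y`, `X[1]` of `C`. The pair `X`,
`X[1]` cancels up to homotopy and `Y` remains. -/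
lemma invRotate_triangle_mem {f : hom k X Y 0} (hf : f ∈ cycles k X Y 0) (c : ConeData f) :
    (c.triangle hf).invRotate ∈ distTriangles k B := by
  let v : hom k (tr k (-1) c.pt) X 0 := -comp (add_neg_cancel 1) c.proj (ofTr (-1) c.pt)
  have hv : v ∈ cycles k (tr k (-1) c.pt) X 0 :=
    mem_cycles_iff.2 ⟨by simp [v, c.proj_dOp, ofTr_dOp_assoc],
      len_neg_le_zero (len_comp_le_zero _ c.len_proj (len_ofTr _ _))⟩
  obtain ⟨c'⟩ := exists_cone v hv
  -- The canonical morphism has degree `-(-1)`, recast here as `1`.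
  let s : hom k c.pt (tr k (-1) c.pt) 1 := degCast k (neg_neg 1) (toTr (-1) c.pt)
  have hs : len s ≤ 0 := len_degCast_le_zero _ (len_toTr _ _)
  let a : hom k Y c'.pt 0 := comp (neg_add_cancel 1) c'.sec (comp (add_zero 1) s c.incl)
  let b : hom k c'.pt Y 0 := comp (add_zero 0) f c'.ret +
    comp (add_zero 0) c.ret (comp (neg_add_cancel 1) (ofTr (-1) c.pt) c'.proj)
  have e₀ := act_comm hf
  have e₁ {W : AddCommGrpCat} (g : _ ⟶ W) := act_comm_assoc hf g
  -- No correction term is needed: the differential of `c'.sec` contributes `v ∘ s ∘ incl = -proj ∘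
  -- incl`, which vanishes.
  have ha : a ∈ cycles k Y c'.pt 0 := by
    refine mem_cycles_iff.2 ⟨?_, len_comp_le_zero _ c'.len_sec
      (len_comp_le_zero _ hs c.len_incl)⟩
    simp [a, s, v, c.incl_dOp_assoc, c'.sec_dOp, toTr_dOp_assoc]
  have hb : b ∈ cycles k c'.pt Y 0 := by
    refine mem_cycles_iff.2 ⟨?_, len_add_le_zero (len_comp_le_zero _ hf.2 c'.len_ret)
      (len_comp_le_zero _ c.len_ret (len_comp_le_zero _ (len_ofTr _ _) c'.len_proj))⟩
    simp [b, v, e₀, c.ret_dOp, c'.ret_dOp_assoc, c'.proj_dOp_assoc, ofTr_dOp_assoc]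
  have hu : len (comp (show -1 + 0 = -1 by omega) c'.sec
      (comp (show 1 + -1 = 0 by omega) s (comp (add_zero (-1)) c.sec c'.ret))) ≤ 0 :=
    len_comp_le_zero _ c'.len_sec
      (len_comp_le_zero _ hs (len_comp_le_zero _ c.len_sec c'.len_ret))
  have hu' : len (comp (show -1 + 0 = -1 by omega) c'.sec
      (comp (show 1 + -1 = 0 by omega) s c.sec)) ≤ 0 :=
    len_comp_le_zero _ c'.len_sec (len_comp_le_zero _ hs c.len_sec)
  -- The minus sign in `v` is the one in the definition of the inverse rotation.
  have e₂ : H0.homMk v hv = -(CategoryTheory.shiftFunctor (Level0 k (H0 k B)) (-1 : ℤ)).map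
      c.projMor ≫ (shiftEquiv (Level0 k (H0 k B)) (1 : ℤ)).unitIso.inv.app ⟨⟨X⟩⟩ := by
    refine Eq.trans ?_ (congrArg (fun x => -(CategoryTheory.shiftFunctor (Level0 k (H0 k B))
      (-1 : ℤ)).map c.projMor ≫ x) (shiftFunctorCompIsoId_hom_app (add_neg_cancel 1) X)).symm
    exact H0.homMk_congr (hf := hv) (hg := neg_mem (comp_mem_cycles (add_zero 0)
      (trCancel_mem (add_neg_cancel 1) X) (trMap_mem (-1) c.projTr_mem))) (by simp [v])
  have e₃ : H0.homMk c.incl c.incl_mem ≫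
        (shiftEquiv (Level0 k (H0 k B)) (1 : ℤ)).counitIso.inv.app ⟨⟨c.pt⟩⟩ =
      H0.homMk a ha ≫ c'.projMor := by
    refine (congrArg (fun x => H0.homMk c.incl c.incl_mem ≫ x)
      (shiftFunctorCompIsoId_inv_app (neg_add_cancel 1) c.pt)).trans ?_
    exact H0.homMk_congr (hf := comp_mem_cycles (add_zero 0)
      (trCancelInv_mem (neg_add_cancel 1) c.pt) c.incl_mem)
      (hg := comp_mem_cycles (add_zero 0) c'.projTr_mem ha) (by simp [a, s])
  exact mk_mem_distTriangles hv c' (H0.isoOfHomotopy a ha b hb (by simp [a, b, s]) _ hu (by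
        simp [a, b, s, v, c'.sec_dOp, c.sec_dOp_assoc, c'.ret_dOp_assoc, toTr_dOp_assoc]
        abel)) (H0.homMk f hf) _ e₂.symm
    (H0.homMk_eq (hf := comp_mem_cycles (add_zero 0) ha hf) (hg := c'.incl_mem) _ hu' (by
        simp [a, s, v, c'.sec_dOp, c.sec_dOp_assoc, toTr_dOp_assoc]
        abel)) e₃

/-- The identity is its own inverse and has level ≤ 0, so its cone is contractible already at level
0 and is a zero object of the 0-level. -/
lemma contractible_mem (A : Level0 k (H0 k B)) : contractibleTriangle A ∈ distTriangles k B := by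
  obtain ⟨⟨X⟩⟩ := A
  obtain ⟨c⟩ := exists_cone (FilteredDGCategory.id (k := k) X) (id_mem_cycles X)
  have h : IsZero (⟨⟨c.pt⟩⟩ : Level0 k (H0 k B)) := by
    refine (IsZero.iff_id_eq_zero _).2 (H0Hom.mk_eq (id_mem_cycles c.pt) (zero_mem _) ?_)
    rw [sub_zero]
    exact c.id_mem_boundaries (id_mem_cycles X) (FilteredDGCategory.id X) (len_id_le X)
      (by simp) (by simp)
  exact mk_mem_distTriangles (id_mem_cycles X) c ((isZero_zero _).iso h) _ _ rfl
    (h.eq_of_tgt _ _) ((isZero_zero _).eq_of_src _ _)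

lemma exists_cone_triangle {A A' : Level0 k (H0 k B)} (φ : A ⟶ A') :
    ∃ (Z : Level0 k (H0 k B)) (g : A' ⟶ Z)
      (h : Z ⟶ (CategoryTheory.shiftFunctor (Level0 k (H0 k B)) (1 : ℤ)).obj A),
      Triangle.mk φ g h ∈ distTriangles k B := by
  obtain ⟨f, hf, rfl⟩ := H0.exists_homMk φ
  obtain ⟨c⟩ := exists_cone f hf
  exact ⟨_, _, _, triangle_mem hf c⟩

lemma rotate_mem (T : Triangle (Level0 k (H0 k B))) (hT : T ∈ distTriangles k B) :
    T.rotate ∈ distTriangles k B := by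
  obtain ⟨X, Y, f, hf, c, ⟨e⟩⟩ := hT
  exact mem_distTriangles_of_iso ((rotate _).mapIso e) (rotate_triangle_mem hf c)

lemma invRotate_mem (T : Triangle (Level0 k (H0 k B))) (hT : T ∈ distTriangles k B) :
    T.invRotate ∈ distTriangles k B := by
  obtain ⟨X, Y, f, hf, c, ⟨e⟩⟩ := hT
  exact mem_distTriangles_of_iso ((invRotate _).mapIso e) (invRotate_triangle_mem hf c)

end ConeStable

end FiltDG

/-! ### Morphisms of triangles and the octahedral axiom. -/

namespace FiltDG

open FilteredDGCategory

namespace ConeStable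

variable {k : Type w} [Field k] {B : Type u} [FilteredDGCategory.{w, v} k B] [ConeStable k B]
  {X Y Z : B}

/-- With representatives `a`, `b` and a homotopy `u` from commutativity of the given square, the
third map is the block matrix with diagonal `b`, `a` and off-diagonal entry `u`. The homotopy
equation is exactly the condition that this matrix is closed, and the two new squares then commute
strictly. -/
lemma complete_triangle_morphism {X' Y' : B} {f : hom k X Y 0} (hf : f ∈ cycles k X Y 0)
    (c : ConeData f) {f' : hom k X' Y' 0} (hf' : f' ∈ cycles k X' Y' 0) (c' : ConeData f')
    (α : (⟨⟨X⟩⟩ : Level0 k (H0 k B)) ⟶ ⟨⟨X'⟩⟩) (β : (⟨⟨Y⟩⟩ : Level0 k (H0 k B)) ⟶ ⟨⟨Y'⟩⟩)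
    (comm : H0.homMk f hf ≫ β = α ≫ H0.homMk f' hf') :
    ∃ γ : (⟨⟨c.pt⟩⟩ : Level0 k (H0 k B)) ⟶ ⟨⟨c'.pt⟩⟩,
      H0.homMk c.incl c.incl_mem ≫ γ = β ≫ H0.homMk c'.incl c'.incl_mem ∧
      c.projMor ≫ (CategoryTheory.shiftFunctor (Level0 k (H0 k B)) (1 : ℤ)).map α =
        γ ≫ c'.projMor := by
  obtain ⟨a, ha, rfl⟩ := H0.exists_homMk α
  obtain ⟨b, hb, rfl⟩ := H0.exists_homMk β
  obtain ⟨u, hu, hu'⟩ := H0.exists_homotopy (hf := comp_mem_cycles (add_zero 0) hb hf)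
    (hg := comp_mem_cycles (add_zero 0) hf' ha) comm
  simp only [act_comp] at hu'
  -- The three summands are the entries `b`, `a` and `u` of the block matrix; the level of the last
  -- is controlled by the bound on the homotopy.
  have hc : len (comp (add_zero 0) c'.incl (comp (add_zero 0) b c.ret) +
      comp (neg_add_cancel 1) c'.sec (comp (zero_add 1) a c.proj) +
      comp (add_zero 0) c'.incl (comp (neg_add_cancel 1) u c.proj)) ≤ 0 :=
    len_add_le_zero (len_add_le_zero
      (len_comp_le_zero _ c'.len_incl (len_comp_le_zero _ hb.2 c.len_ret))
      (len_comp_le_zero _ c'.len_sec (len_comp_le_zero _ ha.2 c.len_proj)))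
      (len_comp_le_zero _ c'.len_incl (len_comp_le_zero _ hu c.len_proj))
  have e₁ {W : AddCommGrpCat} (g : _ ⟶ W) := act_comm_assoc hf g
  have e₂ {W : AddCommGrpCat} (g : _ ⟶ W) := act_comm_assoc ha g
  have e₃ {W : AddCommGrpCat} (g : _ ⟶ W) := act_comm_assoc hb g
  have e₄ {W : AddCommGrpCat} (g : _ ⟶ W) : act u ≫ dOp k Y' ≫ g =
      act f ≫ act b ≫ g - act a ≫ act f' ≫ g - dOp k X ≫ act u ≫ g := by
    rw [← Category.assoc, eq_sub_of_add_eq hu']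
    simp
  have hm := mem_cycles_iff.2 ⟨by
    simp [c'.incl_dOp, c.ret_dOp_assoc, c'.sec_dOp, c.proj_dOp_assoc, e₂, e₃, e₄]
    abel, hc⟩
  refine ⟨H0.homMk _ hm, ?_, ?_⟩
  · exact H0.homMk_congr (hf := comp_mem_cycles (add_zero 0) hm c.incl_mem)
      (hg := comp_mem_cycles (add_zero 0) c'.incl_mem hb) (by simp)
  · exact H0.homMk_congr (hf := comp_mem_cycles (add_zero 0) (trMap_mem 1 ha) c.projTr_mem)
      (hg := comp_mem_cycles (add_zero 0) c'.projTr_mem hm) (by simp)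

/-- Exact triangles are only isomorphic to those of cones; conjugation by the isomorphisms reduces
the morphism axiom to cones. -/
lemma exists_morphism_of_iso {C : Type*} [Category* C] [HasShift C ℤ] {T T' S S' : Triangle C}
    (e : T ≅ S) (e' : T' ≅ S')
    (H : ∀ (α : S.obj₁ ⟶ S'.obj₁) (β : S.obj₂ ⟶ S'.obj₂), S.mor₁ ≫ β = α ≫ S'.mor₁ →
      ∃ γ : S.obj₃ ⟶ S'.obj₃, S.mor₂ ≫ γ = β ≫ S'.mor₂ ∧
        S.mor₃ ≫ (CategoryTheory.shiftFunctor C (1 : ℤ)).map α = γ ≫ S'.mor₃)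
    (α : T.obj₁ ⟶ T'.obj₁) (β : T.obj₂ ⟶ T'.obj₂) (comm : T.mor₁ ≫ β = α ≫ T'.mor₁) :
    ∃ γ : T.obj₃ ⟶ T'.obj₃, T.mor₂ ≫ γ = β ≫ T'.mor₂ ∧
      T.mor₃ ≫ (CategoryTheory.shiftFunctor C (1 : ℤ)).map α = γ ≫ T'.mor₃ := by
  obtain ⟨γ, h, h'⟩ := H (e.inv.hom₁ ≫ α ≫ e'.hom.hom₁) (e.inv.hom₂ ≫ β ≫ e'.hom.hom₂) (by
    rw [e.inv.comm₁_assoc, reassoc_of% comm, e'.hom.comm₁, Category.assoc, Category.assoc])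
  refine ⟨e.hom.hom₃ ≫ γ ≫ e'.inv.hom₃, ?_, ?_⟩
  · rw [e.hom.comm₂_assoc, reassoc_of% h, e'.inv.comm₂, Iso.hom_inv_id_triangle_hom₂_assoc,
      Iso.hom_inv_id_triangle_hom₂_assoc]
  -- The map `α` is recovered from its conjugate, so that the square obtained for the cones can be
  -- inserted.
  · have h₃ : (CategoryTheory.shiftFunctor C (1 : ℤ)).map α =
        (CategoryTheory.shiftFunctor C (1 : ℤ)).map e.hom.hom₁ ≫
          (CategoryTheory.shiftFunctor C (1 : ℤ)).map (e.inv.hom₁ ≫ α ≫ e'.hom.hom₁) ≫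
            (CategoryTheory.shiftFunctor C (1 : ℤ)).map e'.inv.hom₁ := by
      simp [← Functor.map_comp]
    rw [h₃, e.hom.comm₃_assoc, reassoc_of% h', e'.inv.comm₃, Category.assoc, Category.assoc]

instance pretriangulated : Pretriangulated (Level0 k (H0 k B)) where
  distinguishedTriangles := distTriangles k B
  isomorphic_distinguished _ h _ e := mem_distTriangles_of_iso e h
  contractible_distinguished := contractible_mem
  distinguished_cocone_triangle := exists_cone_triangle
  rotate_distinguished_triangle T :=
    -- For the converse direction `T` is identified with the inverse rotation of its rotation.
    ⟨rotate_mem T, fun h => mem_distTriangles_of_iso (rotCompInvRot.app T) (invRotate_mem _ h)⟩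
  complete_distinguished_triangle_morphism := by
    rintro T T' ⟨X, Y, f, hf, c, ⟨e⟩⟩ ⟨X', Y', f', hf', c', ⟨e'⟩⟩ α β comm
    exact exists_morphism_of_iso e e' (complete_triangle_morphism hf c hf' c') α β comm

/-- The maps between the cones are the block-diagonal matrices `(g, 1)` and `(1, f)`. The cone of
the first consists of `Z`, `X[1]`, `Y[1]` and `X[2]`; cancelling the two translates of `X` leaves
the cone of `g`. -/
lemma octahedron {f : hom k X Y 0} (hf : f ∈ cycles k X Y 0) {g : hom k Y Z 0}
    (hg : g ∈ cycles k Y Z 0) (c₁ : ConeData f) (c₂ : ConeData g)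
    (c₃ : ConeData (comp (add_zero 0) g f)) :
    Nonempty (Triangulated.Octahedron
      (rfl : H0.homMk f hf ≫ H0.homMk g hg = H0.homMk f hf ≫ H0.homMk g hg)
      (triangle_mem hf c₁ : c₁.triangle hf ∈ distTriang _)
      (triangle_mem hg c₂ : c₂.triangle hg ∈ distTriang _)
      (triangle_mem (comp_mem_cycles (add_zero 0) hg hf) c₃ :
        Triangle.mk (H0.homMk f hf ≫ H0.homMk g hg) (H0.homMk c₃.incl c₃.incl_mem) c₃.projMor ∈
          distTriang _)) := by
  let m₁ : hom k c₁.pt c₃.pt 0 := comp (add_zero 0) c₃.incl (comp (add_zero 0) g c₁.ret) +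
    comp (neg_add_cancel 1) c₃.sec c₁.proj
  let m₃ : hom k c₃.pt c₂.pt 0 := comp (add_zero 0) c₂.incl c₃.ret +
    comp (neg_add_cancel 1) c₂.sec (comp (zero_add 1) f c₃.proj)
  have f₁ {W : AddCommGrpCat} (φ : _ ⟶ W) := act_comm_assoc hf φ
  have g₁ {W : AddCommGrpCat} (φ : _ ⟶ W) := act_comm_assoc hg φ
  have hm₁ : m₁ ∈ cycles k c₁.pt c₃.pt 0 := by
    refine mem_cycles_iff.2 ⟨?_, len_add_le_zero
      (len_comp_le_zero _ c₃.len_incl (len_comp_le_zero _ hg.2 c₁.len_ret))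
      (len_comp_le_zero _ c₃.len_sec c₁.len_proj)⟩
    simp [m₁, c₃.incl_dOp, c₁.ret_dOp_assoc, c₃.sec_dOp, c₁.proj_dOp_assoc, g₁]
    abel
  have hm₃ : m₃ ∈ cycles k c₃.pt c₂.pt 0 := by
    refine mem_cycles_iff.2 ⟨?_, len_add_le_zero (len_comp_le_zero _ c₂.len_incl c₃.len_ret)
      (len_comp_le_zero _ c₂.len_sec (len_comp_le_zero _ hf.2 c₃.len_proj))⟩
    simp [m₃, c₂.incl_dOp, c₃.ret_dOp_assoc, c₂.sec_dOp, c₃.proj_dOp_assoc, f₁]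
    abel
  obtain ⟨c⟩ := exists_cone m₁ hm₁
  -- The inclusion places the summand `Z` of the cone of `g` in the cone of `g ∘ f`, and its summand
  -- `Y[1]` in the translated cone of `f`.
  let a : hom k c₂.pt c.pt 0 := comp (add_zero 0) c.incl (comp (add_zero 0) c₃.incl c₂.ret) +
    comp (neg_add_cancel 1) c.sec (comp (zero_add 1) c₁.incl c₂.proj)
  let b : hom k c.pt c₂.pt 0 := comp (add_zero 0) m₃ c.ret +
    comp (neg_add_cancel 1) c₂.sec (comp (zero_add 1) c₁.ret c.proj)
  -- The homotopy sends the copy of `X[1]` in the cone of `g ∘ f` to the copy of `X[2]` in the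
  -- translated cone of `f`.
  let u : hom k c.pt c.pt (-1) := comp (show -1 + 0 = -1 by omega) c.sec
    (comp (show -1 + 1 = 0 by omega) c₁.sec (comp (add_zero 1) c₃.proj c.ret))
  have ha : a ∈ cycles k c₂.pt c.pt 0 := by
    refine mem_cycles_iff.2 ⟨?_, len_add_le_zero
      (len_comp_le_zero _ c.len_incl (len_comp_le_zero _ c₃.len_incl c₂.len_ret))
      (len_comp_le_zero _ c.len_sec (len_comp_le_zero _ c₁.len_incl c₂.len_proj))⟩
    simp [a, m₁, c.incl_dOp, c₃.incl_dOp_assoc, c₂.ret_dOp_assoc, c.sec_dOp, c₁.incl_dOp_assoc,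
      c₂.proj_dOp_assoc]
    abel
  have hb : b ∈ cycles k c.pt c₂.pt 0 := by
    refine mem_cycles_iff.2 ⟨?_, len_add_le_zero (len_comp_le_zero _ hm₃.2 c.len_ret)
      (len_comp_le_zero _ c₂.len_sec (len_comp_le_zero _ c₁.len_ret c.len_proj))⟩
    simp [b, m₁, m₃, c₂.incl_dOp, c₃.ret_dOp_assoc, c₂.sec_dOp, c₃.proj_dOp_assoc, f₁,
      c.ret_dOp_assoc, c₁.ret_dOp_assoc, c.proj_dOp_assoc]
    abel
  have hu : len (-u) ≤ 0 := len_neg_le_zero (len_comp_le_zero _ c.len_sec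
    (len_comp_le_zero _ c₁.len_sec (len_comp_le_zero _ c₃.len_proj c.len_ret)))
  have hab : act a ≫ act b = 𝟙 _ := by simp [a, b, m₃]
  have huab : act (-u) ≫ dOp k c.pt + dOp k c.pt ≫ act (-u) = act b ≫ act a - 𝟙 _ := by
    simp [a, b, u, m₁, m₃, c.sec_dOp, c₁.sec_dOp_assoc, c₃.proj_dOp_assoc, c.ret_dOp_assoc]
    abel
  refine ⟨⟨H0.homMk m₁ hm₁, H0.homMk m₃ hm₃, ?_, ?_, ?_, ?_, ?_⟩⟩
  · exact H0.homMk_congr (hf := comp_mem_cycles (add_zero 0) hm₁ c₁.incl_mem)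
      (hg := comp_mem_cycles (add_zero 0) c₃.incl_mem hg) (by simp [m₁])
  · exact H0.homMk_congr (hf := comp_mem_cycles (add_zero 0) c₃.projTr_mem hm₁)
      (hg := c₁.projTr_mem) (by simp [m₁])
  · exact H0.homMk_congr (hf := comp_mem_cycles (add_zero 0) hm₃ c₃.incl_mem)
      (hg := c₂.incl_mem) (by simp [m₃])
  · exact H0.homMk_congr (hf := comp_mem_cycles (add_zero 0) (trMap_mem 1 hf) c₃.projTr_mem)
      (hg := comp_mem_cycles (add_zero 0) c₂.projTr_mem hm₃) (by simp [m₃])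
  · refine mk_mem_distTriangles hm₁ c (H0.isoOfHomotopy a ha b hb hab _ hu huab) _ _ rfl ?_ ?_
    -- Of all the commutativities this is the only one that requires a homotopy; it is the same
    -- cancellation of the two translates of `X`.
    · refine H0.homMk_eq (hf := comp_mem_cycles (add_zero 0) ha hm₃) (hg := c.incl_mem)
        (-comp (show -1 + 0 = -1 by omega) c.sec (comp (neg_add_cancel 1) c₁.sec c₃.proj))
        (len_neg_le_zero (len_comp_le_zero _ c.len_sec
          (len_comp_le_zero _ c₁.len_sec c₃.len_proj))) ?_
      simp [a, m₁, m₃, c.sec_dOp, c₁.sec_dOp_assoc, c₃.proj_dOp_assoc]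
      abel
    · exact H0.homMk_congr
        (hf := comp_mem_cycles (add_zero 0) (trMap_mem 1 c₁.incl_mem) c₂.projTr_mem)
        (hg := comp_mem_cycles (add_zero 0) c.projTr_mem ha) (by simp [a])

instance isTriangulated : IsTriangulated (Level0 k (H0 k B)) :=
  -- It suffices to exhibit one octahedron for each composable pair up to isomorphism, so
  -- representatives and cones may be chosen freely.
  IsTriangulated.mk' fun A A' A'' φ ψ => by
    obtain ⟨f, hf, rfl⟩ := H0.exists_homMk φ
    obtain ⟨g, hg, rfl⟩ := H0.exists_homMk ψ
    obtain ⟨c₁⟩ := exists_cone f hf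
    obtain ⟨c₂⟩ := exists_cone g hg
    obtain ⟨c₃⟩ := exists_cone _ (comp_mem_cycles (add_zero 0) hg hf)
    exact ⟨_, _, _, _, _, _, _, _, Iso.refl _, Iso.refl _, Iso.refl _,
      (Category.comp_id _).trans (Category.id_comp _).symm,
      (Category.comp_id _).trans (Category.id_comp _).symm, _, _, _, _, _, _, _, _, _,
      octahedron hf hg c₁ c₂ c₃⟩

end ConeStable

end FiltDG

/-! ### Direct sums and morphisms of arbitrary shift. -/

namespace FiltDG

-- The inclusions and projections of a direct sum in the 0-level have shift 0, so composition with
-- them preserves the shift `r`. The direct sum equations, which hold in shift 0, then provide the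
-- inverse map by the usual formula.
open PersistenceCategory in
lemma PersistenceCategory.bijective_comp_inl_inr {k : Type w} [Field k] {C : Type u}
    [PersistenceCategory.{w, v} k C] {A B : Level0 k C} (D : Level0 k C) {b : BinaryBicone A B}
    (hb : b.IsBilimit) (r : ℝ) :
    Function.Bijective fun f : hom k b.pt.obj D.obj r =>
      ((comp (add_zero r) f b.inl : hom k A.obj D.obj r),
        (comp (add_zero r) f b.inr : hom k B.obj D.obj r)) := by
  have h₁ : comp (add_zero 0) b.fst b.inl = PersistenceCategory.id (k := k) A.obj := b.inl_fst
  have h₂ : comp (k := k) (add_zero 0) b.snd b.inl = (0 : hom k A.obj B.obj 0) := b.inl_snd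
  have h₃ : comp (k := k) (add_zero 0) b.fst b.inr = (0 : hom k B.obj A.obj 0) := b.inr_fst
  have h₄ : comp (add_zero 0) b.snd b.inr = PersistenceCategory.id (k := k) B.obj := b.inr_snd
  have h₅ : comp (k := k) (add_zero 0) b.inl b.fst + comp (add_zero 0) b.inr b.snd =
      PersistenceCategory.id b.pt.obj := IsBilimit.binary_total hb
  refine Function.bijective_iff_has_inverse.2
    ⟨fun p => comp (add_zero r) p.1 b.fst + comp (add_zero r) p.2 b.snd, fun f => ?_, fun p => ?_⟩
  · dsimp only
    rw [assoc _ _ (add_zero 0) (add_zero r), assoc _ _ (add_zero 0) (add_zero r), ← map_add, h₅,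
      comp_id]
  · refine Prod.ext ?_ ?_ <;>
    simp only [map_add, LinearMap.add_apply] <;>
    rw [assoc _ _ (add_zero 0) (add_zero r), assoc _ _ (add_zero 0) (add_zero r)]
    · rw [h₁, h₂, map_zero, comp_id, add_zero]
    · rw [h₃, h₄, map_zero, comp_id, zero_add]

open PersistenceCategory in
lemma PersistenceCategory.bijective_comp_fst_snd {k : Type w} [Field k] {C : Type u}
    [PersistenceCategory.{w, v} k C] {A B : Level0 k C} (D : Level0 k C) {b : BinaryBicone A B}
    (hb : b.IsBilimit) (r : ℝ) :
    Function.Bijective fun f : hom k D.obj b.pt.obj r =>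
      ((comp (zero_add r) b.fst f : hom k D.obj A.obj r),
        (comp (zero_add r) b.snd f : hom k D.obj B.obj r)) := by
  have h₁ : comp (add_zero 0) b.fst b.inl = PersistenceCategory.id (k := k) A.obj := b.inl_fst
  have h₂ : comp (k := k) (add_zero 0) b.snd b.inl = (0 : hom k A.obj B.obj 0) := b.inl_snd
  have h₃ : comp (k := k) (add_zero 0) b.fst b.inr = (0 : hom k B.obj A.obj 0) := b.inr_fst
  have h₄ : comp (add_zero 0) b.snd b.inr = PersistenceCategory.id (k := k) B.obj := b.inr_snd
  have h₅ : comp (k := k) (add_zero 0) b.inl b.fst + comp (add_zero 0) b.inr b.snd =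
      PersistenceCategory.id b.pt.obj := IsBilimit.binary_total hb
  refine Function.bijective_iff_has_inverse.2
    ⟨fun p => comp (zero_add r) b.inl p.1 + comp (zero_add r) b.inr p.2, fun f => ?_, fun p => ?_⟩
  · dsimp only
    rw [← assoc (add_zero 0) (zero_add r), ← assoc (add_zero 0) (zero_add r),
      ← LinearMap.add_apply, ← map_add, h₅, PersistenceCategory.id_comp]
  · refine Prod.ext ?_ ?_ <;>
    simp only [map_add] <;>
    rw [← assoc (add_zero 0) (zero_add r), ← assoc (add_zero 0) (zero_add r)]
    · rw [h₁, h₃, map_zero, LinearMap.zero_apply, PersistenceCategory.id_comp, add_zero]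
    · rw [h₂, h₄, map_zero, LinearMap.zero_apply, PersistenceCategory.id_comp, zero_add]

open FilteredDGCategory

namespace ConeStable

/-! ### The triangulated persistence structure -/

variable {k : Type w} [Field k] {B : Type u} [FilteredDGCategory.{w, v} k B] [ConeStable k B]
  {X Y Z : B}

variable (k B) in
/-- The objects `Σ^r X` and the morphisms between them and `X`. -/
def shiftData : ShiftData k (H0 k B) where
  obj r X := ⟨sh k r X.obj⟩
  e r X := H0Hom.mk (toSh r X.obj) (toSh_mem r X.obj)
  e' r X := H0Hom.mk (ofSh r X.obj) (ofSh_mem r X.obj)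
  e'_e r X := congrArg _ (Subtype.ext (ofSh_toSh r X.obj))
  e_e' r X := congrArg _ (Subtype.ext (toSh_ofSh r X.obj))

variable (k B) in
/-- The functor `Σ^r` on the `0`-level. -/
abbrev shFunctor (r : ℝ) : Level0 k (H0 k B) ⥤ Level0 k (H0 k B) :=
  ((shiftData k B).shiftFunctor.functor r).level0

/-- The morphism `Σ^r f : Σ^r X → Σ^r Y`. -/
def shMap (r : ℝ) {n : ℤ} (f : hom k X Y n) : hom k (sh k r X) (sh k r Y) n :=
  comp (add_zero n) (comp (zero_add n) (toSh r Y) f) (ofSh r X)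

@[simp]
lemma act_shMap (r : ℝ) {n : ℤ} (f : hom k X Y n) :
    act (shMap r f) = act (ofSh r X) ≫ act f ≫ act (toSh r Y) := by
  simp only [shMap, act_comp]

lemma len_shMap_le (r : ℝ) {n : ℤ} {f : hom k X Y n} (hf : len f ≤ 0) : len (shMap r f) ≤ 0 :=
  len_comp_le_coe _ (a := r) (b := -r)
    (len_comp_le_coe _ (a := r) (b := 0) (toSh_mem r Y).2 hf (add_zero r)) (ofSh_mem r X).2
    (add_neg_cancel r)

lemma shMap_mem (r : ℝ) {f : hom k X Y 0} (hf : f ∈ cycles k X Y 0) :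
    shMap r f ∈ cycles k (sh k r X) (sh k r Y) 0 :=
  comp_mem_cycles (add_neg_cancel r) (comp_mem_cycles (add_zero r) (toSh_mem r Y) hf)
    (ofSh_mem r X)

lemma shFunctor_map (r : ℝ) {f : hom k X Y 0} (hf : f ∈ cycles k X Y 0) :
    (shFunctor k B r).map (H0.homMk f hf) = H0.homMk (shMap r f) (shMap_mem r hf) := rfl

variable (k) in
/-- The canonical morphism `Σ^r (X[n]) → (Σ^r X)[n]`. -/
def shTr (r : ℝ) (n : ℤ) (X : B) : hom k (sh k r (tr k n X)) (tr k n (sh k r X)) 0 :=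
  comp (neg_add_cancel n) (toTr n (sh k r X))
    (comp (zero_add n) (toSh r X) (comp (add_zero n) (ofTr n X) (ofSh r (tr k n X))))

@[simp]
lemma act_shTr (r : ℝ) (n : ℤ) (X : B) : act (shTr k r n X) =
    act (ofSh r (tr k n X)) ≫ act (ofTr n X) ≫ act (toSh r X) ≫ act (toTr n (sh k r X)) := by
  simp [shTr]

/-- The filtration levels `r` of `toSh` and `-r` of `ofSh` add up to 0, and the signs of `toTr` and
`ofTr` cancel. -/
lemma shTr_mem (r : ℝ) (n : ℤ) (X : B) :
    shTr k r n X ∈ cycles k (sh k r (tr k n X)) (tr k n (sh k r X)) 0 := by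
  refine mem_cycles_iff.2 ⟨?_, len_comp_le_zero _ (len_toTr _ _)
    (len_comp_le_coe _ (a := r) (b := -r) (toSh_mem r X).2
      (len_comp_le_coe _ (a := 0) (b := -r) (len_ofTr _ _) (ofSh_mem r _).2 (zero_add _))
      (add_neg_cancel r))⟩
  rcases Int.units_eq_one_or n.negOnePow with hn | hn <;>
  simp [toTr_dOp, ofTr_dOp_assoc, toSh_dOp_assoc, ofSh_dOp_assoc, hn]

variable (k) in
/-- The canonical morphism `(Σ^r X)[n] → Σ^r (X[n])`. -/
def trSh (r : ℝ) (n : ℤ) (X : B) : hom k (tr k n (sh k r X)) (sh k r (tr k n X)) 0 :=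
  comp (zero_add 0) (toSh r (tr k n X))
    (comp (neg_add_cancel n) (toTr n X) (comp (zero_add n) (ofSh r X) (ofTr n (sh k r X))))

@[simp]
lemma act_trSh (r : ℝ) (n : ℤ) (X : B) : act (trSh k r n X) =
    act (ofTr n (sh k r X)) ≫ act (ofSh r X) ≫ act (toTr n X) ≫ act (toSh r (tr k n X)) := by
  simp [trSh]

lemma trSh_mem (r : ℝ) (n : ℤ) (X : B) :
    trSh k r n X ∈ cycles k (tr k n (sh k r X)) (sh k r (tr k n X)) 0 := by
  refine mem_cycles_iff.2 ⟨?_, len_comp_le_coe _ (a := r) (b := -r) (toSh_mem _ _).2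
    (len_comp_le_coe _ (a := 0) (b := -r) (len_toTr _ _)
      (len_comp_le_coe _ (a := -r) (b := 0) (ofSh_mem _ _).2 (len_ofTr _ _) (add_zero _))
      (zero_add _)) (add_neg_cancel r)⟩
  rcases Int.units_eq_one_or n.negOnePow with hn | hn <;>
  simp [toTr_dOp_assoc, ofTr_dOp_assoc, toSh_dOp, ofSh_dOp_assoc, hn]

variable (k) in
/-- The isomorphism `Σ^r (X[n]) ≅ (Σ^r X)[n]`. -/
def shTrIso (r : ℝ) (n : ℤ) (X : B) :
    (⟨⟨sh k r (tr k n X)⟩⟩ : Level0 k (H0 k B)) ≅ ⟨⟨tr k n (sh k r X)⟩⟩ :=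
  H0.isoMk (shTr k r n X) (shTr_mem _ _ _) (trSh k r n X) (trSh_mem _ _ _) (by simp) (by simp)

instance shCommShift (r : ℝ) : (shFunctor k B r).CommShift ℤ where
  commShiftIso n := NatIso.ofComponents (fun A => shTrIso k r n A.obj.obj) (fun {A A'} φ => by
    obtain ⟨f, hf, rfl⟩ := H0.exists_homMk φ
    exact H0.homMk_congr (hf := comp_mem_cycles (add_zero 0) (shTr_mem _ _ _)
        (shMap_mem r (trMap_mem n hf)))
      (hg := comp_mem_cycles (add_zero 0) (trMap_mem n (shMap_mem r hf)) (shTr_mem _ _ _))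
      (by simp))
  commShiftIso_zero := by
    ext A
    rw [Functor.CommShift.isoZero_hom_app]
    exact H0.homMk_congr (hf := shTr_mem _ _ _) (hg := comp_mem_cycles (add_zero 0)
      (toTrZero_mem _) (shMap_mem r (ofTrZero_mem _))) (by simp)
  commShiftIso_add n m := by
    ext A
    rw [Functor.CommShift.isoAdd_hom_app]
    exact H0.homMk_congr (hf := shTr_mem _ _ _)
      (hg := comp_mem_cycles (add_zero 0) (comp_mem_cycles (add_zero 0)
        (comp_mem_cycles (add_zero 0) (trAddInv_mem _ _ _) (trMap_mem m (shTr_mem _ _ _)))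
        (shTr_mem _ _ _)) (shMap_mem r (trAdd_mem _ _ _))) (by simp)

/-- The shift of a cone. -/
def shCone (r : ℝ) {f : hom k X Y 0} (c : ConeData f) : ConeData (shMap r f) where
  pt := sh k r c.pt
  incl := shMap r c.incl
  ret := shMap r c.ret
  sec := shMap r c.sec
  proj := shMap r c.proj
  d_incl := (closed_iff (zero_add 1) _).2 (by
    simp [toSh_dOp, ofSh_dOp_assoc, c.incl_dOp_assoc])
  d_ret := act_injective (by
    simp [act_d (zero_add 1), toSh_dOp, ofSh_dOp_assoc, c.ret_dOp_assoc])
  d_sec := act_injective (by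
    simp [act_d_neg_one, toSh_dOp, ofSh_dOp_assoc, c.sec_dOp_assoc])
  d_proj := (closed_iff one_add_one_eq_two _).2 (by
    simp [toSh_dOp, ofSh_dOp_assoc, c.proj_dOp_assoc])
  len_incl := len_shMap_le r c.len_incl
  len_ret := len_shMap_le r c.len_ret
  len_sec := len_shMap_le r c.len_sec
  len_proj := len_shMap_le r c.len_proj
  ret_incl := act_injective (by simp)
  proj_sec := act_injective (by simp)
  proj_incl := act_injective (by simp)
  ret_sec := act_injective (by simp)
  total := act_injective (by simp)

instance shFunctor_isTriangulated (r : ℝ) : (shFunctor k B r).IsTriangulated where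
  map_distinguished := by
    rintro T ⟨X, Y, f, hf, c, ⟨e⟩⟩
    refine mem_distTriangles_of_iso ((shFunctor k B r).mapTriangle.mapIso e) ?_
    -- The image of the cone of `f` is itself a cone of the shifted morphism, so only the third map
    -- has to be compared, across the isomorphism `Σ^r (X[1]) ≅ (Σ^r X)[1]`.
    refine mk_mem_distTriangles (shMap_mem r hf) (shCone r c) (Iso.refl _) _ _
      (shFunctor_map r hf) (Category.comp_id _) ?_
    refine Eq.trans ?_ (Category.id_comp _).symm
    exact H0.homMk_congr (hf := comp_mem_cycles (add_zero 0) (shTr_mem _ _ _)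
      (shMap_mem r c.projTr_mem)) (hg := (shCone r c).projTr_mem) (by simp [shCone])

variable (k) in
/-- The canonical morphism `Σ^s Σ^r X → Σ^(r+s) X`. -/
def shAdd (r s : ℝ) (X : B) : hom k (sh k s (sh k r X)) (sh k (r + s) X) 0 :=
  comp (add_zero 0) (toSh (r + s) X) (comp (add_zero 0) (ofSh r X) (ofSh s (sh k r X)))

@[simp]
lemma act_shAdd (r s : ℝ) (X : B) : act (shAdd k r s X) =
    act (ofSh s (sh k r X)) ≫ act (ofSh r X) ≫ act (toSh (r + s) X) := by
  simp [shAdd]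

lemma shAdd_mem (r s : ℝ) (X : B) :
    shAdd k r s X ∈ cycles k (sh k s (sh k r X)) (sh k (r + s) X) 0 :=
  comp_mem_cycles (show (r + s) + -(r + s) = 0 by ring) (toSh_mem _ _)
    (comp_mem_cycles (show -r + -s = -(r + s) by ring) (ofSh_mem _ _) (ofSh_mem _ _))

variable (k) in
/-- The canonical morphism `Σ^r X → Σ^s X`. -/
def shEta (r s : ℝ) (X : B) : hom k (sh k r X) (sh k s X) 0 :=
  comp (add_zero 0) (toSh s X) (ofSh r X)

@[simp]
lemma act_shEta (r s : ℝ) (X : B) : act (shEta k r s X) = act (ofSh r X) ≫ act (toSh s X) := by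
  simp [shEta]

lemma shEta_mem {r s : ℝ} (h : s ≤ r) (X : B) :
    shEta k r s X ∈ cycles k (sh k r X) (sh k s X) 0 :=
  cycles_mono (show s + -r ≤ 0 by linarith) (comp_mem_cycles rfl (toSh_mem _ _) (ofSh_mem _ _))

/-- On the level of morphisms η^A_r is the canonical isomorphism from Σ^r A to A, lowered to level
0. Its inverse `toSh` has level `r` only, so the identity of the cone bounds at level `r`. -/
lemma exists_acyclic (r : ℝ) (hr : 0 ≤ r) (A : Level0 k (H0 k B)) :
    ∃ (K : Level0 k (H0 k B)) (g : A ⟶ K)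
      (h : K ⟶ (CategoryTheory.shiftFunctor (Level0 k (H0 k B)) (1 : ℤ)).obj
        ((shFunctor k B r).obj A)),
      Triangle.mk ((shiftData k B).shiftFunctor.ηA r hr A) g h ∈ distTriang (Level0 k (H0 k B)) ∧
      PersistenceCategory.IsAcyclic k r hr K.obj := by
  let X : B := A.obj.obj
  have hm : comp (add_zero 0) (ofSh 0 X) (shEta k r 0 X) ∈ cycles k (sh k r X) X 0 :=
    comp_mem_cycles (add_zero 0) (cycles_mono neg_zero.le (ofSh_mem 0 X)) (shEta_mem hr X)
  obtain ⟨c⟩ := exists_cone _ hm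
  -- The representative passes through `Σ^0 X`; the pair `toSh 0`, `ofSh 0` cancels, so the operator
  -- is that of `ofSh r`.
  have hη : (shiftData k B).shiftFunctor.ηA r hr A = H0.homMk _ hm := rfl
  refine ⟨⟨⟨c.pt⟩⟩, H0.homMk c.incl c.incl_mem, c.projMor, ?_, ?_⟩
  · rw [hη]
    exact triangle_mem hm c
  · exact H0Hom.mk_eq (cycles_mono hr (id_mem_cycles _)) (zero_mem _) (by
      rw [sub_zero]
      exact c.id_mem_boundaries hm (toSh r X) (toSh_mem r X).2 (by simp) (by simp))

variable (k B) in
/-- The triangulated persistence structure on the degree-`0` cohomology category. -/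
def tpc : TPC k (H0 k B) (shiftData k B).shiftFunctor where
  bijective_biprod_left _ _ D _ hb r := PersistenceCategory.bijective_comp_inl_inr D hb r
  bijective_biprod_right _ _ D _ hb r := PersistenceCategory.bijective_comp_fst_snd D hb r
  commShift := shCommShift
  functor_isTriangulated := shFunctor_isTriangulated
  unit_translate A := H0.homMk_congr
    (hf := comp_mem_cycles (add_zero 0) (shTr_mem _ _ _) (toSh_mem 0 _))
    (hg := trMap_mem 1 (toSh_mem 0 _)) (by simp)
  mul_translate r s A := H0.homMk_congr
    (hf := comp_mem_cycles (add_zero 0) (shTr_mem _ _ _) (shAdd_mem r s _))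
    (hg := comp_mem_cycles (add_zero 0) (comp_mem_cycles (add_zero 0)
      (trMap_mem 1 (shAdd_mem r s _)) (shTr_mem _ _ _)) (shMap_mem s (shTr_mem r 1 _)))
    (by simp)
  η_translate r s h A := H0.homMk_congr
    (hf := comp_mem_cycles (add_zero 0) (shTr_mem _ _ _) (shEta_mem h _))
    (hg := comp_mem_cycles (add_zero 0) (trMap_mem 1 (shEta_mem h _)) (shTr_mem _ _ _))
    (by simp)
  exists_acyclic := exists_acyclic

end ConeStable

end FiltDG

namespace FiltDG

open FilteredDGCategory

/-! ### Twisted complexes -/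

namespace ShiftCompletion

variable (k : Type w) [Field k] {A : Type u} [FilteredDGCategory.{w, v} k A]

/-- The identity of the underlying object, as a morphism `X → X[a]` of degree `-a`. -/
def toTr (a : ℤ) (X : ShiftCompletion A) : hom k X (translate a X) (-a) :=
  degCast k (A := A) (X := X.obj) (Y := X.obj) (show 0 = -a + (X.deg + a) - X.deg by omega)
    (FilteredDGCategory.id X.obj)

/-- The identity of the underlying object, as a morphism `X[a] → X` of degree `a`. -/
def ofTr (a : ℤ) (X : ShiftCompletion A) : hom k (translate a X) X a :=
  degCast k (A := A) (X := X.obj) (Y := X.obj) (show 0 = a + X.deg - (X.deg + a) by omega)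
    (FilteredDGCategory.id X.obj)

variable {k} {X Y Z : ShiftCompletion A} (a : ℤ)

/-- The underlying morphism of `toTr` is an identity of `A`, so composition with it only changes the
degree label. The same reason gives `toTr_comp`, `comp_ofTr` and `ofTr_comp`. -/
lemma comp_toTr {n m : ℤ} (h : n + -a = m) (g : hom k (translate a X) Y n) :
    comp h g (toTr k a X) = degCast k (A := A) (X := X.obj) (Y := Y.obj)
      (show n + Y.deg - (X.deg + a) = m + Y.deg - X.deg by omega) g := by
  subst h
  exact (comp_degCast_right k (A := A) _ (show n + Y.deg - (X.deg + a) = _ by omega) _ _ _).trans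
    (congrArg _ (FilteredDGCategory.comp_id (A := A) (X := X.obj) (Y := Y.obj) g))

lemma toTr_comp {n m : ℤ} (h : -a + n = m) (f : hom k X Y n) :
    comp h (toTr k a Y) f = degCast k (A := A) (X := X.obj) (Y := Y.obj)
      (show n + Y.deg - X.deg = m + (Y.deg + a) - X.deg by omega) f := by
  subst h
  exact (comp_degCast_left k (A := A) _
    (show n + Y.deg - X.deg = -a + n + (Y.deg + a) - X.deg by omega) _ _ _).trans
    (congrArg _ (FilteredDGCategory.id_comp (A := A) (X := X.obj) (Y := Y.obj) f))

lemma comp_ofTr {n m : ℤ} (h : n + a = m) (g : hom k X Y n) :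
    comp h g (ofTr k a X) = homTranslateLeft k a h g := by
  subst h
  exact (comp_degCast_right k (A := A) _
    (show n + Y.deg - X.deg = n + a + Y.deg - (X.deg + a) by omega) _ _ _).trans
    (congrArg _ (FilteredDGCategory.comp_id (A := A) (X := X.obj) (Y := Y.obj) g))

lemma ofTr_comp {n m : ℤ} (h : a + n = m) (f : hom k X (translate a Y) n) :
    comp h (ofTr k a Y) f = degCast k (A := A) (X := X.obj) (Y := Y.obj)
      (show n + (Y.deg + a) - X.deg = m + Y.deg - X.deg by omega) f := by
  subst h
  exact (comp_degCast_left k (A := A) _ (show n + (Y.deg + a) - X.deg = _ by omega) _ _ _).trans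
    (congrArg _ (FilteredDGCategory.id_comp (A := A) (X := X.obj) (Y := Y.obj) f))

lemma toTr_ofTr {m : ℤ} (h : -a + a = m) :
    comp h (toTr k a X) (ofTr k a X) =
      degCast k (show 0 = m by omega) (FilteredDGCategory.id (translate a X)) := by
  obtain rfl : m = 0 := by omega
  exact (comp_ofTr a _ _).trans (degCast_degCast k (A := A) _ _ _)

lemma ofTr_toTr {m : ℤ} (h : a + -a = m) :
    comp h (ofTr k a X) (toTr k a X) =
      degCast k (show 0 = m by omega) (FilteredDGCategory.id X) := by
  obtain rfl : m = 0 := by omega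
  exact (comp_toTr a _ _).trans (degCast_degCast k (A := A) _ _ _)

/-- No sign occurs, since `f` and `f[a]` have the same underlying morphism; the signs of the
translation are all carried by the differentials. -/
lemma homTranslate_comp_toTr {n m : ℤ} (h : n + -a = m) (h' : -a + n = m) (f : hom k X Y n) :
    comp h (homTranslate k a n f) (toTr k a X) = comp h' (toTr k a Y) f :=
  (comp_toTr a h _).trans ((degCast_degCast k (A := A) _ _ _).trans (toTr_comp a h' f).symm)

lemma ofTr_comp_homTranslate {n m : ℤ} (h : a + n = m) (h' : n + a = m) (f : hom k X Y n) :
    comp h (ofTr k a Y) (homTranslate k a n f) = comp h' f (ofTr k a X) :=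
  (ofTr_comp a h _).trans ((degCast_degCast k (A := A) _ _ _).trans (comp_ofTr a h' f).symm)

/-- The differential is a sign times that of an identity of `A`, hence zero whatever the sign is. -/
lemma d_toTr (m : ℤ) : d (-a) m (toTr k a X) = 0 := by
  have e : d (k := k) (A := A) (X := X.obj) (Y := X.obj) (-a + (X.deg + a) - X.deg)
      (m + (X.deg + a) - X.deg) (degCast k (A := A) (by omega) (FilteredDGCategory.id X.obj)) = 0 := by
    rw [d_degCast k _ (rfl : m + (X.deg + a) - X.deg = _), FilteredDGCategory.d_id, map_zero]
  exact (congrArg (fun x => (X.deg + a).negOnePow • x) e).trans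
    (smul_zero (A := hom k (A := A) X.obj X.obj (m + (X.deg + a) - X.deg)) _)

lemma d_ofTr (m : ℤ) : d a m (ofTr k a X) = 0 := by
  have e : d (k := k) (A := A) (X := X.obj) (Y := X.obj) (a + X.deg - (X.deg + a))
      (m + X.deg - (X.deg + a)) (degCast k (A := A) (by omega) (FilteredDGCategory.id X.obj)) = 0 := by
    rw [d_degCast k _ (rfl : m + X.deg - (X.deg + a) = _), FilteredDGCategory.d_id, map_zero]
  exact (congrArg (fun x => X.deg.negOnePow • x) e).trans
    (smul_zero (A := hom k (A := A) X.obj X.obj (m + X.deg - (X.deg + a))) _)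

lemma len_toTr : len (toTr k a X) ≤ 0 := by
  rw [len_def]
  refine (add_le_add_left ((len_degCast k (A := A) _ _).le.trans (len_id_le _)) _).trans ?_
  simp [translate]

lemma len_ofTr : len (ofTr k a X) ≤ 0 := by
  rw [len_def]
  refine (add_le_add_left ((len_degCast k (A := A) _ _).le.trans (len_id_le _)) _).trans ?_
  simp [translate]

end ShiftCompletion

namespace Tw

open ShiftCompletion

variable {k : Type w} [Field k] {A : Type u} [FilteredDGCategory.{w, v} k A] {X Y Z : Tw k A}

variable (k) in
/-- The identity matrix, as a morphism `X → X[a]` of degree `-a`. -/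
def toTr (a : ℤ) (X : Tw k A) : hom k X (translate a X) (-a) := fun i j =>
  comp (add_zero (-a)) (ShiftCompletion.toTr k a (X.obj i)) (Mat.id k X.obj i j)

variable (k) in
/-- The identity matrix, as a morphism `X[a] → X` of degree `a`. -/
def ofTr (a : ℤ) (X : Tw k A) : hom k (translate a X) X a := fun i j =>
  comp (zero_add a) (Mat.id k X.obj i j) (ShiftCompletion.ofTr k a (X.obj j))

lemma comp_assoc_of_add_zero {W W' X Y : ShiftCompletion A} {n m p : ℤ} (h : n + m = p)
    (z : hom k Y W n) (y : hom k X Y m) (x : hom k W' X 0) :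
    comp h z (comp (add_zero m) y x) = comp (add_zero p) (comp h z y) x :=
  (FilteredDGCategory.assoc h (add_zero p) (add_zero m) h z y x).symm

/-- The identity matrix inside `toTr` collapses the sum over the intermediate index; the three
companions below hold for the same reason. -/
lemma comp_toTr_apply (a : ℤ) {n m : ℤ} (h : n + -a = m) (g : hom k (translate a X) Y n)
    (i : Fin Y.size) (j : Fin X.size) :
    comp h g (toTr k a X) i j = comp h (g i j) (ShiftCompletion.toTr k a (X.obj j)) := by
  have e := sum_comp_id (k := k) (fun l => comp h (g i l) (ShiftCompletion.toTr k a (X.obj l))) j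
  rw [comp_apply]
  refine Eq.trans ?_ e
  refine Finset.sum_congr rfl fun l _ => ?_
  exact comp_assoc_of_add_zero h (g i l) (ShiftCompletion.toTr k a (X.obj l)) (Mat.id k X.obj l j)

lemma comp_ofTr_apply (a : ℤ) {n m : ℤ} (h : n + a = m) (g : hom k X Y n)
    (i : Fin Y.size) (j : Fin X.size) :
    comp h g (ofTr k a X) i j = comp h (g i j) (ShiftCompletion.ofTr k a (X.obj j)) := by
  have e : ∑ l, comp h (g i l) (comp (zero_add a) (Mat.id k X.obj l j)
      (ShiftCompletion.ofTr k a (X.obj j))) = comp h (g i j) (ShiftCompletion.ofTr k a (X.obj j)) := by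
    rw [← sum_comp_id (fun l => g i l) j, map_sum, LinearMap.sum_apply]
    exact Finset.sum_congr rfl fun l _ => (FilteredDGCategory.assoc _ _ _ _ _ _ _).symm
  exact e

lemma toTr_comp_apply (a : ℤ) {n m : ℤ} (h : -a + n = m) (f : hom k X Y n)
    (i : Fin Y.size) (j : Fin X.size) :
    comp h (toTr k a Y) f i j = comp h (ShiftCompletion.toTr k a (Y.obj i)) (f i j) := by
  have e : ∑ l, comp h (comp (add_zero (-a)) (ShiftCompletion.toTr k a (Y.obj i))
      (Mat.id k Y.obj i l)) (f l j) = comp h (ShiftCompletion.toTr k a (Y.obj i)) (f i j) := by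
    rw [← sum_id_comp (fun l => f l j) i, map_sum]
    exact Finset.sum_congr rfl fun l _ => FilteredDGCategory.assoc _ _ _ _ _ _ _
  exact e

lemma ofTr_comp_apply (a : ℤ) {n m : ℤ} (h : a + n = m) (f : hom k X (translate a Y) n)
    (i : Fin Y.size) (j : Fin X.size) :
    comp h (ofTr k a Y) f i j = comp h (ShiftCompletion.ofTr k a (Y.obj i)) (f i j) := by
  have e := sum_id_comp (k := k) (fun l => comp h (ShiftCompletion.ofTr k a (Y.obj l)) (f l j)) i
  rw [comp_apply]
  refine Eq.trans ?_ e
  refine Finset.sum_congr rfl fun l _ => ?_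
  exact FilteredDGCategory.assoc (zero_add a) h h (zero_add m)
    (Mat.id k Y.obj i l) (ShiftCompletion.ofTr k a (Y.obj l)) (f l j)

lemma ofTr_toTr (a : ℤ) (X : Tw k A) :
    comp (add_neg_cancel a) (ofTr k a X) (toTr k a X) = FilteredDGCategory.id X := by
  funext i j
  refine (ofTr_comp_apply a (add_neg_cancel a) (toTr k a X) i j).trans ?_
  refine (FilteredDGCategory.assoc (add_neg_cancel a) (add_zero 0) (add_zero (-a))
    (add_neg_cancel a) (ShiftCompletion.ofTr k a (X.obj i)) (ShiftCompletion.toTr k a (X.obj i))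
    (Mat.id k X.obj i j)).symm.trans ?_
  rw [ShiftCompletion.ofTr_toTr]
  exact FilteredDGCategory.id_comp (k := k) (Mat.id k X.obj i j)

lemma toTr_ofTr (a : ℤ) (X : Tw k A) :
    comp (neg_add_cancel a) (toTr k a X) (ofTr k a X) = FilteredDGCategory.id (translate a X) := by
  rw [← homTranslate_id]
  funext i j
  refine (toTr_comp_apply a (neg_add_cancel a) (ofTr k a X) i j).trans ?_
  refine Eq.trans ?_ ((degCast_self k rfl _).trans rfl :
    degCast k rfl (ShiftCompletion.homTranslate k a 0 (Mat.id k X.obj i j)) = _)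
  change comp (neg_add_cancel a) (ShiftCompletion.toTr k a (X.obj i)) (comp (zero_add a)
    (Mat.id k X.obj i j) (ShiftCompletion.ofTr k a (X.obj j))) = _
  -- The entry of the identity matrix is moved across `ofTr`, so that `toTr` and `ofTr` become
  -- adjacent and cancel.
  rw [← ofTr_comp_homTranslate a (add_zero a) (zero_add a),
    ← FilteredDGCategory.assoc (neg_add_cancel a) (add_zero 0), ShiftCompletion.toTr_ofTr]
  exact FilteredDGCategory.id_comp (k := k) _

lemma len_toTr (a : ℤ) (X : Tw k A) : len (toTr k a X) ≤ 0 :=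
  (Mat.len_le_iff _ _).2 fun i j => len_comp_le_zero _ (ShiftCompletion.len_toTr a)
    (len_id_apply_le X.obj i j)

lemma len_ofTr (a : ℤ) (X : Tw k A) : len (ofTr k a X) ≤ 0 :=
  (Mat.len_le_iff _ _).2 fun i j => len_comp_le_zero _ (len_id_apply_le X.obj i j)
    (ShiftCompletion.len_ofTr a)

lemma d_id_comp {W : ShiftCompletion A} {I : Type*} [DecidableEq I] (Z : I → ShiftCompletion A)
    {n m : ℤ} (i j : I) (f : hom k W (Z j) n) (hf : d n m f = 0) :
    d n m (comp (zero_add n) (Mat.id k Z i j) f) = 0 := by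
  rcases eq_or_ne j i with rfl | h
  · rw [Mat.id_self, FilteredDGCategory.id_comp, hf]
  · rw [Mat.id_of_ne h]; simp

lemma d_comp_id {W : ShiftCompletion A} {I : Type*} [DecidableEq I] (Z : I → ShiftCompletion A)
    {n m : ℤ} (i j : I) (f : hom k (Z i) W n) (hf : d n m f = 0) :
    d n m (comp (add_zero n) f (Mat.id k Z i j)) = 0 := by
  rcases eq_or_ne j i with rfl | h
  · rw [Mat.id_self, FilteredDGCategory.comp_id, hf]
  · rw [Mat.id_of_ne h]; simp

lemma sub_units_smul_eq_zero {M : Type*} [AddCommGroup M] {x y z w : M} {u u' : ℤˣ} (hx : x = 0)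
    (hy : y = u • w) (hz : z = w) (hu : u' = u) : x + y - u' • z = 0 := by
  rw [hx, hy, hz, hu, zero_add, sub_self]

lemma map_units_smul {R M N : Type*} [Ring R] [AddCommGroup M] [AddCommGroup N] [Module R M]
    [Module R N] (f : M →ₗ[R] N) (u : ℤˣ) (x : M) : f (u • x) = u • f x := by
  rw [Units.smul_def, map_zsmul, Units.smul_def]

/-- The matrix of `X[a]` is `(-1)^a q`, so multiplying it with `toTr` gives `(-1)^a` times the
product of `toTr` with `q`. The other term of the differential carries the sign of the degree `-a`,
and the two cancel. -/
lemma d_toTr (a : ℤ) (X : Tw k A) : d (-a) (-a + 1) (toTr k a X) = 0 := by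
  rw [d_eq (-a) (-a + 1) rfl]
  funext i j
  have e₁ : d (k := k) (-a) (-a + 1) (toTr k a X i j) = 0 :=
    d_comp_id X.obj i j _ (ShiftCompletion.d_toTr a _)
  have e₂ := comp_toTr_apply a (show 1 + -a = -a + 1 by omega) (translate a X).q i j
  have e₃ := toTr_comp_apply a (rfl : -a + 1 = -a + 1) X.q i j
  have e₄ : comp (show 1 + -a = -a + 1 by omega) ((translate a X).q i j)
      (ShiftCompletion.toTr k a (X.obj j)) =
    a.negOnePow • comp rfl (ShiftCompletion.toTr k a (X.obj i)) (X.q i j) := by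
    refine (map_units_smul (LinearMap.flip (comp _) _) a.negOnePow _).trans ?_
    exact congrArg _ (homTranslate_comp_toTr a _ _ _)
  exact sub_units_smul_eq_zero e₁ (e₂.trans e₄) e₃ (Int.negOnePow_neg a)

lemma d_ofTr (a : ℤ) (X : Tw k A) : d a (a + 1) (ofTr k a X) = 0 := by
  rw [d_eq a (a + 1) rfl]
  funext i j
  have e₁ : d (k := k) a (a + 1) (ofTr k a X i j) = 0 :=
    d_id_comp X.obj i j _ (ShiftCompletion.d_ofTr a _)
  have e₂ := comp_ofTr_apply a (show 1 + a = a + 1 by omega) X.q i j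
  have e₃ := ofTr_comp_apply a (rfl : a + 1 = a + 1) (translate a X).q i j
  have e₄ : comp rfl (ShiftCompletion.ofTr k a (X.obj i)) ((translate a X).q i j) =
    a.negOnePow • comp (show 1 + a = a + 1 by omega) (X.q i j)
      (ShiftCompletion.ofTr k a (X.obj j)) := by
    refine (map_units_smul _ a.negOnePow _).trans ?_
    exact congrArg _ (ofTr_comp_homTranslate a _ _ _)
  -- Here the sign sits on the second product; multiplying by `(-1)^a` twice moves it to the first.
  refine sub_units_smul_eq_zero e₁ (e₂.trans ?_) (e₃.trans e₄) rfl
  exact ((smul_smul _ _ _).trans ((congrArg (fun x => x • _) (Int.units_mul_self _)).trans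
    (one_smul _ _))).symm

end Tw

end FiltDG

/-! ### Cones of twisted complexes. -/

namespace FiltDG

open FilteredDGCategory

namespace Tw

open ShiftCompletion

variable {k : Type w} [Field k] {A : Type u} [FilteredDGCategory.{w, v} k A] {X Y Z : Tw k A}

/-- The projection `cone f → Y`. -/
def coneRet (f : hom k X Y 0) (hf : f ∈ cycles k X Y 0) : hom k (cone f hf) Y 0 :=
  fun i j => Mat.id k (coneObj X Y) (Sum.inl i) (finSumFinEquiv.symm j)

/-- The inclusion `X[1] → cone f`. -/
def coneSec (f : hom k X Y 0) (hf : f ∈ cycles k X Y 0) : hom k (translate 1 X) (cone f hf) 0 :=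
  fun i j => Mat.id k (coneObj X Y) (finSumFinEquiv.symm i) (Sum.inr j)

/-- The morphism `f`, as a morphism `X[1] → Y` of degree `1`. -/
def homLeft (f : hom k X Y 0) : hom k (translate 1 X) Y 1 := fun i j =>
  ShiftCompletion.homTranslateLeft k 1 (zero_add 1) (f i j)

/-- This relates the off-diagonal block of the cone matrix to `f` and the canonical morphism `X[1] →
X`, as needed for `ConeData`. -/
lemma homLeft_eq (f : hom k X Y 0) : homLeft f = comp (zero_add 1) f (ofTr k 1 X) := by
  funext i j
  exact ((comp_ofTr_apply 1 (zero_add 1) f i j).trans (ShiftCompletion.comp_ofTr 1 _ _)).symm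

lemma sum_comp_coneSec {W : ShiftCompletion A} {n : ℤ}
    (g : ∀ l, hom k (coneObj X Y l) W n) (b : Fin Y.size ⊕ Fin X.size) :
    ∑ l : Fin (Y.size + X.size), comp (add_zero n) (g (finSumFinEquiv.symm l))
      (Mat.id k (coneObj X Y) (finSumFinEquiv.symm l) b) = g b := by
  rw [Equiv.sum_comp finSumFinEquiv.symm fun l => comp (add_zero n) (g l)
    (Mat.id k (coneObj X Y) l b)]
  exact sum_comp_id (fun l => g l) b

lemma sum_coneRet_comp {W : ShiftCompletion A} {n : ℤ}
    (g : ∀ l, hom k W (coneObj X Y l) n) (a : Fin Y.size ⊕ Fin X.size) :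
    ∑ l : Fin (Y.size + X.size), comp (zero_add n)
      (Mat.id k (coneObj X Y) a (finSumFinEquiv.symm l)) (g (finSumFinEquiv.symm l)) = g a := by
  rw [Equiv.sum_comp finSumFinEquiv.symm fun l => comp (zero_add n)
    (Mat.id k (coneObj X Y) a l) (g l)]
  exact sum_id_comp (fun l => g l) a

lemma coneRet_coneIncl (f : hom k X Y 0) (hf : f ∈ cycles k X Y 0) :
    comp (add_zero 0) (coneRet f hf) (coneIncl f hf) = FilteredDGCategory.id Y := by
  funext i j
  refine (sum_comp_coneSec (fun l => Mat.id k (coneObj X Y) (Sum.inl i) l) (Sum.inl j)).trans ?_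
  rcases eq_or_ne j i with rfl | h
  · exact (Mat.id_self _).trans (Mat.id_self (X := Y.obj) j).symm
  · exact (Mat.id_of_ne (by simpa using h)).trans (Mat.id_of_ne (X := Y.obj) h).symm

lemma coneProj_coneSec (f : hom k X Y 0) (hf : f ∈ cycles k X Y 0) :
    comp (add_zero 0) (coneProj f hf) (coneSec f hf) = FilteredDGCategory.id (translate 1 X) := by
  funext i j
  refine (sum_comp_coneSec (fun l => Mat.id k (coneObj X Y) (Sum.inr i) l) (Sum.inr j)).trans ?_
  by_cases h : j = i
  · subst h
    exact (Mat.id_self _).trans (Mat.id_self (X := (translate 1 X).obj) j).symm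
  · exact (Mat.id_of_ne (fun e => h (Sum.inr.inj e))).trans
      (Mat.id_of_ne (X := (translate 1 X).obj) h).symm

lemma coneProj_coneIncl (f : hom k X Y 0) (hf : f ∈ cycles k X Y 0) :
    comp (add_zero 0) (coneProj f hf) (coneIncl f hf) = 0 := by
  funext i j
  refine (sum_comp_coneSec (fun l => Mat.id k (coneObj X Y) (Sum.inr i) l) (Sum.inl j)).trans ?_
  exact Mat.id_of_ne Sum.inl_ne_inr

lemma coneRet_coneSec (f : hom k X Y 0) (hf : f ∈ cycles k X Y 0) :
    comp (add_zero 0) (coneRet f hf) (coneSec f hf) = 0 := by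
  funext i j
  refine (sum_comp_coneSec (fun l => Mat.id k (coneObj X Y) (Sum.inl i) l) (Sum.inr j)).trans ?_
  exact Mat.id_of_ne Sum.inr_ne_inl

lemma cone_total (f : hom k X Y 0) (hf : f ∈ cycles k X Y 0) :
    comp (add_zero 0) (coneIncl f hf) (coneRet f hf) +
      comp (add_zero 0) (coneSec f hf) (coneProj f hf) = FilteredDGCategory.id (cone f hf) := by
  funext i j
  have e (a b : Fin Y.size ⊕ Fin X.size) :
      ∑ l, comp (add_zero 0) (Mat.id k (coneObj X Y) a (Sum.inl l))
        (Mat.id k (coneObj X Y) (Sum.inl l) b) +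
      ∑ l, comp (add_zero 0) (Mat.id k (coneObj X Y) a (Sum.inr l))
        (Mat.id k (coneObj X Y) (Sum.inr l) b) = Mat.id k (coneObj X Y) a b := by
    rw [← sum_comp_id (fun l => Mat.id k (coneObj X Y) a l) b, Fintype.sum_sum_type]
  refine (e _ _).trans ?_
  by_cases h : j = i
  · subst h
    exact (Mat.id_self _).trans (Mat.id_self (X := (cone f hf).obj) j).symm
  · exact (Mat.id_of_ne (fun e => h (finSumFinEquiv.symm.injective e))).trans
      (Mat.id_of_ne (X := (cone f hf).obj) h).symm

/-- Multiplication by the retraction extracts the first block row `(q_Y, f)` of the cone matrix. Its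
part `q_Y` cancels against the matrix of the target, and the block `f` is left with a minus sign. -/
lemma d_coneRet (f : hom k X Y 0) (hf : f ∈ cycles k X Y 0) :
    d 0 1 (coneRet f hf) = -comp (add_zero 1) (homLeft f) (coneProj f hf) := by
  have e (i : Fin Y.size) (b : Fin Y.size ⊕ Fin X.size) :
      d (k := k) 0 1 (Mat.id k (coneObj X Y) (Sum.inl i) b) +
        ∑ l : Fin Y.size, comp (add_zero 1) (coneQ f (Sum.inl i) (Sum.inl l))
          (Mat.id k (coneObj X Y) (Sum.inl l) b) -
        (0 : ℤ).negOnePow • ∑ l : Fin (Y.size + X.size),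
          comp (zero_add 1) (Mat.id k (coneObj X Y) (Sum.inl i) (finSumFinEquiv.symm l))
            (coneQ f (finSumFinEquiv.symm l) b) =
      -∑ l : Fin X.size, comp (add_zero 1) (coneQ f (Sum.inl i) (Sum.inr l))
        (Mat.id k (coneObj X Y) (Sum.inr l) b) := by
    have h := sum_comp_id (fun l => coneQ f (Sum.inl i) l) b
    rw [Fintype.sum_sum_type] at h
    rw [sum_coneRet_comp (fun l => coneQ f l b) (Sum.inl i), d_id_apply, Int.negOnePow_zero,
      one_smul, zero_add, ← h, sub_add_cancel_left]
  rw [d_eq 0 1 (zero_add 1)]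
  funext i j
  exact e i (finSumFinEquiv.symm j)

/-- Dually, the section extracts the second block column; the matrix of `X[1]` cancels and the block
`f` is left. -/
lemma d_coneSec (f : hom k X Y 0) (hf : f ∈ cycles k X Y 0) :
    d 0 1 (coneSec f hf) = comp (zero_add 1) (coneIncl f hf) (homLeft f) := by
  have e (a : Fin Y.size ⊕ Fin X.size) (j : Fin X.size) :
      d (k := k) 0 1 (Mat.id k (coneObj X Y) a (Sum.inr j)) +
        ∑ l : Fin (Y.size + X.size), comp (add_zero 1) (coneQ f a (finSumFinEquiv.symm l))
          (Mat.id k (coneObj X Y) (finSumFinEquiv.symm l) (Sum.inr j)) -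
        (0 : ℤ).negOnePow • ∑ l : Fin X.size,
          comp (zero_add 1) (Mat.id k (coneObj X Y) a (Sum.inr l))
            (coneQ f (Sum.inr l) (Sum.inr j)) =
      ∑ l : Fin Y.size, comp (zero_add 1) (Mat.id k (coneObj X Y) a (Sum.inl l))
        (coneQ f (Sum.inl l) (Sum.inr j)) := by
    have h := sum_id_comp (fun l => coneQ f l (Sum.inr j)) a
    rw [Fintype.sum_sum_type] at h
    rw [sum_comp_coneSec (fun l => coneQ f a l) (Sum.inr j), d_id_apply, Int.negOnePow_zero,
      one_smul, zero_add, ← h, add_sub_cancel_right]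
  rw [d_eq 0 1 (zero_add 1)]
  funext i j
  exact e (finSumFinEquiv.symm i) j

lemma len_coneRet (f : hom k X Y 0) (hf : f ∈ cycles k X Y 0) : len (coneRet f hf) ≤ 0 :=
  (Mat.len_le_iff _ _).2 fun _ _ => len_id_apply_le (coneObj X Y) _ _

lemma len_coneSec (f : hom k X Y 0) (hf : f ∈ cycles k X Y 0) : len (coneSec f hf) ≤ 0 :=
  (Mat.len_le_iff _ _).2 fun _ _ => len_id_apply_le (coneObj X Y) _ _

lemma act_toTr_ofTr (a : ℤ) (X : Tw k A) : act (toTr k a X) ≫ act (ofTr k a X) = 𝟙 _ := by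
  rw [← act_comp (add_neg_cancel a), ofTr_toTr, act_id]

lemma act_ofTr_toTr (a : ℤ) (X : Tw k A) : act (ofTr k a X) ≫ act (toTr k a X) = 𝟙 _ := by
  rw [← act_comp (neg_add_cancel a), toTr_ofTr, act_id]

/-- The cone of a morphism of twisted complexes. -/
def coneData (f : hom k X Y 0) (hf : f ∈ cycles k X Y 0) : ConeData f where
  pt := cone f hf
  incl := coneIncl f hf
  ret := coneRet f hf
  sec := comp (zero_add (-1)) (coneSec f hf) (toTr k 1 X)
  proj := comp (add_zero 1) (ofTr k 1 X) (coneProj f hf)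
  d_incl := (coneIncl_mem f hf).1
  d_ret := by
    rw [d_coneRet, homLeft_eq, FilteredDGCategory.assoc _ _ (add_zero 1) (zero_add 1)]
  d_sec := by
    rw [d_comp (zero_add (-1)) (zero_add 1) (neg_add_cancel 1) (neg_add_cancel 1)
      (add_neg_cancel 1) (add_zero 0), d_coneSec, show d (-1) 0 (toTr k 1 X) = 0 from d_toTr 1 X, homLeft_eq, map_zero, smul_zero, add_zero,
      FilteredDGCategory.assoc _ _ (add_neg_cancel 1) (add_zero 0),
      FilteredDGCategory.assoc _ _ (add_neg_cancel 1) (add_zero 0), ofTr_toTr,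
      FilteredDGCategory.comp_id]
  d_proj := by
    rw [d_comp (add_zero 1) one_add_one_eq_two (zero_add 1) one_add_one_eq_two
      (add_zero 2) one_add_one_eq_two, show d 0 1 (coneProj f hf) = 0 from (coneProj_mem f hf).1,
      show d 1 2 (ofTr k 1 X) = 0 from d_ofTr 1 X]
    simp
  len_incl := (coneIncl_mem f hf).2
  len_ret := len_coneRet f hf
  len_sec := len_comp_le_zero _ (len_coneSec f hf) (len_toTr 1 X)
  len_proj := len_comp_le_zero _ (len_ofTr 1 X) (coneProj_mem f hf).2
  ret_incl := coneRet_coneIncl f hf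
  proj_sec := by
    rw [FilteredDGCategory.assoc _ _ (zero_add (-1)) (add_neg_cancel 1),
      ← FilteredDGCategory.assoc (add_zero 0) (zero_add (-1)), coneProj_coneSec,
      FilteredDGCategory.id_comp, ofTr_toTr]
  proj_incl := by
    rw [FilteredDGCategory.assoc _ _ (add_zero 0) (add_zero 1), coneProj_coneIncl, map_zero]
  ret_sec := by
    rw [← FilteredDGCategory.assoc (add_zero 0) (zero_add (-1)), coneRet_coneSec, map_zero,
      LinearMap.zero_apply]
  total := by
    rw [← cone_total f hf, FilteredDGCategory.assoc _ _ (neg_add_cancel 1) (zero_add 0),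
      ← FilteredDGCategory.assoc (neg_add_cancel 1) (zero_add 0), toTr_ofTr,
      FilteredDGCategory.id_comp]

/-- The empty twisted complex. -/
def empty : Tw k A where
  size := 0
  obj i := i.elim0
  q i := i.elim0
  q_eq_zero i := i.elim0
  d_q i := i.elim0
  len_q_le i := i.elim0

instance coneStable : ConeStable k (Tw k A) where
  sh := shiftBy
  toSh := toShift
  ofSh := fromShift
  toSh_mem := toShift_mem
  ofSh_mem := fromShift_mem
  ofSh_toSh _ X := FilteredDGCategory.id_comp (k := k) (FilteredDGCategory.id X)
  toSh_ofSh _ X := FilteredDGCategory.id_comp (k := k) (FilteredDGCategory.id X)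
  tr := translate
  toTr := toTr k
  ofTr := ofTr k
  d_toTr := d_toTr
  d_ofTr := d_ofTr
  len_toTr := len_toTr
  len_ofTr := len_ofTr
  ofTr_toTr := ofTr_toTr
  toTr_ofTr := toTr_ofTr
  exists_zero := ⟨empty, funext fun i => i.elim0⟩
  exists_cone f hf := ⟨coneData f hf⟩

/-- The triangulated persistence structure on the degree-`0` cohomology of twisted complexes. -/
def tpc : TPC k (H0 k (Tw k A)) (Tw.shiftFunctor k A) := ConeStable.tpc k (Tw k A)

end Tw

end FiltDG

/-! ### Uniqueness of cones; standard triangles and strictness for twisted complexes. -/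

namespace FiltDG

open FilteredDGCategory

namespace ConeData

variable {k : Type w} [Field k] {B : Type u} [FilteredDGCategory.{w, v} k B]
  {X Y : B} {f : hom k X Y 0}

/-- The canonical morphism between two cones of the same morphism. -/
def compare (c c' : ConeData f) : hom k c.pt c'.pt 0 :=
  comp (add_zero 0) c'.incl c.ret + comp (neg_add_cancel 1) c'.sec c.proj

@[simp]
lemma act_compare (c c' : ConeData f) :
    act (c.compare c') = act c.ret ≫ act c'.incl + act c.proj ≫ act c'.sec := by
  simp [compare]

lemma compare_mem (c c' : ConeData f) : c.compare c' ∈ cycles k c.pt c'.pt 0 :=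
  mem_cycles_iff.2 ⟨by simp [c'.incl_dOp, c.ret_dOp_assoc, c'.sec_dOp, c.proj_dOp_assoc]; abel,
    len_add_le_zero (len_comp_le_zero _ c'.len_incl c.len_ret)
      (len_comp_le_zero _ c'.len_sec c.len_proj)⟩

/-- Two cones of the same morphism are isomorphic. -/
def ptIso (c c' : ConeData f) :
    (⟨⟨c.pt⟩⟩ : Level0 k (H0 k B)) ≅ ⟨⟨c'.pt⟩⟩ :=
  H0.isoMk (c.compare c') (compare_mem _ _) (c'.compare c) (compare_mem _ _) (by simp) (by simp)

variable [ConeStable k B]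

/-- Two cones of the same morphism give isomorphic triangles. -/
def triangleIso (c c' : ConeData f) (hf : f ∈ cycles k X Y 0) : c.triangle hf ≅ c'.triangle hf :=
  Triangle.isoMk _ _ (Iso.refl _) (Iso.refl _) (ptIso c c')
    ((Category.comp_id _).trans (Category.id_comp _).symm)
    ((H0.homMk_congr (hf := comp_mem_cycles (add_zero 0) (compare_mem _ _) c.incl_mem)
      (hg := c'.incl_mem) (by simp)).trans (Category.id_comp _).symm)
    (by
      refine Eq.trans ?_ (H0.homMk_congr (hf := c.projTr_mem)
        (hg := comp_mem_cycles (add_zero 0) c'.projTr_mem (compare_mem c c')) (by simp))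
      refine (congrArg (fun x => c.projMor ≫ x) ?_).trans (Category.comp_id _)
      exact (shiftFunctor (Level0 k (H0 k B)) (1 : ℤ)).map_id _)

end ConeData

namespace Tw

open ShiftCompletion

variable {k : Type w} [Field k] {A : Type u} [FilteredDGCategory.{w, v} k A] {X Y Z : Tw k A}

/-- Conjugation by `toTr` and `ofTr` merely relabels the degrees of the entries. Hence the
translation obtained from cone stability is the one given by the matrices `f[n]`. -/
lemma trMap_eq (n m : ℤ) (f : hom k X Y m) :
    ConeStable.trMap n X Y m f = homTranslate n X Y m f := by
  funext i j
  refine (toTr_comp_apply (X := translate n X) (Y := Y) n (show -n + (m + n) = m by omega)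
    (comp rfl f (ofTr k n X)) i j).trans ?_
  refine (congrArg _ ((comp_ofTr_apply n rfl f i j).trans (ShiftCompletion.comp_ofTr n rfl _))).trans
    ((ShiftCompletion.toTr_comp n (show -n + (m + n) = m by omega) _).trans ?_)
  exact degCast_degCast k (A := A) _ _ _

lemma shiftFunctor_eq (n : ℤ) : CategoryTheory.shiftFunctor (Level0 k (H0 k (Tw k A))) n =
    (translation k A n).level0 := by
  refine CategoryTheory.Functor.hext (fun _ => rfl) fun X Y φ => ?_
  obtain ⟨f, hf, rfl⟩ := H0.exists_homMk φ
  -- The two functors agree definitionally on objects, so only an ordinary equality of classes is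
  -- left.
  exact heq_of_eq (congrArg Submodule.Quotient.mk (Subtype.ext (trMap_eq n 0 f)))

/-- The projection was lowered along `X[1] → X` to fit into `ConeData` and is raised back along `X →
X[1]`; the two canonical morphisms cancel. -/
lemma coneData_projMor (f : hom k X Y 0) (hf : f ∈ cycles k X Y 0) :
    (coneData f hf).projMor = H0.homMk (coneProj f hf) (coneProj_mem f hf) :=
  H0.homMk_congr (hf := (coneData f hf).projTr_mem) (by
    rw [ConeData.act_projTr]
    change act (comp (add_zero 1) (ofTr k 1 X) (coneProj f hf)) ≫ act (toTr k 1 X) = _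
    rw [act_comp, Category.assoc, act_ofTr_toTr, Category.comp_id]
    rfl)

/-- Exactness was defined with arbitrary cone data. By uniqueness of cones each such triangle is
isomorphic to the one of the standard cone. -/
lemma tpc_isConeTPC : IsConeTPC (tpc (k := k) (A := A)) := by
  refine ⟨shiftFunctor_eq, fun T => ⟨?_, ?_⟩⟩
  · rintro ⟨X, Y, f, hf, c, ⟨e⟩⟩
    refine ⟨X, Y, f, hf, ⟨e ≪≫ c.triangleIso (coneData f hf) hf ≪≫ eqToIso ?_⟩⟩
    exact congrArg (Triangle.mk (H0.homMk f hf) (H0.homMk (coneIncl f hf) (coneIncl_mem f hf)))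
      ((coneData_projMor f hf).trans (Category.comp_id _).symm)
  · rintro ⟨X, Y, f, hf, ⟨e⟩⟩
    refine ⟨X, Y, f, hf, coneData f hf, ⟨e ≪≫ eqToIso ?_⟩⟩
    exact congrArg (Triangle.mk (H0.homMk f hf) (H0.homMk (coneIncl f hf) (coneIncl_mem f hf)))
      ((coneData_projMor f hf).trans (Category.comp_id _).symm).symm

/-- The twisted complex with the same objects and matrix as `X` but other filtration shifts. -/
def reshift (X : Tw k A) (s : Fin X.size → ℝ)
    (h : ∀ i j, len (k := k) (A := ShiftCompletion A) (X := (⟨(X.obj j).obj, s j, (X.obj j).deg⟩ : ShiftCompletion A))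
      (Y := ⟨(X.obj i).obj, s i, (X.obj i).deg⟩) (n := 1) (X.q i j) ≤ 0) : Tw k A where
  size := X.size
  obj i := ⟨(X.obj i).obj, s i, (X.obj i).deg⟩
  q := X.q
  q_eq_zero := X.q_eq_zero
  d_q := X.d_q
  len_q_le := h

/-- Strictness compares complexes that differ only in real numbers such as `t` and `t + 0`, equal
but not definitionally so. Isolating these numbers as a family permits substitution, after which the
transport is an identity. -/
lemma eqTo_reshift (X : Tw k A) {s s' : Fin X.size → ℝ} (hs : s = s') {h h'}
    (f : hom k (reshift X s h) (reshift X s' h') 0) (hf : f ∈ cycles k _ _ 0)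
    (h_id : f = (FilteredDGCategory.id (k := k) X : hom k X X 0)) :
    ∃ e : (⟨reshift X s h⟩ : H0 k (Tw k A)) = ⟨reshift X s' h'⟩,
      H0Hom.mk f hf = PersistenceCategory.eqTo k e := by
  subst hs
  exact ⟨rfl, congrArg _ (Subtype.ext h_id)⟩

lemma shiftFunctor_isStrict : (Tw.shiftFunctor k A).IsStrict := by
  refine ⟨fun X => ?_, fun r s X => ?_⟩
  · exact eqTo_reshift X.obj (s := fun i => (X.obj.obj i).shift)
      (s' := fun i => (X.obj.obj i).shift + 0) (by simp) (h := X.obj.len_q_le)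
      (h' := (shiftBy 0 X.obj).len_q_le) (toShift 0 X.obj) (toShift_mem 0 X.obj) rfl
  · refine eqTo_reshift X.obj (s := fun i => (X.obj.obj i).shift + r + s)
      (s' := fun i => (X.obj.obj i).shift + (r + s)) (by funext i; ring)
      (h := (shiftBy s (shiftBy r X.obj)).len_q_le)
      (h' := (shiftBy (r + s) X.obj).len_q_le) (ConeStable.shAdd k r s X.obj)
      (ConeStable.shAdd_mem r s X.obj) ?_
    exact (FilteredDGCategory.id_comp (k := k) (X := X.obj) (Y := X.obj) _).trans
      (FilteredDGCategory.id_comp (k := k) (X := X.obj) (Y := X.obj) _)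

lemma mk_eq_mk {n : ℕ} {obj obj' : Fin n → ShiftCompletion A}
    {q : ∀ i j : Fin n, hom k (obj j) (obj i) 1} {q' : ∀ i j : Fin n, hom k (obj' j) (obj' i) 1}
    {h₁ h₂ h₃ h₁' h₂' h₃'} (h : obj = obj') (hq : ∀ i j, HEq (q i j) (q' i j)) :
    (⟨n, obj, q, h₁, h₂, h₃⟩ : Tw k A) = ⟨n, obj', q', h₁', h₂', h₃'⟩ := by
  subst h
  obtain rfl : q = q' := by
    funext i j
    exact eq_of_heq (hq i j)
  rfl

lemma degCast_heq {X Y : A} {n m : ℤ} (h : n = m) (f : hom k X Y n) : HEq (degCast k h f) f := by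
  subst h; rfl

/-- The signs `(-1)^a` and `(-1)^(-a)` on the matrix cancel, and the entries change only in their
degree label. This makes the translation bijective on objects. -/
lemma translate_translate {a b : ℤ} (h : a + b = 0) (X : Tw k A) :
    translate b (translate a X) = X := by
  obtain rfl : b = -a := by omega
  refine mk_eq_mk (funext fun i => ?_) fun i j => ?_
  · exact ShiftCompletion.ext rfl rfl (Int.add_neg_cancel_right _ _)
  · refine HEq.trans (heq_of_eq ?_) (degCast_heq (k := k) (A := A) (X := (X.obj j).obj)
      (Y := (X.obj i).obj) (show 1 + (X.obj i).deg - (X.obj j).deg =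
        1 + ((X.obj i).deg + a + -a) - ((X.obj j).deg + a + -a) by omega) (X.q i j))
    refine (congrArg _ (map_units_smul (ShiftCompletion.homTranslate k (-a) 1) _ _)).trans ?_
    rw [smul_smul, Int.negOnePow_neg, Int.units_mul_self, one_smul]
    exact degCast_degCast k (A := A) _ _ _

/-- The filtration shift keeps the matrix, and `toSh`, `ofSh` are identity matrices. What remains of
the comparison isomorphism is `toTr` composed with `ofTr`. -/
lemma shTr_eq (r : ℝ) (X : Tw k A) : ConeStable.shTr k r 1 X =
    FilteredDGCategory.id (translate 1 (shiftBy r X)) := by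
  refine Eq.trans ?_ (toTr_ofTr 1 (shiftBy r X))
  refine congrArg (comp (neg_add_cancel 1) (toTr k 1 (shiftBy r X))) ?_
  exact (FilteredDGCategory.id_comp (k := k) (X := translate 1 X) (Y := X) _).trans
    (FilteredDGCategory.comp_id (k := k) (X := translate 1 X) (Y := X) _)

lemma tpc_isStrict : (tpc (k := k) (A := A)).IsStrict := by
  refine ⟨shiftFunctor_isStrict, Function.bijective_iff_has_inverse.2
    ⟨fun X => ⟨⟨translate (-1) X.obj.obj⟩⟩, fun X => ?_, fun X => ?_⟩, fun r X => ⟨rfl, ?_⟩⟩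
  · exact congrArg (fun Y => (⟨⟨Y⟩⟩ : Level0 k (H0 k (Tw k A))))
      (translate_translate (add_neg_cancel 1) X.obj.obj)
  · exact congrArg (fun Y => (⟨⟨Y⟩⟩ : Level0 k (H0 k (Tw k A))))
      (translate_translate (neg_add_cancel 1) X.obj.obj)
  · exact congrArg _ (Subtype.ext (shTr_eq r X.obj.obj))

end Tw

end FiltDG

namespace FiltDG

open FilteredDGCategory

/-! ### Transfer along equivalences -/

section

variable {k : Type w} [Field k] {B : Type u} [FilteredDGCategory.{w, v} k B] {X Y Z : B}

/-- A cone transported along an isomorphism. -/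
def ConeData.ofIso {f : hom k X Y 0} (c : ConeData f) {φ : hom k c.pt Z 0} {ψ : hom k Z c.pt 0}
    (hφ : φ ∈ cycles k c.pt Z 0) (hψ : ψ ∈ cycles k Z c.pt 0) (h : act φ ≫ act ψ = 𝟙 _)
    (h' : act ψ ≫ act φ = 𝟙 _) : ConeData f where
  pt := Z
  incl := comp (add_zero 0) φ c.incl
  ret := comp (add_zero 0) c.ret ψ
  sec := comp (zero_add (-1)) φ c.sec
  proj := comp (add_zero 1) c.proj ψ
  d_incl := (closed_iff (zero_add 1) _).2 (by simp [act_comm hφ, c.incl_dOp_assoc])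
  d_ret := act_injective (by
    simp [act_d (zero_add 1), c.ret_dOp, act_comm_assoc hψ])
  d_sec := act_injective (by simp [act_d_neg_one, act_comm hφ, c.sec_dOp_assoc])
  d_proj := (closed_iff one_add_one_eq_two _).2 (by simp [c.proj_dOp, act_comm_assoc hψ])
  len_incl := len_comp_le_zero _ hφ.2 c.len_incl
  len_ret := len_comp_le_zero _ c.len_ret hψ.2
  len_sec := len_comp_le_zero _ hφ.2 c.len_sec
  len_proj := len_comp_le_zero _ c.len_proj hψ.2
  ret_incl := act_injective (by
    have := congrArg (fun x => act c.incl ≫ x ≫ act c.ret) h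
    simpa using this)
  proj_sec := act_injective (by
    have := congrArg (fun x => act c.sec ≫ x ≫ act c.proj) h
    simpa using this)
  proj_incl := act_injective (by
    have := congrArg (fun x => act c.incl ≫ x ≫ act c.proj) h
    simpa using this)
  ret_sec := act_injective (by
    have := congrArg (fun x => act c.sec ≫ x ≫ act c.ret) h
    simpa using this)
  total := act_injective (by simp [h'])

end

namespace FilteredDGFunctor

variable {k : Type w} [Field k] {A : Type u} {B : Type u'} [FilteredDGCategory.{w, v} k A]
  [FilteredDGCategory.{w, v'} k B] {F : FilteredDGFunctor k A B} {X Y Z : A}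

lemma IsEquivalence.injective (hF : F.IsEquivalence) {n : ℤ} {f g : hom k X Y n}
    (h : F.map f = F.map g) : f = g := (hF.1 X Y n).1 h

lemma IsEquivalence.exists_map_eq (hF : F.IsEquivalence) {n : ℤ}
    (g : hom k (F.obj X) (F.obj Y) n) : ∃ f : hom k X Y n, F.map f = g := (hF.1 X Y n).2 g

lemma IsEquivalence.mem_cycles_iff (hF : F.IsEquivalence) {f : hom k X Y 0} {r : ℝ} :
    F.map f ∈ cycles k (F.obj X) (F.obj Y) r ↔ f ∈ cycles k X Y r := by
  refine and_congr ?_ (by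
    change len (F.map f) ≤ _ ↔ len f ≤ _
    rw [hF.2.1])
  change d 0 1 (F.map f) = 0 ↔ d 0 1 f = 0
  rw [← F.map_d]
  exact ⟨fun h => hF.injective (h.trans (map_zero _).symm), fun h => by rw [h, map_zero]⟩

/-- Fullness lifts the structure maps, faithfulness lifts their equations, and preservation of the
filtration function lifts the bounds. -/
lemma IsEquivalence.exists_coneData_of_eq (hF : F.IsEquivalence) {f : hom k X Y 0} {P : A}
    (c : ConeData (F.map f)) (h : c.pt = F.obj P) : Nonempty (ConeData f) := by
  -- The data are unpacked so that the vertex becomes a variable and can be replaced by `F.obj P`.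
  obtain ⟨Q, incl, ret, sec, proj, h₁, h₂, h₃, h₄, l₁, l₂, l₃, l₄, e₁, e₂, e₃, e₄, e₅⟩ := c
  obtain rfl : Q = F.obj P := h
  obtain ⟨incl, rfl⟩ := hF.exists_map_eq incl
  obtain ⟨ret, rfl⟩ := hF.exists_map_eq ret
  obtain ⟨sec, rfl⟩ := hF.exists_map_eq sec
  obtain ⟨proj, rfl⟩ := hF.exists_map_eq proj
  simp only [← F.map_d, ← F.map_comp, ← F.map_id, ← map_neg, ← map_add, hF.2.1] at *
  exact ⟨⟨P, incl, ret, sec, proj, hF.injective (h₁.trans (map_zero _).symm),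
    (hF.injective h₂).trans (map_neg _ _),
    hF.injective h₃, hF.injective (h₄.trans (map_zero _).symm), l₁, l₂, l₃, l₄, hF.injective e₁,
    hF.injective e₂, hF.injective (e₃.trans (map_zero _).symm),
    hF.injective (e₄.trans (map_zero _).symm), hF.injective e₅⟩⟩

lemma IsEquivalence.exists_iso (hF : F.IsEquivalence) (Z : B) :
    ∃ (P : A) (φ : hom k Z (F.obj P) 0) (ψ : hom k (F.obj P) Z 0),
      φ ∈ cycles k Z (F.obj P) 0 ∧ ψ ∈ cycles k (F.obj P) Z 0 ∧
        act φ ≫ act ψ = 𝟙 _ ∧ act ψ ≫ act φ = 𝟙 _ := by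
  obtain ⟨P, φ, ψ, hφ, hψ, h, h'⟩ := hF.2.2 Z
  refine ⟨P, ψ, φ, hψ, hφ, ?_, ?_⟩
  · rw [← act_comp (add_zero 0), h', act_id]
  · rw [← act_comp (add_zero 0), h, act_id]

/-- The vertex need not lie in the image of `F`; it is first moved there along an isomorphism
provided by essential surjectivity. -/
lemma IsEquivalence.exists_coneData (hF : F.IsEquivalence) {f : hom k X Y 0}
    (c : ConeData (F.map f)) : Nonempty (ConeData f) := by
  obtain ⟨P, φ, ψ, hφ, hψ, h, h'⟩ := hF.exists_iso c.pt
  exact hF.exists_coneData_of_eq (c.ofIso hφ hψ h h') rfl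

variable [ConeStable k B]

lemma IsEquivalence.exists_cone (hF : F.IsEquivalence) (f : hom k X Y 0) (hf : f ∈ cycles k X Y 0) :
    Nonempty (ConeData f) := by
  obtain ⟨c⟩ := ConeStable.exists_cone (F.map f) (hF.mem_cycles_iff.2 hf)
  exact hF.exists_coneData c

lemma IsEquivalence.exists_zero (hF : F.IsEquivalence) :
    ∃ X : A, FilteredDGCategory.id (k := k) X = 0 := by
  obtain ⟨Z, hZ⟩ := ConeStable.exists_zero (k := k) (B := B)
  obtain ⟨P, φ, ψ, -, -, -, h⟩ := hF.exists_iso Z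
  refine ⟨P, hF.injective (act_injective ?_)⟩
  -- The identity of `F.obj P` factors through the zero object `Z`, so it vanishes.
  have e : 𝟙 (Yo k Z) = 0 := by rw [← act_id, hZ, act_zero]
  rw [map_zero, F.map_id, act_id, act_zero, ← h, ← Category.id_comp (act φ), e]
  simp

/-- The canonical morphisms in `B` are composed with an isomorphism of level ≤ 0 onto an object in
the image, which leaves the levels `r` and `-r` unchanged, and are then lifted. -/
lemma IsEquivalence.exists_sh (hF : F.IsEquivalence) (r : ℝ) (X : A) :
    ∃ (Y : A) (f : hom k X Y 0) (g : hom k Y X 0), f ∈ cycles k X Y r ∧ g ∈ cycles k Y X (-r) ∧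
      comp (add_zero 0) g f = FilteredDGCategory.id X ∧
      comp (add_zero 0) f g = FilteredDGCategory.id Y := by
  obtain ⟨P, φ, ψ, hφ, hψ, h, h'⟩ := hF.exists_iso (ConeStable.sh k r (F.obj X))
  obtain ⟨f, hf⟩ := hF.exists_map_eq (comp (add_zero 0) φ (ConeStable.toSh r (F.obj X)))
  obtain ⟨g, hg⟩ := hF.exists_map_eq (comp (add_zero 0) (ConeStable.ofSh r (F.obj X)) ψ)
  have e := congrArg (fun x => act (ConeStable.toSh r (F.obj X)) ≫ x ≫
    act (ConeStable.ofSh r (F.obj X))) h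
  refine ⟨P, f, g, hF.mem_cycles_iff.1 ?_, hF.mem_cycles_iff.1 ?_, hF.injective ?_,
    hF.injective ?_⟩
  · rw [hf]; exact comp_mem_cycles (zero_add r) hφ (ConeStable.toSh_mem _ _)
  · rw [hg]; exact comp_mem_cycles (add_zero (-r)) (ConeStable.ofSh_mem _ _) hψ
  · rw [F.map_comp, F.map_id, hf, hg]
    exact act_injective (by simpa using e)
  · rw [F.map_comp, F.map_id, hf, hg]
    exact act_injective (by simpa using h')

lemma IsEquivalence.exists_tr (hF : F.IsEquivalence) (n : ℤ) (X : A) :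
    ∃ (Y : A) (f : hom k X Y (-n)) (g : hom k Y X n), d (-n) (-n + 1) f = 0 ∧ d n (n + 1) g = 0 ∧
      len f ≤ 0 ∧ len g ≤ 0 ∧ comp (add_neg_cancel n) g f = FilteredDGCategory.id X ∧
      comp (neg_add_cancel n) f g = FilteredDGCategory.id Y := by
  obtain ⟨P, φ, ψ, hφ, hψ, h, h'⟩ := hF.exists_iso (ConeStable.tr k n (F.obj X))
  obtain ⟨f, hf⟩ := hF.exists_map_eq (comp (zero_add (-n)) φ (ConeStable.toTr n (F.obj X)))
  obtain ⟨g, hg⟩ := hF.exists_map_eq (comp (add_zero n) (ConeStable.ofTr n (F.obj X)) ψ)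
  have e := congrArg (fun x => act (ConeStable.toTr n (F.obj X)) ≫ x ≫
    act (ConeStable.ofTr n (F.obj X))) h
  refine ⟨P, f, g, hF.injective ?_, hF.injective ?_, ?_, ?_, hF.injective ?_, hF.injective ?_⟩
  · rw [F.map_d, hf, map_zero]
    refine (closed_iff rfl _).2 ?_
    rcases Int.units_eq_one_or n.negOnePow with hn | hn <;>
    simp [act_comm hφ, ConeStable.toTr_dOp_assoc, Int.negOnePow_neg, hn]
  · rw [F.map_d, hg, map_zero]
    refine (closed_iff rfl _).2 ?_
    rcases Int.units_eq_one_or n.negOnePow with hn | hn <;>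
    simp [ConeStable.ofTr_dOp, act_comm_assoc hψ, hn]
  · rw [← hF.2.1, hf]
    exact len_comp_le_zero _ hφ.2 (ConeStable.len_toTr _ _)
  · rw [← hF.2.1, hg]
    exact len_comp_le_zero _ (ConeStable.len_ofTr _ _) hψ.2
  · rw [F.map_comp, F.map_id, hf, hg]
    exact act_injective (by simpa using e)
  · rw [F.map_comp, F.map_id, hf, hg]
    exact act_injective (by simpa using h')

lemma IsEquivalence.nonempty_coneStable (hF : F.IsEquivalence) : Nonempty (ConeStable k A) := by
  choose sh toSh ofSh h₁ h₂ h₃ h₄ using hF.exists_sh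
  choose tr toTr ofTr t₁ t₂ t₃ t₄ t₅ t₆ using hF.exists_tr
  exact ⟨⟨sh, toSh, ofSh, h₁, h₂, h₃, h₄, tr, toTr, ofTr, t₁, t₂, t₃, t₄, t₅, t₆,
    hF.exists_zero, hF.exists_cone⟩⟩

end FilteredDGFunctor

end FiltDG

namespace FiltDG

open FilteredDGCategory

/-! ### Cone-stable filtered dg-categories are pre-triangulated -/

section

variable {k : Type w} [Field k] {B : Type u} [FilteredDGCategory.{w, v} k B] {X Y Z X' Y' : B}

lemma FilteredDGCategory.isomorphic_iff : Isomorphic k X Y ↔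
    ∃ (φ : hom k X Y 0) (ψ : hom k Y X 0), φ ∈ cycles k X Y 0 ∧ ψ ∈ cycles k Y X 0 ∧
      act φ ≫ act ψ = 𝟙 _ ∧ act ψ ≫ act φ = 𝟙 _ := by
  refine exists_congr fun φ => exists_congr fun ψ => and_congr_right' (and_congr_right' ?_)
  rw [← act_comp (add_zero 0), ← act_comp (add_zero 0), ← act_id, ← act_id]
  exact and_congr ⟨congrArg act, act_injective⟩ ⟨congrArg act, act_injective⟩

lemma ConeData.isomorphic {f : hom k X Y 0} (c c' : ConeData f) : Isomorphic k c.pt c'.pt :=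
  isomorphic_iff.2 ⟨c.compare c', c'.compare c, compare_mem _ _, compare_mem _ _, by simp, by simp⟩

/-- The cone of a conjugate of `f`. -/
def ConeData.conj {f : hom k X Y 0} (c : ConeData f) {a : hom k X X' 0} {a' : hom k X' X 0}
    {b : hom k Y Y' 0} {b' : hom k Y' Y 0} (ha : a ∈ cycles k X X' 0) (ha' : a' ∈ cycles k X' X 0)
    (hb : b ∈ cycles k Y Y' 0) (hb' : b' ∈ cycles k Y' Y 0) (haa' : act a ≫ act a' = 𝟙 _)
    (haa : act a' ≫ act a = 𝟙 _) (hbb' : act b ≫ act b' = 𝟙 _) (hbb : act b' ≫ act b = 𝟙 _) :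
    ConeData (comp (add_zero 0) b (comp (add_zero 0) f a')) :=
  have e₁ {W : AddCommGrpCat} (φ : Yo k X ⟶ W) : act a ≫ act a' ≫ φ = φ := by
    rw [← Category.assoc, haa', Category.id_comp]
  have e₂ {W : AddCommGrpCat} (φ : Yo k Y ⟶ W) : act b ≫ act b' ≫ φ = φ := by
    rw [← Category.assoc, hbb', Category.id_comp]
  { pt := c.pt
    incl := comp (add_zero 0) c.incl b'
    ret := comp (add_zero 0) b c.ret
    sec := comp (add_zero (-1)) c.sec a'
    proj := comp (zero_add 1) a c.proj
    d_incl := (closed_iff (zero_add 1) _).2 (by simp [c.incl_dOp, act_comm_assoc hb'])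
    d_ret := act_injective (by
      simp [act_d (zero_add 1), c.ret_dOp_assoc, act_comm hb, e₁])
    d_sec := act_injective (by
      simp [act_d_neg_one, c.sec_dOp, act_comm_assoc ha', e₂])
    d_proj := (closed_iff one_add_one_eq_two _).2 (by simp [c.proj_dOp_assoc, act_comm ha])
    len_incl := len_comp_le_zero _ c.len_incl hb'.2
    len_ret := len_comp_le_zero _ hb.2 c.len_ret
    len_sec := len_comp_le_zero _ c.len_sec ha'.2
    len_proj := len_comp_le_zero _ ha.2 c.len_proj
    ret_incl := act_injective (by simp [hbb])
    proj_sec := act_injective (by simp [haa])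
    proj_incl := act_injective (by simp)
    ret_sec := act_injective (by simp)
    total := act_injective (by simp [e₁, e₂]) }

variable {A : Type u'} [FilteredDGCategory.{w, v'} k A]

lemma FilteredDGFunctor.map_mem_cycles (F : FilteredDGFunctor k A B) {X Y : A} {f : hom k X Y 0}
    {r : ℝ} (hf : f ∈ cycles k X Y r) : F.map f ∈ cycles k (F.obj X) (F.obj Y) r :=
  ⟨(F.map_d 0 1 f).symm.trans ((congrArg _ hf.1).trans (map_zero _)), (F.len_map_le f).trans hf.2⟩

/-- The image of a cone under a filtered dg-functor. -/
def ConeData.map (F : FilteredDGFunctor k A B) {X Y : A} {f : hom k X Y 0} (c : ConeData f) :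
    ConeData (F.map f) where
  pt := F.obj c.pt
  incl := F.map c.incl
  ret := F.map c.ret
  sec := F.map c.sec
  proj := F.map c.proj
  d_incl := by rw [← F.map_d, c.d_incl, map_zero]
  d_ret := by rw [← F.map_d, c.d_ret, map_neg, F.map_comp]
  d_sec := by rw [← F.map_d, c.d_sec, F.map_comp]
  d_proj := by rw [← F.map_d, c.d_proj, map_zero]
  len_incl := (F.len_map_le _).trans c.len_incl
  len_ret := (F.len_map_le _).trans c.len_ret
  len_sec := (F.len_map_le _).trans c.len_sec
  len_proj := (F.len_map_le _).trans c.len_proj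
  ret_incl := by rw [← F.map_comp, c.ret_incl, F.map_id]
  proj_sec := by rw [← F.map_comp, c.proj_sec, F.map_id]
  proj_incl := by rw [← F.map_comp, c.proj_incl, map_zero]
  ret_sec := by rw [← F.map_comp, c.ret_sec, map_zero]
  total := by rw [← F.map_comp, ← F.map_comp, ← map_add, c.total, F.map_id]

variable [ConeStable k A] [ConeStable k B] (F : FilteredDGFunctor k A B)

/-- The object `Σ^r X` is determined up to isomorphism by its inverse pair of closed morphisms of
levels `r` and `-r`, and `F` preserves such pairs. In the composites the two levels cancel. -/
lemma FilteredDGFunctor.isomorphic_sh (r : ℝ) {X : A} {Z : B} (h : Isomorphic k (F.obj X) Z) :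
    Isomorphic k (F.obj (ConeStable.sh k r X)) (ConeStable.sh k r Z) := by
  obtain ⟨φ, ψ, hφ, hψ, e, e'⟩ := isomorphic_iff.1 h
  have h₁ := congrArg act (F.map_comp (add_zero 0) (ConeStable.ofSh r X) (ConeStable.toSh r X))
  have h₂ := congrArg act (F.map_comp (add_zero 0) (ConeStable.toSh r X) (ConeStable.ofSh r X))
  simp only [ConeStable.ofSh_toSh, ConeStable.toSh_ofSh, F.map_id, act_id, act_comp] at h₁ h₂
  have h₃ {W : AddCommGrpCat} (φ : Yo k (F.obj X) ⟶ W) :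
      act (F.map (ConeStable.toSh r X)) ≫ act (F.map (ConeStable.ofSh r X)) ≫ φ = φ := by
    rw [← Category.assoc, ← h₁, Category.id_comp]
  have h₄ {W : AddCommGrpCat} (g : Yo k (F.obj X) ⟶ W) : act φ ≫ act ψ ≫ g = g := by
    rw [← Category.assoc, e, Category.id_comp]
  have h₅ {W : AddCommGrpCat} (g : Yo k Z ⟶ W) : act ψ ≫ act φ ≫ g = g := by
    rw [← Category.assoc, e', Category.id_comp]
  refine isomorphic_iff.2
    ⟨comp (add_zero 0) (ConeStable.toSh r Z) (comp (add_zero 0) φ (F.map (ConeStable.ofSh r X))),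
      comp (add_zero 0) (F.map (ConeStable.toSh r X)) (comp (add_zero 0) ψ (ConeStable.ofSh r Z)),
      comp_mem_cycles (add_neg_cancel r) (ConeStable.toSh_mem r Z)
        (comp_mem_cycles (zero_add (-r)) hφ (F.map_mem_cycles (ConeStable.ofSh_mem r X))),
      comp_mem_cycles (add_neg_cancel r) (F.map_mem_cycles (ConeStable.toSh_mem r X))
        (comp_mem_cycles (zero_add (-r)) hψ (ConeStable.ofSh_mem r Z)), ?_, ?_⟩
  · simp [h₄, ← h₂]
  · simp [h₃, h₅]

lemma FilteredDGFunctor.isomorphic_tr (n : ℤ) {X : A} {Z : B} (h : Isomorphic k (F.obj X) Z) :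
    Isomorphic k (F.obj (ConeStable.tr k n X)) (ConeStable.tr k n Z) := by
  obtain ⟨φ, ψ, hφ, hψ, e, e'⟩ := isomorphic_iff.1 h
  have h₁ := congrArg act (F.map_comp (add_neg_cancel n) (ConeStable.ofTr n X) (ConeStable.toTr n X))
  have h₂ := congrArg act (F.map_comp (neg_add_cancel n) (ConeStable.toTr n X) (ConeStable.ofTr n X))
  simp only [ConeStable.ofTr_toTr, ConeStable.toTr_ofTr, F.map_id, act_id, act_comp] at h₁ h₂
  have h₃ {W : AddCommGrpCat} (φ : Yo k (F.obj X) ⟶ W) :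
      act (F.map (ConeStable.toTr n X)) ≫ act (F.map (ConeStable.ofTr n X)) ≫ φ = φ := by
    rw [← Category.assoc, ← h₁, Category.id_comp]
  have h₄ {W : AddCommGrpCat} (g : Yo k (F.obj X) ⟶ W) : act φ ≫ act ψ ≫ g = g := by
    rw [← Category.assoc, e, Category.id_comp]
  have h₅ {W : AddCommGrpCat} (g : Yo k Z ⟶ W) : act ψ ≫ act φ ≫ g = g := by
    rw [← Category.assoc, e', Category.id_comp]
  -- The functor commutes with the differential, so the images of the canonical morphisms remain
  -- closed and obey the same sign rules.
  have h₆ : act (F.map (ConeStable.toTr n X)) ≫ dOp k _ =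
      n.negOnePow • (dOp k _ ≫ act (F.map (ConeStable.toTr n X))) := by
    have := (closed_iff rfl _).1 ((F.map_d (-n) (-n + 1) (ConeStable.toTr n X)).symm.trans
      ((congrArg _ (ConeStable.d_toTr n X)).trans (map_zero _)))
    rwa [Int.negOnePow_neg] at this
  have h₇ : act (F.map (ConeStable.ofTr n X)) ≫ dOp k _ =
      n.negOnePow • (dOp k _ ≫ act (F.map (ConeStable.ofTr n X))) :=
    (closed_iff rfl _).1 ((F.map_d n (n + 1) (ConeStable.ofTr n X)).symm.trans
      ((congrArg _ (ConeStable.d_ofTr n X)).trans (map_zero _)))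
  have h₈ {W : AddCommGrpCat} (g : _ ⟶ W) : act (F.map (ConeStable.ofTr n X)) ≫ dOp k _ ≫ g =
      n.negOnePow • (dOp k _ ≫ act (F.map (ConeStable.ofTr n X)) ≫ g) := by
    rw [← Category.assoc, h₇]
    rcases Int.units_eq_one_or n.negOnePow with hn | hn <;> rw [hn] <;> simp
  refine isomorphic_iff.2
    ⟨comp (neg_add_cancel n) (ConeStable.toTr n Z)
      (comp (zero_add n) φ (F.map (ConeStable.ofTr n X))),
      comp (neg_add_cancel n) (F.map (ConeStable.toTr n X))
        (comp (zero_add n) ψ (ConeStable.ofTr n Z)),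
      mem_cycles_iff.2 ⟨?_, len_comp_le_zero _ (ConeStable.len_toTr n Z)
        (len_comp_le_zero _ hφ.2 ((F.len_map_le _).trans (ConeStable.len_ofTr n X)))⟩,
      mem_cycles_iff.2 ⟨?_, len_comp_le_zero _ ((F.len_map_le _).trans (ConeStable.len_toTr n X))
        (len_comp_le_zero _ hψ.2 (ConeStable.len_ofTr n Z))⟩, ?_, ?_⟩
  · rcases Int.units_eq_one_or n.negOnePow with hn | hn <;>
    simp [hn, ConeStable.toTr_dOp, act_comm_assoc hφ, h₈]
  · rcases Int.units_eq_one_or n.negOnePow with hn | hn <;>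
    simp [hn, ConeStable.ofTr_dOp_assoc, act_comm_assoc hψ, h₆]
  · simp [h₄, ← h₂]
  · simp [h₃, h₅]

end

end FiltDG

/-! ### Twisted complexes as iterated cones. -/

namespace FiltDG

open FilteredDGCategory

namespace Tw

open ShiftCompletion

variable {k : Type w} [Field k] {A : Type u} [FilteredDGCategory.{w, v} k A] {X Y Z : Tw k A}

/-- A cone of `g ∘ t`, where `t : L[-1] → L` is the canonical morphism of degree `-1` and `g` has
degree `1`. -/
def coneOfSplit {L Y Z : Tw k A} (g : hom k L Y 1) (incl : hom k Y Z 0)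
    (ret : hom k Z Y 0) (sec : hom k L Z 0) (proj : hom k Z L 0)
    (d_incl : act incl ≫ dOp k Z = dOp k Y ≫ act incl)
    (d_ret : act ret ≫ dOp k Y = dOp k Z ≫ act ret - act proj ≫ act g)
    (d_sec : act sec ≫ dOp k Z = dOp k L ≫ act sec + act g ≫ act incl)
    (d_proj : act proj ≫ dOp k L = dOp k Z ≫ act proj)
    (len_incl : len incl ≤ 0) (len_ret : len ret ≤ 0) (len_sec : len sec ≤ 0)
    (len_proj : len proj ≤ 0) (ret_incl : act incl ≫ act ret = 𝟙 _)
    (proj_sec : act sec ≫ act proj = 𝟙 _) (proj_incl : act incl ≫ act proj = 0)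
    (ret_sec : act sec ≫ act ret = 0)
    (total : act ret ≫ act incl + act proj ≫ act sec = 𝟙 _) :
    ConeData (comp (add_neg_cancel 1) g (ofTr k (-1) L)) :=
  have e₁ : act (toTr k (-1) L) ≫ act (ofTr k (-1) L) = 𝟙 _ := act_toTr_ofTr _ _
  have e₂ : act (ofTr k (-1) L) ≫ act (toTr k (-1) L) = 𝟙 _ := act_ofTr_toTr _ _
  have e₃ {W : AddCommGrpCat} (φ : Yo k L ⟶ W) :
      act (toTr k (-1) L) ≫ act (ofTr k (-1) L) ≫ φ = φ := by
    rw [← Category.assoc, e₁, Category.id_comp]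
  have s₁ : act (toTr k (-1) L) ≫ dOp k _ = -(dOp k _ ≫ act (toTr k (-1) L)) := by
    simpa using (closed_iff rfl _).1 (d_toTr (-1) L)
  have s₂ : act (ofTr k (-1) L) ≫ dOp k _ = -(dOp k _ ≫ act (ofTr k (-1) L)) := by
    simpa using (closed_iff rfl _).1 (d_ofTr (-1) L)
  have s₃ {W : AddCommGrpCat} (φ : _ ⟶ W) :
      act (ofTr k (-1) L) ≫ dOp k _ ≫ φ = -(dOp k _ ≫ act (ofTr k (-1) L) ≫ φ) := by
    rw [← Category.assoc, s₂]; simp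
  have s₄ {W : AddCommGrpCat} (φ : _ ⟶ W) :
      act proj ≫ dOp k _ ≫ φ = dOp k _ ≫ act proj ≫ φ := by
    rw [← Category.assoc, d_proj]; simp
  { pt := Z
    incl := incl
    ret := ret
    -- The morphisms `L[-1] → L` and `L → L[-1]` have degrees `-1` and `1`; they give the degree-0
    -- splitting maps the degrees required of a cone.
    sec := comp (zero_add (-1)) sec (ofTr k (-1) L)
    proj := comp (show -(-1) + 0 = (1 : ℤ) by omega) (toTr k (-1) L) proj
    d_incl := (closed_iff (zero_add 1) _).2 (by simpa using d_incl)
    d_ret := act_injective (by simp [act_d (zero_add 1), d_ret, e₃])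
    d_sec := act_injective (by simp [act_d_neg_one, d_sec, s₃])
    d_proj := (closed_iff one_add_one_eq_two _).2 (by simp [s₁, s₄])
    len_incl := len_incl
    len_ret := len_ret
    len_sec := len_comp_le_zero _ len_sec (len_ofTr _ _)
    len_proj := len_comp_le_zero _ (len_toTr _ _) len_proj
    ret_incl := act_injective (by simpa using ret_incl)
    proj_sec := act_injective (by
      have := congrArg (fun x => act (ofTr k (-1) L) ≫ x ≫ act (toTr k (-1) L)) proj_sec
      simpa [e₂] using this)
    proj_incl := act_injective (by
      have := congrArg (fun x => x ≫ act (toTr k (-1) L)) proj_incl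
      simpa using this)
    ret_sec := act_injective (by simp [ret_sec])
    total := act_injective (by simpa [e₃] using total) }

/-! #### The last term of a twisted complex -/

/-- A twisted complex with a single term. -/
def term (x : ShiftCompletion A) : Tw k A where
  size := 1
  obj _ := x
  q _ _ := 0
  q_eq_zero _ _ _ := rfl
  d_q i j := by simp
  len_q_le i j := by simp

variable {n : ℕ} (obj : Fin (n + 1) → ShiftCompletion A)
  (q : ∀ i j : Fin (n + 1), hom k (obj j) (obj i) 1)
  (q_eq_zero : ∀ i j : Fin (n + 1), j ≤ i → q i j = 0)
  (d_q : ∀ i j : Fin (n + 1), d 1 2 (q i j) +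
    ∑ l, comp (one_add_one_eq_two (R := ℤ)) (q i l) (q l j) = 0)
  (len_q_le : ∀ i j : Fin (n + 1), len (q i j) ≤ 0)

/-- The twisted complex obtained by omitting the last term. -/
def initTerms : Tw k A where
  size := n
  obj i := obj i.castSucc
  q i j := q i.castSucc j.castSucc
  q_eq_zero i j h := q_eq_zero _ _ h
  d_q i j := by
    have h := d_q i.castSucc j.castSucc
    -- The summand of `q²` through the omitted last term vanishes, because no entry of `q` leads
    -- from an earlier term into the last one... as the last row of `q` is zero.
    rw [Fin.sum_univ_castSucc, q_eq_zero (Fin.last n) _ (Fin.le_last _)] at h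
    simpa using h
  len_q_le i j := len_q_le _ _

/-- A twisted complex is a cone of a morphism to the complex of all but the last term. -/
lemma exists_coneData_initTerms :
    ∃ (f : hom k (translate (-1) (term (obj (Fin.last n))))
        (initTerms obj q q_eq_zero d_q len_q_le) 0) (_ : f ∈ cycles k _ _ 0) (c : ConeData f),
      c.pt = ⟨n + 1, obj, q, q_eq_zero, d_q, len_q_le⟩ := by
  let Y : Tw k A := initTerms obj q q_eq_zero d_q len_q_le
  let L : Tw k A := term (obj (Fin.last n))
  let Z : Tw k A := ⟨n + 1, obj, q, q_eq_zero, d_q, len_q_le⟩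
  -- The attaching morphism is the last column of `q`.
  let g : hom k L Y 1 := fun i _ => q i.castSucc (Fin.last n)
  let incl : hom k Y Z 0 := fun i j => Mat.id k obj i j.castSucc
  let ret : hom k Z Y 0 := fun i j => Mat.id k obj i.castSucc j
  let sec : hom k L Z 0 := fun i _ => Mat.id k obj i (Fin.last n)
  let proj : hom k Z L 0 := fun _ j => Mat.id k obj (Fin.last n) j
  -- Strict upper triangularity kills the last row: the first `n` terms form a subcomplex, and the
  -- last term is a quotient with zero matrix.
  have hlast (l : Fin (n + 1)) : q (Fin.last n) l = 0 := q_eq_zero _ _ (Fin.le_last _)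
  have hg : d 1 2 g = 0 := by
    rw [d_eq 1 2 one_add_one_eq_two]
    have e (i : Fin n) : d 1 2 (q i.castSucc (Fin.last n)) +
        ∑ l : Fin n, comp one_add_one_eq_two (q i.castSucc l.castSucc)
          (q l.castSucc (Fin.last n)) -
        (1 : ℤ).negOnePow • ∑ l : Fin 1, comp one_add_one_eq_two (q i.castSucc (Fin.last n))
          (0 : hom k (obj (Fin.last n)) (obj (Fin.last n)) 1) = 0 := by
      -- The attaching morphism is closed by the last column of the equation `d q + q² = 0`.
      have h := d_q i.castSucc (Fin.last n)
      rw [Fin.sum_univ_castSucc, hlast] at h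
      simpa using h
    funext i j
    exact e i
  have hincl : d 0 1 incl = 0 := by
    rw [d_eq 0 1 (zero_add 1)]
    have e (i : Fin (n + 1)) (j : Fin n) : d (k := k) 0 1 (Mat.id k obj i j.castSucc) +
        ∑ l : Fin (n + 1), comp (add_zero 1) (q i l) (Mat.id k obj l j.castSucc) -
        (0 : ℤ).negOnePow • ∑ l : Fin n, comp (zero_add 1) (Mat.id k obj i l.castSucc)
          (q l.castSucc j.castSucc) = 0 := by
      have h := sum_id_comp (fun l => q l j.castSucc) i
      rw [Fin.sum_univ_castSucc, hlast, map_zero, add_zero] at h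
      rw [d_id_apply, sum_comp_id (fun l => q i l), h]
      simp
    funext i j
    exact e i j
  have hproj : d 0 1 proj = 0 := by
    rw [d_eq 0 1 (zero_add 1)]
    have e (j : Fin (n + 1)) : d (k := k) 0 1 (Mat.id k obj (Fin.last n) j) +
        ∑ l : Fin 1, comp (add_zero 1) (0 : hom k (obj (Fin.last n)) (obj (Fin.last n)) 1)
          (Mat.id k obj (Fin.last n) j) -
        (0 : ℤ).negOnePow • ∑ l : Fin (n + 1), comp (zero_add 1) (Mat.id k obj (Fin.last n) l)
          (q l j) = 0 := by
      rw [d_id_apply, sum_id_comp (fun l => q l j), hlast]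
      simp
    funext i j
    exact e j
  have hsec : d 0 1 sec = comp (zero_add 1) incl g := by
    rw [d_eq 0 1 (zero_add 1)]
    have e (i : Fin (n + 1)) : d (k := k) 0 1 (Mat.id k obj i (Fin.last n)) +
        ∑ l : Fin (n + 1), comp (add_zero 1) (q i l) (Mat.id k obj l (Fin.last n)) -
        (0 : ℤ).negOnePow • ∑ l : Fin 1, comp (zero_add 1) (Mat.id k obj i (Fin.last n))
          (0 : hom k (obj (Fin.last n)) (obj (Fin.last n)) 1) =
        ∑ l : Fin n, comp (zero_add 1) (Mat.id k obj i l.castSucc) (q l.castSucc (Fin.last n)) := by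
      have h := sum_id_comp (fun l => q l (Fin.last n)) i
      rw [Fin.sum_univ_castSucc, hlast, map_zero, add_zero] at h
      rw [d_id_apply, sum_comp_id (fun l => q i l), h]
      simp
    funext i j
    exact e i
  have hret : d 0 1 ret = -comp (add_zero 1) g proj := by
    rw [d_eq 0 1 (zero_add 1)]
    have e (i : Fin n) (j : Fin (n + 1)) : d (k := k) 0 1 (Mat.id k obj i.castSucc j) +
        ∑ l : Fin n, comp (add_zero 1) (q i.castSucc l.castSucc) (Mat.id k obj l.castSucc j) -
        (0 : ℤ).negOnePow • ∑ l : Fin (n + 1), comp (zero_add 1) (Mat.id k obj i.castSucc l)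
          (q l j) =
        -∑ l : Fin 1, comp (add_zero 1) (q i.castSucc (Fin.last n))
          (Mat.id k obj (Fin.last n) j) := by
      have h := sum_comp_id (fun l => q i.castSucc l) j
      rw [Fin.sum_univ_castSucc] at h
      rw [d_id_apply, sum_id_comp (fun l => q l j), ← h]
      simp
    funext i j
    exact e i j
  have hri : comp (add_zero 0) ret incl = FilteredDGCategory.id Y := by
    funext i j
    refine (sum_comp_id (fun l => Mat.id k obj i.castSucc l) j.castSucc).trans ?_
    by_cases h : j = i
    · subst h
      exact (Mat.id_self _).trans (Mat.id_self (X := Y.obj) j).symm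
    · exact (Mat.id_of_ne (fun e => h (Fin.castSucc_injective n e))).trans
        (Mat.id_of_ne (X := Y.obj) h).symm
  have hps : comp (add_zero 0) proj sec = FilteredDGCategory.id L := by
    funext i j
    refine (sum_comp_id (fun l => Mat.id k obj (Fin.last n) l) (Fin.last n)).trans ?_
    obtain rfl : i = j := Subsingleton.elim (α := Fin 1) i j
    exact (Mat.id_self _).trans (Mat.id_self (X := L.obj) i).symm
  have hpi : comp (add_zero 0) proj incl = 0 := by
    funext i j
    exact (sum_comp_id (fun l => Mat.id k obj (Fin.last n) l) j.castSucc).trans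
      (Mat.id_of_ne (Fin.castSucc_lt_last j).ne)
  have hrs : comp (add_zero 0) ret sec = 0 := by
    funext i j
    exact (sum_comp_id (fun l => Mat.id k obj i.castSucc l) (Fin.last n)).trans
      (Mat.id_of_ne (Fin.castSucc_lt_last i).ne')
  have htotal : comp (add_zero 0) incl ret + comp (add_zero 0) sec proj =
      FilteredDGCategory.id Z := by
    have e (i j : Fin (n + 1)) : ∑ l : Fin n, comp (add_zero 0) (Mat.id k obj i l.castSucc)
        (Mat.id k obj l.castSucc j) + ∑ l : Fin 1, comp (add_zero 0) (Mat.id k obj i (Fin.last n))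
        (Mat.id k obj (Fin.last n) j) = Mat.id k obj i j := by
      have h := sum_comp_id (fun l => Mat.id k obj i l) j
      rw [Fin.sum_univ_castSucc] at h
      rw [← h, Fin.sum_univ_one]
    funext i j
    exact e i j
  have hg' : len g ≤ 0 := (Mat.len_le_iff _ _).2 fun i j => len_q_le _ _
  have hag := (closed_iff one_add_one_eq_two _).1 hg
  refine ⟨_, ?_, coneOfSplit g incl ret sec proj ?_ ?_ ?_ ?_
    ((Mat.len_le_iff _ _).2 fun i j => len_id_apply_le obj _ _)
    ((Mat.len_le_iff _ _).2 fun i j => len_id_apply_le obj _ _)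
    ((Mat.len_le_iff _ _).2 fun i j => len_id_apply_le obj _ _)
    ((Mat.len_le_iff _ _).2 fun i j => len_id_apply_le obj _ _) ?_ ?_ ?_ ?_ ?_, rfl⟩
  · refine mem_cycles_iff.2 ⟨?_, len_comp_le_zero _ hg' (len_ofTr _ _)⟩
    have s₂ := (closed_iff rfl _).1 (d_ofTr (k := k) (-1) L)
    have s₃ {W : AddCommGrpCat} (φ : Yo k L ⟶ W) :
        act (ofTr k (-1) L) ≫ dOp k _ ≫ φ = -(dOp k _ ≫ act (ofTr k (-1) L) ≫ φ) := by
      rw [← Category.assoc, s₂]; simp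
    change act (comp (add_neg_cancel 1) g (ofTr k (-1) L)) ≫ dOp k Y = dOp k (translate (-1) L) ≫ _
    rw [act_comp, Category.assoc, hag, Int.negOnePow_one, Units.neg_smul, one_smul,
      Preadditive.comp_neg, s₃, neg_neg]
  · simpa using (closed_iff (zero_add 1) _).1 hincl
  · have := congrArg act hret
    simp [act_d (zero_add 1)] at this
    rw [sub_eq_iff_eq_add] at this
    rw [this]; abel
  · have := congrArg act hsec
    simp [act_d (zero_add 1)] at this
    rw [sub_eq_iff_eq_add] at this
    rw [this]; abel
  · simpa using (closed_iff (zero_add 1) _).1 hproj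
  · rw [← act_comp (add_zero 0), hri, act_id]
  · rw [← act_comp (add_zero 0), hps, act_id]
  · rw [← act_comp (add_zero 0), hpi, act_zero]
  · rw [← act_comp (add_zero 0), hrs, act_zero]
  · rw [← act_comp (add_zero 0), ← act_comp (add_zero 0), ← act_add, htotal, act_id]

/-- One-term complexes are thus obtained from objects of `A` by translation and filtration shift.
The matrices agree automatically, since the only entry is on the diagonal and vanishes. -/
lemma term_eq (x : ShiftCompletion A) :
    shiftBy x.shift (translate x.deg (single k x.obj)) = term x := by
  have h {n : ℕ} (hn : Subsingleton (Fin n)) {x x' : Fin n → ShiftCompletion A} {q q'}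
      {h₁ h₂ h₃ h₁' h₂' h₃'} (h : x = x') :
      (⟨n, x, q, h₁, h₂, h₃⟩ : Tw k A) = ⟨n, x', q', h₁', h₂', h₃'⟩ := by
    subst h
    obtain rfl : q = q' := by
      funext i j
      obtain rfl := Subsingleton.elim i j
      rw [h₁ i i le_rfl, h₁' i i le_rfl]
    rfl
  exact h (inferInstanceAs (Subsingleton (Fin 1)))
    (funext fun _ => ShiftCompletion.ext rfl (zero_add _) (zero_add _))

lemma isomorphic_of_size_eq_zero {Y Z : Tw k A} (hY : FilteredDGCategory.id (k := k) Y = 0)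
    (hZ : Z.size = 0) : Isomorphic k Y Z := by
  have hZ' : FilteredDGCategory.id (k := k) Z = 0 := by
    funext i
    exact (hZ ▸ i : Fin 0).elim0
  exact ⟨0, 0, zero_mem _, zero_mem _, by rw [map_zero, hY], by rw [map_zero, hZ']⟩

lemma inclusion_bijective (X Y : A) (n : ℤ) : Function.Bijective (singleHom (k := k) X Y n) := by
  refine Function.bijective_iff_has_inverse.2 ⟨fun f => degCast k (A := A) (X := X) (Y := Y)
    (show n + 0 - 0 = n by omega) (f (0 : Fin 1) (0 : Fin 1)), fun f => degCast_degCast k (A := A) _ _ _, fun f => ?_⟩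
  funext i j
  obtain rfl := Subsingleton.elim (α := Fin 1) 0 i
  obtain rfl := Subsingleton.elim (α := Fin 1) 0 j
  exact degCast_degCast k (A := A) _ _ _

lemma len_singleHom (X Y : A) (n : ℤ) (f : hom k X Y n) : len (singleHom X Y n f) = len f := by
  refine le_antisymm ((inclusion k A).len_map_le f) ?_
  refine le_trans (le_of_eq ?_) (Mat.le_len (k := k) (singleHom X Y n f) (0 : Fin 1) (0 : Fin 1))
  have e : len f = len (degCast k (A := A) (X := X) (Y := Y) (show n = n + 0 - 0 by omega) f) +
      ((0 - 0 : ℝ) : WithBot ℝ) := by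
    rw [len_degCast]; simp
  exact e

/-- Every twisted complex is isomorphic to an object of `A`, if `A` has cones. -/
lemma exists_isomorphic [ConeStable k A] (Z : Tw k A) :
    ∃ X : A, Isomorphic k (single k X) Z := by
  obtain ⟨n, obj, q, h₁, h₂, h₃⟩ := Z
  induction n with
  | zero =>
    obtain ⟨X, hX⟩ := ConeStable.exists_zero (k := k) (B := A)
    refine ⟨X, isomorphic_of_size_eq_zero ?_ rfl⟩
    rw [← singleHom_id, hX, map_zero]
  | succ n ih =>
    let F := inclusion k A
    obtain ⟨f, hf, c, hc⟩ := exists_coneData_initTerms obj q h₁ h₂ h₃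
    let W : Tw k A := initTerms obj q h₁ h₂ h₃
    -- The induction is on the number of terms; `W` has one term fewer.
    obtain ⟨Y, hY⟩ : ∃ Y : A, Isomorphic k (single k Y) W :=
      ih W.obj W.q W.q_eq_zero W.d_q W.len_q_le
    let x := obj (Fin.last n)
    -- The other end of the attaching morphism, the last term translated by `-1`, is built from an
    -- object of `A` by operations that `A` itself possesses and the inclusion respects up to
    -- isomorphism.
    have hX : Isomorphic k
        (F.obj (ConeStable.tr k (-1) (ConeStable.sh k x.shift (ConeStable.tr k x.deg x.obj))))
        (translate (-1) (term x)) := by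
      have e : Isomorphic k (F.obj x.obj) (F.obj x.obj) :=
        ⟨_, _, id_mem_cycles _, id_mem_cycles _, FilteredDGCategory.id_comp _,
          FilteredDGCategory.id_comp _⟩
      rw [← term_eq]
      exact F.isomorphic_tr _ (F.isomorphic_sh _ (F.isomorphic_tr _ e))
    obtain ⟨a, a', ha, ha', e₁, e₂⟩ := isomorphic_iff.1 hX
    obtain ⟨b, b', hb, hb', e₃, e₄⟩ := isomorphic_iff.1 hY
    let c' := c.conj ha' ha hb' hb e₂ e₁ e₄ e₃
    -- After conjugation the attaching morphism joins objects in the image, so fullness gives `f₀`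
    -- in `A`. It is closed of level ≤ 0 by faithfulness and preservation of the filtration
    -- function.
    obtain ⟨f₀, hf₀⟩ := (inclusion_bijective _ Y 0).2 (comp (add_zero 0) b' (comp (add_zero 0) f a))
    have hm : f₀ ∈ cycles k _ _ 0 := by
      have hm' := comp_mem_cycles (add_zero 0) hb' (comp_mem_cycles (add_zero 0) hf ha)
      refine ⟨(inclusion_bijective _ _ _).1 ?_, ?_⟩
      · refine (F.map_d 0 1 f₀).trans ?_
        refine (congrArg (d 0 1) hf₀).trans (hm'.1.trans (map_zero _).symm)
      · exact (len_singleHom _ _ _ f₀).symm.le.trans ((congrArg len hf₀).le.trans hm'.2)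
    obtain ⟨c₀⟩ := ConeStable.exists_cone f₀ hm
    -- The inclusion maps the cone of `f₀` in `A` to a cone of the conjugated morphism, and the
    -- given complex is another one; cones of the same morphism are isomorphic.
    have key {g : hom k _ _ 0} (hg : F.map f₀ = g) (c₁ : ConeData g) :
        Isomorphic k (F.obj c₀.pt) c₁.pt := by
      subst hg
      exact (c₀.map F).isomorphic c₁
    exact ⟨c₀.pt, hc ▸ key hf₀ c'⟩

end Tw

lemma ConeStable.isPretriangulated (k : Type w) [Field k] (A : Type u)
    [FilteredDGCategory.{w, v} k A] [ConeStable k A] : IsPretriangulated k A :=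
  ⟨Tw.inclusion_bijective, Tw.len_singleHom, Tw.exists_isomorphic⟩

end FiltDG

/-! ### Filtered cochain complexes. -/

namespace FiltDG

open FilteredDGCategory CochainComplex CochainComplex.HomComplex

namespace FilteredComplex

variable {k : Type w} [Field k] {X Y Z : FilteredComplex.{w, v} k}

/-- The cochain underlying a morphism of filtered complexes. -/
def toCochain {n : ℤ} (f : hom k X Y n) : Cochain X.complex Y.complex n :=
  Subtype.val (p := fun f => f ∈ homSubmodule X Y n) f

lemma toCochain_injective {n : ℤ} {f g : hom k X Y n} (h : toCochain f = toCochain g) : f = g :=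
  Subtype.ext (p := fun f => f ∈ homSubmodule X Y n) h

/-- A cochain which does not increase the filtration, as a morphism of filtered complexes. -/
def ofCochain {n : ℤ} (f : Cochain X.complex Y.complex n) (hf : IsBoundedBy f 0) : hom k X Y n :=
  (⟨f, 0, hf⟩ : homSubmodule X Y n)

lemma len_ofCochain {n : ℤ} (f : Cochain X.complex Y.complex n) (hf : IsBoundedBy f 0) :
    FilteredDGCategory.len (ofCochain f hf) ≤ 0 :=
  (homLen_le_iff ⟨0, hf⟩ 0).2 hf

lemma isBoundedBy_of_len_le {n : ℤ} {f : hom k X Y n} (h : FilteredDGCategory.len f ≤ 0) :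
    IsBoundedBy (toCochain f) 0 :=
  (homLen_le_iff (Subtype.property (p := fun f => f ∈ homSubmodule X Y n) f) 0).1 h

lemma isBoundedBy_iff {n : ℤ} (f : Cochain X.complex Y.complex n) : IsBoundedBy f 0 ↔
    ∀ (p q : ℤ) (h : p + n = q) (x : X.complex.X p), Y.len (f.v p q h x) ≤ X.len x := by
  simp [IsBoundedBy]

/-! #### Translations -/

section

variable (n : ℤ) (C : CochainComplex (ModuleCat.{v} k) ℤ)

/-- The identity, as a cochain `C → C[n]` of degree `-n`. -/
def toTrCochain : Cochain C ((CategoryTheory.shiftFunctor _ n).obj C) (-n) :=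
  (Cochain.ofHom (𝟙 C)).rightShift n (-n) (neg_add_cancel n)

/-- The identity, as a cochain `C[n] → C` of degree `n`. -/
def ofTrCochain : Cochain ((CategoryTheory.shiftFunctor _ n).obj C) C n :=
  (Cochain.ofHom (𝟙 ((CategoryTheory.shiftFunctor _ n).obj C))).rightUnshift n (zero_add n)

lemma toTrCochain_v (q : ℤ) : (toTrCochain n C).v (q + n) q (by omega) = 𝟙 (C.X (q + n)) := by
  rw [toTrCochain, Cochain.rightShift_v _ n (-n) (neg_add_cancel n) (q + n) q _ (q + n)
    (add_zero _)]
  simp [shiftFunctorObjXIso]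
  exact Category.id_comp (𝟙 (C.X (q + n)))

lemma ofTrCochain_v (p : ℤ) : (ofTrCochain n C).v p (p + n) rfl = 𝟙 (C.X (p + n)) := by
  rw [ofTrCochain, Cochain.rightUnshift_v _ n (zero_add n) p (p + n) rfl p (add_zero p)]
  simp [shiftFunctorObjXIso]

/-- Shifting the target commutes with the differential up to sign, and the identity is closed. -/
lemma δ_toTrCochain : δ (-n) (-n + 1) (toTrCochain n C) = 0 := by
  rw [toTrCochain, Cochain.δ_rightShift (Cochain.ofHom (𝟙 C)) n (-n) (-n + 1)
    (neg_add_cancel n) 1 (by omega), δ_ofHom, Cochain.rightShift_zero, smul_zero]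

lemma δ_ofTrCochain : δ n (n + 1) (ofTrCochain n C) = 0 := by
  rw [ofTrCochain, Cochain.δ_rightUnshift _ n (zero_add n) (n + 1) 1 (by omega), δ_ofHom,
    Cochain.rightUnshift_zero, smul_zero]

lemma toTrCochain_comp_ofTrCochain :
    (toTrCochain n C).comp (ofTrCochain n C) (neg_add_cancel n) = Cochain.ofHom (𝟙 C) := by
  ext p
  obtain ⟨q, rfl⟩ : ∃ q, p = q + n := ⟨p - n, by omega⟩
  rw [Cochain.comp_v _ _ _ (q + n) q (q + n) (by omega) rfl, toTrCochain_v, ofTrCochain_v]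
  simp

lemma ofTrCochain_comp_toTrCochain :
    (ofTrCochain n C).comp (toTrCochain n C) (add_neg_cancel n) = Cochain.ofHom (𝟙 _) := by
  ext p
  rw [Cochain.comp_v _ _ _ p (p + n) p rfl (by omega), toTrCochain_v, ofTrCochain_v]
  simp

end

lemma isBoundedBy_toTrCochain (n : ℤ) (X : FilteredComplex.{w, v} k) :
    IsBoundedBy (X := X) (Y := translate n X) (toTrCochain n X.complex) 0 := by
  refine (isBoundedBy_iff (X := X) (Y := translate n X) _).2 fun p q h x => ?_
  obtain rfl : p = q + n := by omega
  exact (congrArg X.len (ConcreteCategory.congr_hom (toTrCochain_v n X.complex q) x)).le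

lemma isBoundedBy_ofTrCochain (n : ℤ) (X : FilteredComplex.{w, v} k) :
    IsBoundedBy (X := translate n X) (Y := X) (ofTrCochain n X.complex) 0 := by
  refine (isBoundedBy_iff (X := translate n X) (Y := X) _).2 fun p q h x => ?_
  obtain rfl := h
  exact (congrArg X.len (ConcreteCategory.congr_hom (ofTrCochain_v n X.complex p) x)).le

/-- The canonical morphism `X → X[n]` of degree `-n`. -/
def toTr (n : ℤ) (X : FilteredComplex.{w, v} k) : hom k X (translate n X) (-n) :=
  ofCochain _ (isBoundedBy_toTrCochain n X)

/-- The canonical morphism `X[n] → X` of degree `n`. -/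
def ofTr (n : ℤ) (X : FilteredComplex.{w, v} k) : hom k (translate n X) X n :=
  ofCochain _ (isBoundedBy_ofTrCochain n X)

lemma toTr_ofTr (n : ℤ) (X : FilteredComplex.{w, v} k) :
    comp (neg_add_cancel n) (toTr n X) (ofTr n X) = FilteredDGCategory.id (translate n X) :=
  toCochain_injective (ofTrCochain_comp_toTrCochain n X.complex)

/-! #### Cones -/

section

variable (φ : X.complex ⟶ Y.complex) (hφ : IsBoundedBy (Cochain.ofHom φ) 0)

/-- The mapping cone, with the filtration function `ℓ(x, y) = max (ℓ(x)) (ℓ(y))`. -/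
noncomputable def cone : FilteredComplex.{w, v} k where
  complex := mappingCone φ
  len {i} x := max (X.len ((mappingCone.fst φ).1.v i (i + 1) rfl x))
    (Y.len ((mappingCone.snd φ).v i i (add_zero i) x))
  len_smul_add_le {i} a x y ha := by
    simp only [map_add, map_smul]
    refine (max_le_max (X.len_smul_add_le a _ _ ha) (Y.len_smul_add_le a _ _ ha)).trans ?_
    rw [max_max_max_comm]
  len_eq_bot_iff {i} x := by
    rw [max_eq_bot, X.len_eq_bot_iff, Y.len_eq_bot_iff]
    refine ⟨fun h => ?_, fun h => by simp [h]⟩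
    -- The decomposition of the identity recovers `x` from its two components, so `x` vanishes as
    -- soon as both do.
    have e := ConcreteCategory.congr_hom (mappingCone.id_X φ i (i + 1) rfl) x
    simp at e
    rw [← e, h.1, h.2]
    simp
  len_d_le i j x := by
    by_cases hij : i + 1 = j
    -- In components the differential is `(x, y) ↦ (-∂x, φ x + ∂y)`. The mixed term `φ x` is
    -- controlled by the assumption that `φ` has level ≤ 0.
    · have h₁ := ConcreteCategory.congr_hom (mappingCone.d_fst_v φ i j (j + 1) hij rfl) x
      have h₂ := ConcreteCategory.congr_hom (mappingCone.d_snd_v φ i j hij) x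
      subst hij
      simp at h₁ h₂
      rw [h₁, h₂]
      refine max_le (le_max_of_le_left ?_) ((Y.len_add_le _ _).trans (max_le_max ?_ ?_))
      · rw [← neg_one_smul k]
        exact (X.len_smul_le _ _).trans (X.len_d_le _ _ _)
      · have h := (isBoundedBy_iff _).1 hφ _ _ (add_zero (i + 1))
          ((mappingCone.fst φ).1.v i (i + 1) rfl x)
        rw [Cochain.ofHom_v] at h
        exact h
      · exact Y.len_d_le _ _ _
    · rw [HomologicalComplex.shape _ _ _ hij]
      simp

lemma isBoundedBy_fst : IsBoundedBy (X := cone φ hφ) (Y := X) (mappingCone.fst φ).1 0 := by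
  refine (isBoundedBy_iff (X := cone φ hφ) (Y := X) _).2 fun p q h x => ?_
  subst h
  exact le_max_left _ _

lemma isBoundedBy_snd : IsBoundedBy (X := cone φ hφ) (Y := Y) (mappingCone.snd φ) 0 := by
  refine (isBoundedBy_iff (X := cone φ hφ) (Y := Y) _).2 fun p q h x => ?_
  obtain rfl : p = q := by omega
  exact le_max_right _ _

lemma isBoundedBy_inl : IsBoundedBy (X := X) (Y := cone φ hφ) (mappingCone.inl φ) 0 := by
  refine (isBoundedBy_iff (X := X) (Y := cone φ hφ) _).2 fun p q h x => ?_
  obtain rfl : p = q + 1 := by omega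
  have h₁ := ConcreteCategory.congr_hom (mappingCone.inl_v_fst_v φ (q + 1) q rfl) x
  have h₂ := ConcreteCategory.congr_hom (mappingCone.inl_v_snd_v φ (q + 1) q h) x
  exact max_le (congrArg X.len h₁).le ((congrArg Y.len h₂).le.trans ((Y.len_zero _).le.trans bot_le))

lemma isBoundedBy_inr :
    IsBoundedBy (X := Y) (Y := cone φ hφ) (Cochain.ofHom (mappingCone.inr φ)) 0 := by
  refine (isBoundedBy_iff (X := Y) (Y := cone φ hφ) _).2 fun p q h x => ?_
  obtain rfl : p = q := by omega
  have h₁ := ConcreteCategory.congr_hom (mappingCone.inr_f_fst_v φ p (p + 1) rfl) x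
  have h₂ := ConcreteCategory.congr_hom (mappingCone.inr_f_snd_v φ p) x
  have e := Cochain.ofHom_v (mappingCone.inr φ) p
  refine (congrArg (fun f : Y.complex.X p ⟶ (mappingCone φ).X p =>
    (cone φ hφ).len (ConcreteCategory.hom f x)) e).le.trans ?_
  exact max_le ((congrArg X.len h₁).le.trans ((X.len_zero _).le.trans bot_le))
    (congrArg Y.len h₂).le

/-- The mapping cone is a cone in the filtered dg-category of filtered complexes. -/
noncomputable def coneData : ConeData (ofCochain (Cochain.ofHom φ) hφ) where
  pt := cone φ hφ
  incl := ofCochain _ (isBoundedBy_inr φ hφ)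
  ret := ofCochain _ (isBoundedBy_snd φ hφ)
  sec := ofCochain _ (isBoundedBy_inl φ hφ)
  proj := ofCochain _ (isBoundedBy_fst φ hφ)
  d_incl := toCochain_injective (δ_ofHom (mappingCone.inr φ))
  d_ret := toCochain_injective (mappingCone.δ_snd φ)
  d_sec := toCochain_injective ((mappingCone.δ_inl φ).trans (Cochain.ofHom_comp _ _))
  d_proj := toCochain_injective ((mappingCone.fst φ).δ_eq_zero 2)
  len_incl := len_ofCochain _ _
  len_ret := len_ofCochain _ _
  len_sec := len_ofCochain _ _
  len_proj := len_ofCochain _ _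
  ret_incl := toCochain_injective (mappingCone.inr_snd φ)
  proj_sec := toCochain_injective (mappingCone.inl_fst φ)
  proj_incl := toCochain_injective (mappingCone.inr_fst φ)
  ret_sec := toCochain_injective (mappingCone.inl_snd φ)
  total := toCochain_injective ((add_comm _ _).trans (mappingCone.id φ))

end

/-- A closed cochain of degree 0 is a chain map, and its level bound holds pointwise because the
infimum defining the filtration function is attained. This is the form in which the mapping cone
applies. -/
lemma exists_ofCochain_eq (f : hom k X Y 0) (hf : f ∈ cycles k X Y 0) :
    ∃ (φ : X.complex ⟶ Y.complex) (hφ : IsBoundedBy (Cochain.ofHom φ) 0),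
      ofCochain (Cochain.ofHom φ) hφ = f := by
  have hd : δ 0 1 (toCochain f) = 0 := congrArg toCochain hf.1
  have e : Cochain.ofHom (Cocycle.homOf (Cocycle.mk (toCochain f) 1 (zero_add 1) hd)) =
      toCochain f := Cocycle.cochain_ofHom_homOf_eq_coe _
  have hb : IsBoundedBy (toCochain f) 0 := isBoundedBy_of_len_le hf.2
  exact ⟨_, e.symm ▸ hb, toCochain_injective e⟩

/-- The zero complex. -/
def zeroComplex (k : Type w) [Field k] : FilteredComplex.{w, v} k where
  complex :=
    { X := fun _ => ModuleCat.of k PUnit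
      d := fun _ _ => 0 }
  len _ := ⊥
  len_smul_add_le _ _ _ _ := bot_le
  len_eq_bot_iff _ := iff_of_true rfl rfl
  len_d_le _ _ _ := le_rfl

noncomputable instance coneStable : ConeStable k (FilteredComplex.{w, v} k) where
  sh := shiftBy
  toSh := toShift
  ofSh := fromShift
  toSh_mem := toShift_mem
  ofSh_mem := fromShift_mem
  ofSh_toSh r X := toCochain_injective (Cochain.id_comp (Cochain.ofHom (𝟙 X.complex)))
  toSh_ofSh r X := toCochain_injective (Cochain.id_comp (Cochain.ofHom (𝟙 X.complex)))
  tr := translate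
  toTr := toTr
  ofTr := ofTr
  d_toTr n X := toCochain_injective (δ_toTrCochain n X.complex)
  d_ofTr n X := toCochain_injective (δ_ofTrCochain n X.complex)
  len_toTr n X := len_ofCochain _ _
  len_ofTr n X := len_ofCochain _ _
  ofTr_toTr n X := toCochain_injective (toTrCochain_comp_ofTrCochain n X.complex)
  toTr_ofTr := toTr_ofTr
  exists_zero := ⟨zeroComplex k, toCochain_injective (by
    ext p x
    rfl)⟩
  exists_cone f hf := by
    obtain ⟨φ, hφ, rfl⟩ := exists_ofCochain_eq f hf
    exact ⟨coneData φ hφ⟩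

/-! #### The triangulated persistence structure -/

/-- The triangulated persistence structure on the degree-`0` cohomology category of filtered
complexes. -/
noncomputable def tpc : TPC k (H0 k (FilteredComplex.{w, v} k)) (shiftFunctor k) :=
  ConeStable.tpc k (FilteredComplex.{w, v} k)

lemma tpc_isTranslateTPC : IsTranslateTPC (tpc (k := k)) := fun _ => rfl

/-- The complex `X` with another filtration function. -/
def withLen (X : FilteredComplex.{w, v} k) (l : ∀ i : ℤ, X.complex.X i → WithBot ℝ)
    (h₁ : ∀ (i : ℤ) (a : k) (x y : X.complex.X i), a ≠ 0 → l i (a • x + y) ≤ max (l i x) (l i y))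
    (h₂ : ∀ (i : ℤ) (x : X.complex.X i), l i x = ⊥ ↔ x = 0)
    (h₃ : ∀ (i j : ℤ) (x : X.complex.X i), l j (X.complex.d i j x) ≤ l i x) :
    FilteredComplex.{w, v} k where
  complex := X.complex
  len {i} x := l i x
  len_smul_add_le := h₁ _
  len_eq_bot_iff := h₂ _
  len_d_le := h₃

/-- As for twisted complexes, strictness compares objects that differ only in propositionally equal
filtration functions. Substituting the function turns the transport into the identity. -/
lemma eqTo_withLen (X : FilteredComplex.{w, v} k) {l l' : ∀ i : ℤ, X.complex.X i → WithBot ℝ}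
    (hl : l = l') {h₁ h₂ h₃ h₁' h₂' h₃'}
    (f : hom k (withLen X l h₁ h₂ h₃) (withLen X l' h₁' h₂' h₃') 0) (hf : f ∈ cycles k _ _ 0)
    (h_id : toCochain f = Cochain.ofHom (𝟙 X.complex)) :
    ∃ e : (⟨withLen X l h₁ h₂ h₃⟩ : H0 k (FilteredComplex.{w, v} k)) = ⟨withLen X l' h₁' h₂' h₃'⟩,
      H0Hom.mk f hf = PersistenceCategory.eqTo k e := by
  subst hl
  exact ⟨rfl, congrArg _ (Subtype.ext (toCochain_injective h_id))⟩

lemma shiftFunctor_isStrict : (shiftFunctor.{w, v} k).IsStrict := by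
  refine ⟨fun X => ?_, fun r s X => ?_⟩
  · exact eqTo_withLen X.obj (l := fun i => X.obj.len) (l' := fun i => (shiftBy 0 X.obj).len)
      (by funext i x; exact (add_zero (X.obj.len x)).symm)
      (h₁ := fun _ => X.obj.len_smul_add_le) (h₂ := fun _ => X.obj.len_eq_bot_iff)
      (h₃ := X.obj.len_d_le) (h₁' := fun _ => (shiftBy 0 X.obj).len_smul_add_le)
      (h₂' := fun _ => (shiftBy 0 X.obj).len_eq_bot_iff)
      (h₃' := (shiftBy 0 X.obj).len_d_le) (toShift 0 X.obj) (toShift_mem 0 X.obj) rfl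
  · refine eqTo_withLen X.obj (l := fun i => (shiftBy s (shiftBy r X.obj)).len)
      (l' := fun i => (shiftBy (r + s) X.obj).len)
      (by funext i x; exact (add_assoc (X.obj.len x) r s))
      (h₁ := fun _ => (shiftBy s (shiftBy r X.obj)).len_smul_add_le)
      (h₂ := fun _ => (shiftBy s (shiftBy r X.obj)).len_eq_bot_iff)
      (h₃ := (shiftBy s (shiftBy r X.obj)).len_d_le)
      (h₁' := fun _ => (shiftBy (r + s) X.obj).len_smul_add_le)
      (h₂' := fun _ => (shiftBy (r + s) X.obj).len_eq_bot_iff)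
      (h₃' := (shiftBy (r + s) X.obj).len_d_le) (ConeStable.shAdd k r s X.obj)
      (ConeStable.shAdd_mem r s X.obj) ?_
    exact (Cochain.comp_id _).trans (Cochain.comp_id _)

/-- Two adjustments are needed: the differential acquires the sign `(-1)^b (-1)^a`, which is `1`,
and the degrees are reindexed by `i ↦ i + b + a`, which is the identity map. -/
lemma translate_translate {a b : ℤ} (h : a + b = 0) (X : FilteredComplex.{w, v} k) :
    translate b (translate a X) = X := by
  have mk_eq {V : ℤ → ModuleCat.{v} k} {d d' : ∀ i j, V i ⟶ V j} {h₁ h₂ h₁' h₂'}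
      {l : ∀ {i : ℤ}, V i → WithBot ℝ} {h₃ h₄ h₅ h₃' h₄' h₅'} (hd : d = d') :
      (⟨⟨V, d, h₁, h₂⟩, l, h₃, h₄, h₅⟩ : FilteredComplex.{w, v} k) =
        ⟨⟨V, d', h₁', h₂'⟩, l, h₃', h₄', h₅'⟩ := by
    subst hd; rfl
  -- With the reindexing map as a variable, all its occurrences in the complex, the differential and
  -- the filtration function are replaced at once.
  have reindex (φ : ℤ → ℤ) (hφ : φ = _root_.id) {h₁ h₂ h₃ h₄ h₅} :
      (⟨⟨fun i => X.complex.X (φ i), fun i j => X.complex.d (φ i) (φ j), h₁, h₂⟩,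
        fun {i} x => X.len (i := φ i) x, h₃, h₄, h₅⟩ : FilteredComplex.{w, v} k) = X := by
    subst hφ; rfl
  have hφ : (fun i : ℤ => i + b + a) = _root_.id := by
    funext i
    simp only [_root_.id]
    omega
  refine Eq.trans ?_ (reindex (fun i => i + b + a) hφ (h₁ := fun i j hij =>
    X.complex.shape _ _ fun e => hij (by change _ + 1 = _ at e; change _ + 1 = _; omega)) (h₂ := fun i j l _ _ => X.complex.d_comp_d _ _ _)
    (h₃ := X.len_smul_add_le) (h₄ := X.len_eq_bot_iff) (h₅ := fun i j => X.len_d_le _ _))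
  refine mk_eq (funext fun i => funext fun j => ?_)
  change b.negOnePow • a.negOnePow • X.complex.d (i + b + a) (j + b + a) = _
  rw [smul_smul, ← Int.negOnePow_add, add_comm b a, h, Int.negOnePow_zero, one_smul]

lemma shTr_eq (r : ℝ) (X : FilteredComplex.{w, v} k) : ConeStable.shTr k r 1 X =
    FilteredDGCategory.id (translate 1 (shiftBy r X)) := by
  refine Eq.trans ?_ (toTr_ofTr 1 (shiftBy r X))
  refine congrArg (comp (neg_add_cancel 1) (toTr 1 (shiftBy r X))) ?_
  exact toCochain_injective ((Cochain.comp_id _).trans (Cochain.id_comp _))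

lemma tpc_isStrict : (tpc.{w, v} (k := k)).IsStrict := by
  refine ⟨shiftFunctor_isStrict, Function.bijective_iff_has_inverse.2
    ⟨fun X => ⟨⟨translate (-1) X.obj.obj⟩⟩, fun X => ?_, fun X => ?_⟩, fun r X => ⟨rfl, ?_⟩⟩
  · exact congrArg (fun Y => (⟨⟨Y⟩⟩ : Level0 k (H0 k (FilteredComplex.{w, v} k))))
      (translate_translate (add_neg_cancel 1) X.obj.obj)
  · exact congrArg (fun Y => (⟨⟨Y⟩⟩ : Level0 k (H0 k (FilteredComplex.{w, v} k))))
      (translate_translate (neg_add_cancel 1) X.obj.obj)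
  · exact congrArg _ (Subtype.ext (shTr_eq r X.obj.obj))

end FilteredComplex

end FiltDG

/-! ### The theorem. -/

theorem mainTheorem5 (k : Type w) [Field k] :
    (∀ (A : Type u) [FiltDG.FilteredDGCategory.{w, v} k A],
      ∃ t : FiltDG.TPC k (FiltDG.H0 k (FiltDG.Tw k A)) (FiltDG.Tw.shiftFunctor k A),
        t.IsStrict ∧ FiltDG.Tw.IsConeTPC t) ∧
    (∀ (A : Type u) [FiltDG.FilteredDGCategory.{w, v} k A], FiltDG.IsPretriangulated k A →
      ∃ S : FiltDG.ShiftFunctor k (FiltDG.H0 k A), Nonempty (FiltDG.TPC k (FiltDG.H0 k A) S)) ∧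
    FiltDG.IsPretriangulated k (FiltDG.FilteredComplex.{w, v} k) ∧
    ∃ t : FiltDG.TPC k (FiltDG.H0 k (FiltDG.FilteredComplex.{w, v} k))
        (FiltDG.FilteredComplex.shiftFunctor k),
      t.IsStrict ∧ FiltDG.FilteredComplex.IsTranslateTPC t := by
  refine ⟨fun A _ => ⟨FiltDG.Tw.tpc, FiltDG.Tw.tpc_isStrict, FiltDG.Tw.tpc_isConeTPC⟩,
    fun A _ hA => ?_, FiltDG.ConeStable.isPretriangulated k _,
    FiltDG.FilteredComplex.tpc, FiltDG.FilteredComplex.tpc_isStrict,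
    FiltDG.FilteredComplex.tpc_isTranslateTPC⟩
  -- Pre-triangulatedness says that the inclusion into the cone-stable category of twisted complexes
  -- is an equivalence, along which cone stability is pulled back.
  obtain ⟨_⟩ := FiltDG.FilteredDGFunctor.IsEquivalence.nonempty_coneStable hA
  exact ⟨_, ⟨FiltDG.ConeStable.tpc k A⟩⟩
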